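/- **Density Result.** Let $\Omega\subset\mathbb R^2$ be a domain (nonempty, open, connected). A *pattern* $\mathcal G$ is a finite collection of $C^2$ curves $\gamma:[0,l_\gamma]\to\overline\Omega$, $l_\gamma>0$, which are $C^2$ up to the end points, parametrized by arc length $s$, and simple, except that $\gamma(0)=\gamma(l_\gamma)$ is allowed; any two different curves meet at most at points that are end points of both. Let $\Gamma\subset\overline\Omega$ be the union of the curves, end points included. Assume that $\partial\Omega$ is Lipschitz near each point of $\Gamma\cap\partial\Omega$ (for instance, $\Omega$ is a Lipschitz domain), i.e. that near such a point $\Omega$ is, in suitable orthonormal coordinates, the region above the graph of a Lipschitz function. Assume that the pattern is *regular*: * at each node (end point of a curve), the unit tangent vectors, pointing into the curves, of any two curve ends arriving there (including the two ends of one closed curve) are different; * if $p=\gamma(s)\in\partial\Omega$, then $\gamma'(s)$ (when $s<l_\gamma$) and $-\gamma'(s)$ (when $s>0$) are not tangential to $\partial\Omega$ at $p$, where a unit vector $v$ is tangential to $\partial\Omega$ at $p$ if it is a limit of $(x_n-p)/|x_n-p|$ for some sequence $x_n\in\partial\Omega\setminus\{p\}$, $x_n\to p$. The trace $u|_\gamma\in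 L^2(0,l_\gamma)$ of $u\in H^1_0(\Omega)$ is the $L^2$-limit of $\varphi_n\circ\gamma$, for $\varphi_n\in C_0^\infty(\Omega)$ with $\varphi_n\to u$ in $H^1(\Omega)$. Let $$H^{1,0}_\Gamma(\Omega)=\{u\in H^1_0(\Omega):\ u|_\gamma\in H^1(0,l_\gamma)\ \text{for all }\gamma\in\mathcal G\},\qquad \|u\|^2=\int_\Omega|\nabla u|^2+\sum_{\gamma\in\mathcal G}\int_\gamma u_s^2 ,$$ where $u_s$ is the weak arc-length derivative of the trace. Then: 1. $C_0^\infty(\Omega)\subset H^{1,0}_\Gamma(\Omega)$, and $C_0^\infty(\Omega)$ is dense in $H^{1,0}_\Gamma(\Omega)$: for every $u\in H^{1,0}_\Gamma(\Omega)$ and $\varepsilon>0$ there is $\varphi\in C_0^\infty(\Omega)$ with $\|u-\varphi\|<\varepsilon$. 2. For every $u\in H^{1,0}_\Gamma(\Omega)$ the traces $u|_\gamma$ have continuous representatives $W_\gamma$ on $[0,l_\gamma]$. These agree where curves meet: $W_\gamma(s)=W_{\gamma'}(t)$ whenever $\gamma(s)=\gamma'(t)$ (including $\gamma=\gamma'$).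 They vanish on the boundary: $W_\gamma(s)=0$ whenever $\gamma(s)\in\partial\Omega$. -/

import Mathlib

open MeasureTheory Filter Topology Set
open scoped ContDiff

/-- The Euclidean plane. -/
abbrev Plane : Type := EuclideanSpace ℝ (Fin 2)

/-- `φ ∈ C₀^∞(U)`: smooth, with compact support contained in `U`. -/
structure IsTestFunction {E : Type*} [NormedAddCommGroup E] [NormedSpace ℝ E]
    (U : Set E) (φ : E → ℝ) : Prop where
  contDiff : ContDiff ℝ ∞ φ
  hasCompactSupport : HasCompactSupport φ
  tsupport_subset : tsupport φ ⊆ U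

/-- A simple `C²` curve in the plane, regular up to its end points, parametrized by arc length on
`[0, length]`. It may be closed (`toFun 0 = toFun length`, with or without a corner there), and has
no other self-intersection. The values of `toFun` outside `[0, length]` play no role. -/
structure PlaneArc where
  length : ℝ
  length_pos : 0 < length
  toFun : ℝ → Plane
  contDiffOn : ContDiffOn ℝ 2 toFun (Icc 0 length)
  unit_speed : ∀ s ∈ Icc 0 length, ‖derivWithin toFun (Icc 0 length) s‖ = 1
  simple : ∀ s ∈ Icc 0 length, ∀ t ∈ Icc 0 length, s < t → toFun s = toFun t →
    s = 0 ∧ t = length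

namespace PlaneArc

/-- The unit tangent, in the direction of increasing arc length (one-sided at the end points). -/
noncomputable def tangent (γ : PlaneArc) (s : ℝ) : Plane :=
  derivWithin γ.toFun (Icc 0 γ.length) s

/-- The set of points of the curve, end points included. -/
def carrier (γ : PlaneArc) : Set Plane := γ.toFun '' Icc 0 γ.length

/-- The parameter of the initial (`false`) or of the final (`true`) end. -/
def endParam (γ : PlaneArc) (b : Bool) : ℝ := if b then γ.length else 0

/-- The unit tangent at an end of the curve that points into the curve. -/
noncomputable def endTangent (γ : PlaneArc) (b : Bool) : Plane :=
  if b then -γ.tangent γ.length else γ.tangent 0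

/-- The arc-length derivative of the restriction of `φ` to the curve. -/
noncomputable def arcDeriv (γ : PlaneArc) (φ : Plane → ℝ) (s : ℝ) : ℝ :=
  derivWithin (fun t => φ (γ.toFun t)) (Icc 0 γ.length) s

end PlaneArc

/-- A pattern: a family of `C²` curves (indexed by a finite type in the theorem), any two of which
meet at most at points that are end points of both. -/
structure Pattern (ι : Type*) where
  arc : ι → PlaneArc
  meet_at_ends : ∀ i j, i ≠ j → ∀ s ∈ Icc 0 (arc i).length, ∀ t ∈ Icc 0 (arc j).length,
    (arc i).toFun s = (arc j).toFun t →
      (s = 0 ∨ s = (arc i).length) ∧ (t = 0 ∨ t = (arc j).length)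

/-- The union of the curves of the pattern, end points included. -/
def Pattern.carrier {ι : Type*} (G : Pattern ι) : Set Plane := ⋃ i, (G.arc i).carrier

/-- The unit direction `v` at `p` is not tangential to the set `S`: near `p` the directions from
`p` to the other points of `S` stay away from `v`, i.e. a truncated cone with vertex `p` and axis
`v` meets `S` at most in `p`. -/
def NontangentialTo (S : Set Plane) (p v : Plane) : Prop :=
  ∃ ε > 0, ∀ x ∈ S, x ≠ p → ‖x - p‖ < ε → inner ℝ (x - p) v ≤ (1 - ε) * ‖x - p‖

/-- Regularity of a pattern in `Ω`. At each node the ends of curves that arrive there (two ends of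
one closed curve included) point in different directions, i.e. they are mutually nontangential;
opposite directions are allowed. At each point of `∂Ω` the curve leaves the point nontangentially
to `∂Ω`, in each of the directions in which it continues. -/
structure Pattern.IsRegular {ι : Type*} (G : Pattern ι) (Ω : Set Plane) : Prop where
  nodes : ∀ i j b c, (i, b) ≠ (j, c) →
    (G.arc i).toFun ((G.arc i).endParam b) = (G.arc j).toFun ((G.arc j).endParam c) →
      (G.arc i).endTangent b ≠ (G.arc j).endTangent c
  boundary : ∀ i, ∀ s ∈ Icc 0 (G.arc i).length, (G.arc i).toFun s ∈ frontier Ω →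
    (s < (G.arc i).length →
      NontangentialTo (frontier Ω) ((G.arc i).toFun s) ((G.arc i).tangent s)) ∧
    (0 < s →
      NontangentialTo (frontier Ω) ((G.arc i).toFun s) (-(G.arc i).tangent s))

/-- Near `p`, in suitable orthonormal coordinates, `Ω` is the region above the graph of a Lipschitz
function. -/
def IsLipschitzBoundaryAt (Ω : Set Plane) (p : Plane) : Prop :=
  ∃ (R : Plane ≃ₗᵢ[ℝ] Plane) (K : NNReal) (f : ℝ → ℝ) (r : ℝ), LipschitzWith K f ∧ 0 < r ∧
    ∀ x ∈ Metric.ball p r, (x ∈ Ω ↔ f (R x 0) < R x 1)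

/-- `g` is the weak gradient of `u` in `Ω`. -/
def HasWeakGradient (Ω : Set Plane) (u : Plane → ℝ) (g : Plane → Plane) : Prop :=
  ∀ φ : Plane → ℝ, IsTestFunction Ω φ → ∀ e : Plane,
    ∫ x in Ω, u x * fderiv ℝ φ x e = -∫ x in Ω, inner ℝ (g x) e * φ x

/-- `φ n → u` in `H¹(Ω)`, where `g` is the weak gradient of `u`. -/
def TendstoH1 (Ω : Set Plane) (φ : ℕ → Plane → ℝ) (u : Plane → ℝ) (g : Plane → Plane) : Prop :=
  Tendsto (fun n => eLpNorm (fun x => φ n x - u x) 2 (volume.restrict Ω)) atTop (𝓝 0) ∧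
  Tendsto (fun n => eLpNorm (fun x => gradient (φ n) x - g x) 2 (volume.restrict Ω)) atTop (𝓝 0)

/-- `u ∈ H₀¹(Ω)` with weak gradient `g`: `u` lies in `H¹(Ω)`, and in the `H¹(Ω)`-closure of
`C₀^∞(Ω)`. -/
structure IsH10 (Ω : Set Plane) (u : Plane → ℝ) (g : Plane → Plane) : Prop where
  memLp : MemLp u 2 (volume.restrict Ω)
  memLp_grad : MemLp g 2 (volume.restrict Ω)
  hasWeakGradient : HasWeakGradient Ω u g
  mem_closure : ∃ φ : ℕ → Plane → ℝ, (∀ n, IsTestFunction Ω (φ n)) ∧ TendstoH1 Ω φ u g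

/-- `w` is the trace on `γ`, as an element of `L²(γ)` in the arc-length parameter, of the function
`u ∈ H₀¹(Ω)` with weak gradient `g`: the `L²(γ)`-limit of the restrictions to `γ` of functions in
`C₀^∞(Ω)` that converge to `u` in `H¹(Ω)`. -/
structure IsTraceOn (Ω : Set Plane) (γ : PlaneArc) (u : Plane → ℝ) (g : Plane → Plane)
    (w : ℝ → ℝ) : Prop where
  memLp : MemLp w 2 (volume.restrict (Ioo 0 γ.length))
  limit : ∃ φ : ℕ → Plane → ℝ, (∀ n, IsTestFunction Ω (φ n)) ∧ TendstoH1 Ω φ u g ∧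
    Tendsto (fun n => eLpNorm (fun s => φ n (γ.toFun s) - w s) 2
      (volume.restrict (Ioo 0 γ.length))) atTop (𝓝 0)

/-- `w ∈ H¹(0, l)` with weak derivative `dw`. -/
structure IsH1Interval (l : ℝ) (w dw : ℝ → ℝ) : Prop where
  memLp : MemLp w 2 (volume.restrict (Ioo 0 l))
  memLp_deriv : MemLp dw 2 (volume.restrict (Ioo 0 l))
  weak_deriv : ∀ ψ : ℝ → ℝ, IsTestFunction (Ioo 0 l) ψ →
    ∫ s in Ioo 0 l, w s * deriv ψ s = -∫ s in Ioo 0 l, dw s * ψ s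

/-- `u ∈ H_Γ^{1,0}(Ω)`, with weak gradient `g`, traces `w i` on the curves of the pattern and weak
arc-length derivatives `dw i` of these traces (all of them are determined by `u` up to null
sets). -/
structure IsHGamma {ι : Type*} (Ω : Set Plane) (G : Pattern ι) (u : Plane → ℝ)
    (g : Plane → Plane) (w dw : ι → ℝ → ℝ) : Prop where
  isH10 : IsH10 Ω u g
  isTraceOn : ∀ i, IsTraceOn Ω (G.arc i) u g (w i)
  isH1 : ∀ i, IsH1Interval (G.arc i).length (w i) (dw i)

/-- The squared norm of `H_Γ^{1,0}(Ω)`, `∫_Ω |∇u|² + ∑_γ ∫_γ u_s²`, of a function with weak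
gradient `g` and with weak derivatives `dw i` of its traces. -/
noncomputable def hGammaNormSq {ι : Type*} [Fintype ι] (Ω : Set Plane) (G : Pattern ι)
    (g : Plane → Plane) (dw : ι → ℝ → ℝ) : ℝ :=
  (∫ x in Ω, ‖g x‖ ^ 2) + ∑ i, ∫ s in Ioo 0 (G.arc i).length, dw i s ^ 2

open scoped ENNReal NNReal RealInnerProductSpace Convolution

/-! ### The plane in rotated coordinates -/

/-! Values at nodes. In coordinates `x = c u + t • rotJ e` along a graph curve the Jacobian lies
between `κ` and `1`, so one-dimensional estimates on the segments `t ↦ c u + t • rotJ e` integrate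
to trace and strip inequalities (`PlaneArc.exists_trace_le`, `PlaneArc.exists_strip_le`). An `H¹`
function of the plane has no point values. However, if a curve and a ray leave `p` in non-opposite
directions, points over the same abscissa are at distance `O(u)`, so the differences of the values
are square integrable against `du / u`, with a bound by `∫ |∇φ|²`. An `H¹` trace `W` satisfies `|W u
- W 0|² = O(u)`, so it is close to `W 0` in the same sense. Since `du / u` has infinite mass near
`0`, a ray carries at most one such value (`PlaneArc.rayLimit`, `RayLimit.unique`). Two curve ends
at a node can be compared along one common ray, so their values agree. At a Lipschitz boundary point
some ray runs outside `Ω`, where the approximating test functions vanish, so the value is `0`.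

Extension. Conversely, compatible `H¹` functions on the curves are `L²` limits of traces of test
functions of bounded energy (`Pattern.IsRegular.traceApprox`). After subtraction of a test function
with the right node values the curves decouple, and each is cut into short pieces. Regularity
provides, at each point and in each direction of the curve, a truncated cone that lies in `Ω` and
meets the pattern only in that piece. Inside the cone `w u * ζ (t / (θ u))` extends `w`, with energy
at most a constant times `∫ |w'|²`, because `|w u|² ≤ u ∫ |w'|²`.

Correction. Let `φ n → u` in `H¹`; the tangential derivatives of `φ n` are not controlled. Let `f`
be a test function of bounded energy with nearly the right traces, and `η` a cutoff that vanishes on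
the pattern and is `1` at distance `δ` or more. Then `φ n + (1 - η) (f - φ n)` has the traces of
`f`. The gradient `O(1 / δ)` of the cutoff does no harm: the traces of `f - φ n` have squared norm
`O(δ)`, so by the strip inequality its squared mass near the pattern is `O(δ²)`
(`ApproxSeq.exists_bounded`).

Weak to strong. This gives test functions that are bounded in norm and converge to `u` in `L²`,
together with their traces. Their gradients and arc-length derivatives converge weakly, and a weak
limit of a bounded sequence in a subspace of a Hilbert space lies in its norm closure
(`mem_closure_of_tendsto_inner`, `IsHGamma.exists_test_near`). -/

/-- Rotation by a quarter turn. -/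
noncomputable def rotJ (v : Plane) : Plane := !₂[-v 1, v 0]

@[simp] lemma rotJ_zero_coord (v : Plane) : rotJ v 0 = -v 1 := rfl
@[simp] lemma rotJ_one_coord (v : Plane) : rotJ v 1 = v 0 := rfl

lemma plane_inner (x y : Plane) : inner ℝ x y = x 0 * y 0 + x 1 * y 1 := by
  simp [PiLp.inner_apply, Fin.sum_univ_two, mul_comm]

lemma plane_norm_sq (x : Plane) : ‖x‖ ^ 2 = x 0 ^ 2 + x 1 ^ 2 := by
  rw [← real_inner_self_eq_norm_sq, plane_inner]; ring

@[simp] lemma inner_rotJ_self (v : Plane) : inner ℝ (rotJ v) v = 0 := by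
  rw [plane_inner]; simp; ring

@[simp] lemma inner_self_rotJ (v : Plane) : inner ℝ v (rotJ v) = 0 := by
  rw [plane_inner]; simp; ring

@[simp] lemma norm_rotJ (v : Plane) : ‖rotJ v‖ = ‖v‖ := by
  have h : ‖rotJ v‖ ^ 2 = ‖v‖ ^ 2 := by rw [plane_norm_sq, plane_norm_sq]; simp; ring
  exact (sq_eq_sq₀ (norm_nonneg _) (norm_nonneg _)).1 h

lemma unit_coord {e : Plane} (he : ‖e‖ = 1) : e 0 ^ 2 + e 1 ^ 2 = 1 := by
  rw [← plane_norm_sq, he]; norm_num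

lemma frame_decomp {e : Plane} (he : ‖e‖ = 1) (x : Plane) :
    x = (inner ℝ x e) • e + (inner ℝ x (rotJ e)) • rotJ e := by
  have h := unit_coord he
  ext i
  fin_cases i
  · simp [plane_inner]; linear_combination (-(x 0)) * h
  · simp [plane_inner]; linear_combination (-(x 1)) * h

lemma frame_orthonormal {e : Plane} (he : ‖e‖ = 1) : Orthonormal ℝ ![e, rotJ e] := by
  rw [orthonormal_iff_ite]
  intro i j
  fin_cases i <;> fin_cases j <;> simp [he]

lemma measurePreserving_frame {e : Plane} (he : ‖e‖ = 1) :
    MeasurePreserving (fun q : ℝ × ℝ => q.1 • e + q.2 • rotJ e) volume volume := by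
  have hsp : ⊤ ≤ Submodule.span ℝ (Set.range ![e, rotJ e]) := by
    intro x _
    rw [frame_decomp he x]
    refine Submodule.add_mem _ (Submodule.smul_mem _ _ (Submodule.subset_span ⟨0, rfl⟩))
      (Submodule.smul_mem _ _ (Submodule.subset_span ⟨1, rfl⟩))
  let b := OrthonormalBasis.mk (frame_orthonormal he) hsp
  have h1 := b.measurePreserving_repr_symm
  have h2 := (PiLp.volume_preserving_toLp (Fin 2))
  have h3 := (volume_preserving_finTwoArrow ℝ).symm
  have h := h1.comp (h2.comp h3)
  convert! h using 1
  ext1 q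
  have : (b.repr.symm : Plane → Plane) = fun x => ∑ i, x i • b i := by
    ext1 x
    exact (b.sum_repr_symm x).symm
  simp only [Function.comp_apply, this, Fin.sum_univ_two]
  simp [b]

lemma lintegral_frame {e : Plane} (he : ‖e‖ = 1) {f : Plane → ℝ≥0∞} (hf : Measurable f) :
    ∫⁻ x, f x = ∫⁻ x : ℝ, ∫⁻ y : ℝ, f (x • e + y • rotJ e) := by
  rw [← (measurePreserving_frame he).lintegral_comp hf, Measure.volume_eq_prod,
    lintegral_prod]
  exact (hf.comp (measurePreserving_frame he).measurable).aemeasurable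

/-! ### Graph curves -/

/-- A unit speed `C¹` curve defined on the whole line, with derivative `T`, that is a graph over
the line spanned by `e`. -/
structure GraphCurve (e : Plane) (κ : ℝ) (c T : ℝ → Plane) : Prop where
  unit : ‖e‖ = 1
  pos : 0 < κ
  continuous_deriv : Continuous T
  hasDerivAt : ∀ u, HasDerivAt c (T u) u
  norm_deriv : ∀ u, ‖T u‖ = 1
  inner_ge : ∀ u, κ ≤ inner ℝ (T u) e

namespace GraphCurve

variable {e : Plane} {κ : ℝ} {c T : ℝ → Plane}

lemma continuous (h : GraphCurve e κ c T) : Continuous c :=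
  continuous_iff_continuousAt.2 fun u => (h.hasDerivAt u).continuousAt

lemma coord_hasDerivAt (h : GraphCurve e κ c T) (v : Plane) (u : ℝ) :
    HasDerivAt (fun u => inner ℝ (c u) v) (inner ℝ (T u) v) u := by
  simpa using (h.hasDerivAt u).inner ℝ (hasDerivAt_const u v)

lemma inner_le (h : GraphCurve e κ c T) (u : ℝ) : inner ℝ (T u) e ≤ 1 := by
  have := real_inner_le_norm (T u) e
  rwa [h.norm_deriv, h.unit, one_mul] at this

lemma coord_sub_ge (h : GraphCurve e κ c T) {u v : ℝ} (huv : u ≤ v) :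
    κ * (v - u) ≤ inner ℝ (c v) e - inner ℝ (c u) e := by
  have hd : Differentiable ℝ (fun u => inner ℝ (c u) e) :=
    fun u => (h.coord_hasDerivAt e u).differentiableAt
  refine mul_sub_le_image_sub_of_le_deriv hd (fun x => ?_) huv
  rw [(h.coord_hasDerivAt e x).deriv]
  exact h.inner_ge x

lemma norm_sub_le (h : GraphCurve e κ c T) (u v : ℝ) : ‖c v - c u‖ ≤ |v - u| := by
  have := Convex.norm_image_sub_le_of_norm_hasDerivWithin_le (f := c) (f' := T) (C := 1)
    (s := univ) (x := u) (y := v) (fun x _ => (h.hasDerivAt x).hasDerivWithinAt)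
    (fun x _ => (h.norm_deriv x).le) convex_univ trivial trivial
  simpa using this

lemma coord_strictMono (h : GraphCurve e κ c T) : StrictMono (fun u => inner ℝ (c u) e) := by
  intro u v huv
  have h1 := h.coord_sub_ge huv.le
  have h2 : 0 < κ * (v - u) := mul_pos h.pos (by linarith)
  simp only; linarith

lemma coord_continuous (h : GraphCurve e κ c T) : Continuous (fun u => inner ℝ (c u) e) :=
  h.continuous.inner continuous_const

lemma coord_surjective (h : GraphCurve e κ c T) :
    Function.Surjective (fun u => inner ℝ (c u) e) := by
  refine h.coord_continuous.surjective ?_ ?_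
  · refine tendsto_atTop_mono' atTop (f₁ := fun u => κ * u + inner ℝ (c 0) e) ?_ ?_
    · filter_upwards [eventually_ge_atTop 0] with u hu
      have := h.coord_sub_ge hu; linarith
    · exact tendsto_atTop_add_const_right _ _ (tendsto_id.const_mul_atTop h.pos)
  · refine tendsto_atBot_mono' atBot (f₁ := fun u => κ * u + inner ℝ (c 0) e) ?_ ?_
    · filter_upwards [eventually_le_atBot 0] with u hu
      have := h.coord_sub_ge hu; linarith
    · exact tendsto_atBot_add_const_right _ _ (tendsto_id.const_mul_atBot h.pos)

/-- The function on `ℝ` that maps `x` to the integral of `f` over the line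
`{⟪·, e⟫ = x}`, evaluated along the curve. -/
lemma lintegral_line (h : GraphCurve e κ c T) (f : Plane → ℝ≥0∞) (u : ℝ) :
    ∫⁻ t : ℝ, f (c u + t • rotJ e) = ∫⁻ y : ℝ, f ((inner ℝ (c u) e) • e + y • rotJ e) := by
  rw [← lintegral_add_left_eq_self (fun y : ℝ => f ((inner ℝ (c u) e) • e + y • rotJ e))
    (inner ℝ (c u) (rotJ e))]
  refine lintegral_congr fun t => ?_
  rw [add_smul, ← add_assoc, ← frame_decomp h.unit (c u)]

/-- The abscissa along the curve is an increasing bijection of the line with derivative `⟪T u, e⟫`,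
which therefore is the Jacobian of the coordinates `(u, t)`. -/
lemma lintegral_coord (h : GraphCurve e κ c T) (G : ℝ → ℝ≥0∞) :
    ∫⁻ x, G x = ∫⁻ u, ENNReal.ofReal (inner ℝ (T u) e) * G (inner ℝ (c u) e) := by
  have := lintegral_image_eq_lintegral_abs_deriv_mul (s := univ) MeasurableSet.univ
    (fun x _ => (h.coord_hasDerivAt e x).hasDerivWithinAt) h.coord_strictMono.injective.injOn G
  rw [image_univ, h.coord_surjective.range_eq, Measure.restrict_univ] at this
  rw [this]
  refine lintegral_congr fun u => ?_
  rw [abs_of_pos (h.pos.trans_le (h.inner_ge u))]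

/-- The Jacobian of `(u, t) ↦ c u + t • rotJ e` is `⟪T u, e⟫`. Its lower bound `κ` gives this
inequality, its upper bound `1` the next one; no regularity beyond `C¹` is involved. -/
lemma sweep_le (h : GraphCurve e κ c T) {f : Plane → ℝ≥0∞} (hf : Measurable f) :
    ∫⁻ u : ℝ, ∫⁻ t : ℝ, f (c u + t • rotJ e) ≤ ENNReal.ofReal κ⁻¹ * ∫⁻ x, f x := by
  rw [lintegral_frame h.unit hf,
    h.lintegral_coord (fun x => ∫⁻ y : ℝ, f (x • e + y • rotJ e)), ← lintegral_const_mul' _ _ (by simp)]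
  refine lintegral_mono fun u => ?_
  simp only
  rw [h.lintegral_line, ← mul_assoc, ← ENNReal.ofReal_mul (by have := h.pos; positivity)]
  refine le_mul_of_one_le_left zero_le ?_
  rw [ENNReal.one_le_ofReal]
  rw [← div_eq_inv_mul, le_div_iff₀ h.pos, one_mul]
  exact h.inner_ge u

lemma le_sweep (h : GraphCurve e κ c T) {f : Plane → ℝ≥0∞} (hf : Measurable f) :
    ∫⁻ x, f x ≤ ∫⁻ u : ℝ, ∫⁻ t : ℝ, f (c u + t • rotJ e) := by
  rw [lintegral_frame h.unit hf,
    h.lintegral_coord (fun x => ∫⁻ y : ℝ, f (x • e + y • rotJ e))]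
  refine lintegral_mono fun u => ?_
  simp only
  rw [h.lintegral_line]
  refine mul_le_of_le_one_left zero_le ?_
  rw [ENNReal.ofReal_le_one]
  exact h.inner_le u

lemma exists_param (h : GraphCurve e κ c T) (x : Plane) :
    ∃ u t : ℝ, x = c u + t • rotJ e ∧ inner ℝ (c u) e = inner ℝ x e := by
  obtain ⟨u, hu⟩ := h.coord_surjective (inner ℝ x e)
  refine ⟨u, inner ℝ (x - c u) (rotJ e), ?_, hu⟩
  have := frame_decomp h.unit (x - c u)
  have h0 : inner ℝ (x - c u) e = 0 := by rw [inner_sub_left]; simp only at hu; linarith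
  rw [h0, zero_smul, zero_add] at this
  rw [← this]; abel

end GraphCurve

/-! ### The arcs, extended to the whole line -/

namespace PlaneArc

variable (γ : PlaneArc)

lemma continuousOn_tangent : ContinuousOn γ.tangent (Icc 0 γ.length) :=
  γ.contDiffOn.continuousOn_derivWithin (uniqueDiffOn_Icc γ.length_pos) (by norm_num)

lemma continuousOn : ContinuousOn γ.toFun (Icc 0 γ.length) := γ.contDiffOn.continuousOn

lemma hasDerivWithinAt {s : ℝ} (hs : s ∈ Icc 0 γ.length) :
    HasDerivWithinAt γ.toFun (γ.tangent s) (Icc 0 γ.length) s :=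
  ((γ.contDiffOn.differentiableOn (by norm_num)) s hs).hasDerivWithinAt

/-- The tangent, extended by its end point values. -/
noncomputable def extTangent (s : ℝ) : Plane :=
  γ.tangent (projIcc 0 γ.length γ.length_pos.le s)

lemma continuous_extTangent : Continuous γ.extTangent :=
  (continuousOn_iff_continuous_domRestrict.1 γ.continuousOn_tangent).comp continuous_projIcc

lemma extTangent_eq {s : ℝ} (hs : s ∈ Icc 0 γ.length) : γ.extTangent s = γ.tangent s := by
  rw [extTangent, projIcc_of_mem _ hs]

lemma norm_extTangent (s : ℝ) : ‖γ.extTangent s‖ = 1 :=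
  γ.unit_speed _ (projIcc 0 γ.length γ.length_pos.le s).2

/-- The curve, extended to the whole line by half lines. -/
noncomputable def ext (s : ℝ) : Plane := γ.toFun 0 + ∫ r in (0 : ℝ)..s, γ.extTangent r

lemma hasDerivAt_ext (s : ℝ) : HasDerivAt γ.ext (γ.extTangent s) s :=
  (intervalIntegral.integral_hasDerivAt_right (γ.continuous_extTangent.intervalIntegrable _ _)
    (γ.continuous_extTangent.stronglyMeasurableAtFilter _ _)
    γ.continuous_extTangent.continuousAt).const_add _

lemma continuous_ext : Continuous γ.ext :=
  continuous_iff_continuousAt.2 fun s => (γ.hasDerivAt_ext s).continuousAt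

lemma ext_eq {s : ℝ} (hs : s ∈ Icc 0 γ.length) : γ.ext s = γ.toFun s := by
  have h : ∫ r in (0 : ℝ)..s, γ.extTangent r = γ.toFun s - γ.toFun 0 := by
    refine intervalIntegral.integral_eq_sub_of_hasDerivAt_of_le hs.1
      (γ.continuousOn.mono (Icc_subset_Icc_right hs.2)) (fun x hx => ?_)
      (γ.continuous_extTangent.intervalIntegrable _ _)
    have hx' : x ∈ Icc 0 γ.length := ⟨hx.1.le, hx.2.le.trans hs.2⟩
    rw [γ.extTangent_eq hx']
    exact (γ.hasDerivWithinAt hx').hasDerivAt (Icc_mem_nhds hx.1 (hx.2.trans_le hs.2))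
  rw [ext, h]; abel

/-- Near each of its points, and traversed in either direction, the curve is part of a graph
curve. -/
lemma exists_graphCurve (s₀ σ : ℝ) (hσ : σ = 1 ∨ σ = -1) {e : Plane} (he : ‖e‖ = 1) {κ : ℝ}
    (hκ : 0 < κ) (h : κ < inner ℝ (σ • γ.extTangent s₀) e) :
    ∃ η > 0, ∃ c T : ℝ → Plane, GraphCurve e κ c T ∧ T 0 = σ • γ.extTangent s₀ ∧
      ∀ u, |u| ≤ η → c u = γ.ext (s₀ + σ * u) := by
  have hσ1 : |σ| = 1 := by rcases hσ with rfl | rfl <;> simp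
  have hcont : Continuous fun r => σ • γ.extTangent (s₀ + σ * r) :=
    (γ.continuous_extTangent.comp (by fun_prop)).const_smul σ
  have hev : ∀ᶠ r in 𝓝 (0 : ℝ), κ < inner ℝ (σ • γ.extTangent (s₀ + σ * r)) e := by
    refine (hcont.inner continuous_const).continuousAt.eventually_const_lt ?_
    simpa using h
  obtain ⟨η', hη', hball⟩ := Metric.eventually_nhds_iff.1 hev
  let η := η' / 2
  have hη : 0 < η := half_pos hη'
  -- Freezing the tangent outside `[-η, η]` continues the curve by half lines, so that the slope
  -- condition, which holds only locally for the arc, holds on the whole line.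
  let T : ℝ → Plane := fun u => σ • γ.extTangent (s₀ + σ * (projIcc (-η) η (by linarith) u : ℝ))
  have hT : Continuous T := hcont.comp (continuous_subtype_val.comp continuous_projIcc)
  refine ⟨η, hη, fun u => γ.ext s₀ + ∫ r in (0 : ℝ)..u, T r, T, ⟨he, hκ, hT, fun u => ?_,
    fun u => ?_, fun u => ?_⟩, ?_, fun u hu => ?_⟩
  · exact (intervalIntegral.integral_hasDerivAt_right (hT.intervalIntegrable _ _)
      (hT.stronglyMeasurableAtFilter _ _) hT.continuousAt).const_add _
  · simp only [T, norm_smul, Real.norm_eq_abs, hσ1, one_mul]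
    exact γ.norm_extTangent _
  · refine (hball ?_).le
    have := (projIcc (-η) η (by linarith) u).2
    rw [Real.dist_eq, sub_zero]
    exact (abs_le.2 this).trans_lt (half_lt_self hη')
  · simp only [T]
    rw [projIcc_of_mem (by linarith) ⟨by linarith, hη.le⟩]; simp
  · have : ∫ r in (0 : ℝ)..u, T r = γ.ext (s₀ + σ * u) - γ.ext (s₀ + σ * 0) := by
      have h1 : ∫ r in (0 : ℝ)..u, T r = ∫ r in (0 : ℝ)..u, σ • γ.extTangent (s₀ + σ * r) := by
        refine intervalIntegral.integral_congr fun r hr => ?_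
        have hr' : r ∈ Icc (-η) η := by
          rw [abs_le] at hu
          rcases le_total 0 u with h0 | h0
          · rw [uIcc_of_le h0] at hr; exact ⟨by linarith [hr.1], by linarith [hr.2]⟩
          · rw [uIcc_of_ge h0] at hr; exact ⟨by linarith [hr.1], by linarith [hr.2]⟩
        simp only [T]
        rw [projIcc_of_mem (by linarith) hr']
      rw [h1]
      refine intervalIntegral.integral_eq_sub_of_hasDerivAt
        (f := fun r => γ.ext (s₀ + σ * r)) (fun x _ => ?_)
        (hcont.intervalIntegrable _ _)
      have hl : HasDerivAt (fun r : ℝ => s₀ + σ * r) σ x := by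
        simpa using ((hasDerivAt_id x).const_mul σ).const_add s₀
      exact (γ.hasDerivAt_ext _).scomp x hl
    simp only [this]; simp

end PlaneArc

/-! ### Elementary inequalities for square integrals -/

lemma ennreal_add_sq_le (x y : ℝ≥0∞) : (x + y) ^ 2 ≤ 2 * x ^ 2 + 2 * y ^ 2 := by
  have h := ENNReal.rpow_add_le_mul_rpow_add_rpow x y (p := 2) (by norm_num)
  have h2 : (2 : ℝ≥0∞) ^ ((2 : ℝ) - 1) = 2 := by norm_num
  rw [h2, mul_add] at h
  exact_mod_cast h

lemma enorm_sq_le_two_mul (a b : ℝ) : ‖a‖ₑ ^ 2 ≤ 2 * ‖b‖ₑ ^ 2 + 2 * ‖a - b‖ₑ ^ 2 := by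
  refine le_trans ?_ (ennreal_add_sq_le _ _)
  gcongr
  calc ‖a‖ₑ = ‖b + (a - b)‖ₑ := by congr 1; ring
    _ ≤ _ := enorm_add_le _ _

lemma sq_lintegral_le {α : Type*} [MeasurableSpace α] (μ : Measure α) {f : α → ℝ≥0∞}
    (hf : AEMeasurable f μ) : (∫⁻ x, f x ∂μ) ^ 2 ≤ μ univ * ∫⁻ x, f x ^ 2 ∂μ := by
  have h := ENNReal.lintegral_mul_le_Lp_mul_Lq μ Real.HolderConjugate.two_two
    (f := fun _ => 1) (g := f) aemeasurable_const hf
  simp only [Pi.mul_apply, one_mul, ENNReal.one_rpow, lintegral_one] at h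
  have h2 := pow_le_pow_left₀ zero_le h 2
  rw [mul_pow, ← ENNReal.rpow_natCast (_ ^ _), ← ENNReal.rpow_natCast (_ ^ _),
    ← ENNReal.rpow_mul, ← ENNReal.rpow_mul] at h2
  norm_num at h2
  exact h2

/-- Fundamental theorem of calculus and Cauchy–Schwarz; the factor `‖b - a‖ₑ` is what later balances
the weight `1 / u` and the powers of `δ`. -/
lemma enorm_sub_sq_le_set {h h' : ℝ → ℝ} (hd : ∀ t, HasDerivAt h (h' t) t) (hc : Continuous h')
    (a b : ℝ) : ‖h b - h a‖ₑ ^ 2 ≤ ‖b - a‖ₑ * ∫⁻ t in uIoc a b, ‖h' t‖ₑ ^ 2 := by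
  have h1 : ‖h b - h a‖ₑ ≤ ∫⁻ t in uIoc a b, ‖h' t‖ₑ := by
    rw [← intervalIntegral.integral_eq_sub_of_hasDerivAt (fun t _ => hd t)
      (hc.intervalIntegrable a b), ← enorm_norm, intervalIntegral.norm_integral_eq_norm_integral_uIoc,
      enorm_norm]
    exact enorm_integral_le_lintegral_enorm _
  have h2 := sq_lintegral_le (volume.restrict (uIoc a b)) (f := fun t => ‖h' t‖ₑ)
    hc.enorm.measurable.aemeasurable
  refine (pow_le_pow_left₀ zero_le h1 2).trans (h2.trans_eq ?_)
  congr 1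
  rw [Measure.restrict_apply_univ, uIoc, Real.volume_Ioc, max_sub_min_eq_abs,
    ← Real.enorm_eq_ofReal (abs_nonneg _), Real.enorm_abs]

lemma line_hasDerivAt {ψ : Plane → ℝ} (hψ : ContDiff ℝ 1 ψ) (x v : Plane) (t : ℝ) :
    HasDerivAt (fun t : ℝ => ψ (x + t • v)) (fderiv ℝ ψ (x + t • v) v) t := by
  have h1 : HasDerivAt (fun t : ℝ => x + t • v) v t := by
    simpa using ((hasDerivAt_id t).smul_const v).const_add x
  exact ((hψ.differentiable (by norm_num)) _).hasFDerivAt.comp_hasDerivAt t h1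

lemma continuous_fderiv_line {ψ : Plane → ℝ} (hψ : ContDiff ℝ 1 ψ) (x v : Plane) :
    Continuous fun t : ℝ => fderiv ℝ ψ (x + t • v) v :=
  ((hψ.continuous_fderiv (by norm_num)).comp (by fun_prop)).clm_apply continuous_const

lemma enorm_fderiv_apply_le (ψ : Plane → ℝ) (x : Plane) {v : Plane} (hv : ‖v‖ = 1) :
    ‖fderiv ℝ ψ x v‖ₑ ≤ ‖fderiv ℝ ψ x‖ₑ := by
  rw [enorm_le_iff_norm_le]
  simpa [hv] using (fderiv ℝ ψ x).le_opNorm v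

lemma line_sq_le_set {ψ : Plane → ℝ} (hψ : ContDiff ℝ 1 ψ) (x : Plane) {v : Plane}
    (hv : ‖v‖ = 1) (a b : ℝ) : ‖ψ (x + b • v) - ψ (x + a • v)‖ₑ ^ 2 ≤
      ‖b - a‖ₑ * ∫⁻ t in uIoc a b, ‖fderiv ℝ ψ (x + t • v)‖ₑ ^ 2 := by
  refine (enorm_sub_sq_le_set (fun t => line_hasDerivAt hψ x v t)
    (continuous_fderiv_line hψ x v) a b).trans ?_
  gcongr
  exact enorm_fderiv_apply_le _ _ hv

lemma line_sq_le {ψ : Plane → ℝ} (hψ : ContDiff ℝ 1 ψ) (x : Plane) {v : Plane}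
    (hv : ‖v‖ = 1) (a b : ℝ) : ‖ψ (x + b • v) - ψ (x + a • v)‖ₑ ^ 2 ≤
      ‖b - a‖ₑ * ∫⁻ t : ℝ, ‖fderiv ℝ ψ (x + t • v)‖ₑ ^ 2 :=
  (line_sq_le_set hψ x hv a b).trans (by gcongr; exact Measure.restrict_le_self)

lemma measurable_grad_sq {ψ : Plane → ℝ} (hψ : ContDiff ℝ 1 ψ) :
    Measurable fun x => ‖fderiv ℝ ψ x‖ₑ ^ 2 :=
  ((hψ.continuous_fderiv (by norm_num)).enorm.measurable).pow_const 2

lemma measurable_sq {ψ : Plane → ℝ} (hψ : ContDiff ℝ 1 ψ) :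
    Measurable fun x => ‖ψ x‖ₑ ^ 2 := (hψ.continuous.enorm.measurable).pow_const 2

/-- The line inequality is integrated over all base points; after Tonelli, translation invariance
makes the inner integral independent of `t`. -/
lemma translation_sq_le {ψ : Plane → ℝ} (hψ : ContDiff ℝ 1 ψ) {v : Plane} (hv : ‖v‖ = 1)
    {δ : ℝ} (hδ : 0 ≤ δ) : ∫⁻ x, ‖ψ (x + δ • v) - ψ x‖ₑ ^ 2 ≤
      ENNReal.ofReal (δ ^ 2) * ∫⁻ x, ‖fderiv ℝ ψ x‖ₑ ^ 2 := by
  have hm := measurable_grad_sq hψ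
  calc ∫⁻ x, ‖ψ (x + δ • v) - ψ x‖ₑ ^ 2
      ≤ ∫⁻ x, ENNReal.ofReal δ * ∫⁻ t in Ioc 0 δ, ‖fderiv ℝ ψ (x + t • v)‖ₑ ^ 2 := by
        refine lintegral_mono fun x => ?_
        have := line_sq_le_set hψ x hv 0 δ
        rwa [sub_zero, zero_smul, add_zero, uIoc_of_le hδ, Real.enorm_eq_ofReal hδ] at this
    _ = ENNReal.ofReal δ * ∫⁻ t in Ioc 0 δ, ∫⁻ x, ‖fderiv ℝ ψ (x + t • v)‖ₑ ^ 2 := by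
        rw [lintegral_const_mul' _ _ (by simp), lintegral_lintegral_swap]
        exact (hm.comp (by fun_prop)).aemeasurable
    _ = ENNReal.ofReal δ * ∫⁻ _t in Ioc 0 δ, ∫⁻ x, ‖fderiv ℝ ψ x‖ₑ ^ 2 := by
        congr 1
        refine lintegral_congr fun t => ?_
        exact lintegral_add_right_eq_self (fun x => ‖fderiv ℝ ψ x‖ₑ ^ 2) (t • v)
    _ = _ := by
        rw [lintegral_const, Measure.restrict_apply_univ, Real.volume_Ioc, sub_zero, mul_comm
          (∫⁻ x, ‖fderiv ℝ ψ x‖ₑ ^ 2), ← mul_assoc, ← ENNReal.ofReal_mul hδ, sq]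

/-! ### Graph curves: traces, strips, and transport to a ray -/

namespace GraphCurve

variable {e : Plane} {κ : ℝ} {c T : ℝ → Plane}

lemma norm_J (h : GraphCurve e κ c T) : ‖rotJ e‖ = 1 := by rw [norm_rotJ, h.unit]

/-- The value at `c u` is compared with the values at height `t ∈ [0, 1]` above it, averaged over
`t`, and then integrated in `u` by means of `sweep_le`. -/
lemma lintegral_trace_le (h : GraphCurve e κ c T) {ψ : Plane → ℝ} (hψ : ContDiff ℝ 1 ψ) :
    ∫⁻ u, ‖ψ (c u)‖ₑ ^ 2 ≤ 2 * ENNReal.ofReal κ⁻¹ *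
      ((∫⁻ x, ‖ψ x‖ₑ ^ 2) + ∫⁻ x, ‖fderiv ℝ ψ x‖ₑ ^ 2) := by
  have key : ∀ u, ‖ψ (c u)‖ₑ ^ 2 ≤ 2 * (∫⁻ t : ℝ, ‖ψ (c u + t • rotJ e)‖ₑ ^ 2) +
      2 * ∫⁻ t : ℝ, ‖fderiv ℝ ψ (c u + t • rotJ e)‖ₑ ^ 2 := by
    intro u
    set D := ∫⁻ t : ℝ, ‖fderiv ℝ ψ (c u + t • rotJ e)‖ₑ ^ 2
    calc ‖ψ (c u)‖ₑ ^ 2 = ∫⁻ _t in Icc (0 : ℝ) 1, ‖ψ (c u)‖ₑ ^ 2 := by simp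
      _ ≤ ∫⁻ t in Icc (0 : ℝ) 1, (2 * ‖ψ (c u + t • rotJ e)‖ₑ ^ 2 + 2 * D) := by
        refine setLIntegral_mono' measurableSet_Icc fun t ht => ?_
        refine (enorm_sq_le_two_mul (ψ (c u)) (ψ (c u + t • rotJ e))).trans ?_
        gcongr
        have := line_sq_le hψ (c u) h.norm_J t 0
        rw [zero_smul, add_zero] at this
        refine this.trans (mul_le_of_le_one_left zero_le ?_)
        rw [Real.enorm_eq_ofReal_abs, ENNReal.ofReal_le_one, zero_sub, abs_neg, abs_of_nonneg ht.1]
        exact ht.2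
      _ = 2 * (∫⁻ t in Icc (0 : ℝ) 1, ‖ψ (c u + t • rotJ e)‖ₑ ^ 2) + 2 * D := by
        rw [lintegral_add_right _ measurable_const, lintegral_const_mul' _ _ (by simp)]
        simp
      _ ≤ _ := by gcongr; exact Measure.restrict_le_self
  calc ∫⁻ u, ‖ψ (c u)‖ₑ ^ 2 ≤ _ := lintegral_mono key
    _ = 2 * (∫⁻ u, ∫⁻ t : ℝ, ‖ψ (c u + t • rotJ e)‖ₑ ^ 2) +
      2 * ∫⁻ u, ∫⁻ t : ℝ, ‖fderiv ℝ ψ (c u + t • rotJ e)‖ₑ ^ 2 := by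
        have hm := h.continuous.measurable
        rw [lintegral_add_right, lintegral_const_mul' _ _ (by simp),
          lintegral_const_mul' _ _ (by simp)]
        refine Measurable.const_mul (Measurable.lintegral_prod_right' (f := fun q : ℝ × ℝ =>
          ‖fderiv ℝ ψ (c q.1 + q.2 • rotJ e)‖ₑ ^ 2) ?_) _
        exact (measurable_grad_sq hψ).comp (by fun_prop)
    _ ≤ 2 * (ENNReal.ofReal κ⁻¹ * ∫⁻ x, ‖ψ x‖ₑ ^ 2) +
        2 * (ENNReal.ofReal κ⁻¹ * ∫⁻ x, ‖fderiv ℝ ψ x‖ₑ ^ 2) := by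
        gcongr
        · exact h.sweep_le (measurable_sq hψ)
        · exact h.sweep_le (measurable_grad_sq hψ)
    _ = _ := by ring

/-- The part of the strip of half width `r` around the curve that lies over parameters in `U`. -/
def strip (c : ℝ → Plane) (e : Plane) (U : Set ℝ) (r : ℝ) : Set Plane :=
  (fun q : ℝ × ℝ => c q.1 + q.2 • rotJ e) '' (U ×ˢ Icc (-r) r)

lemma inner_add_smul_rotJ (x e : Plane) (t : ℝ) :
    inner ℝ (x + t • rotJ e) e = inner ℝ x e := by
  rw [inner_add_left, inner_smul_left, inner_rotJ_self]; simp

lemma param_injective (h : GraphCurve e κ c T) {u t u' t' : ℝ}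
    (hx : c u + t • rotJ e = c u' + t' • rotJ e) : u = u' ∧ t = t' := by
  have hu : u = u' := by
    apply h.coord_strictMono.injective
    have := congrArg (fun x => inner ℝ x e) hx
    simpa only [inner_add_smul_rotJ] using this
  subst hu
  refine ⟨rfl, ?_⟩
  have h3 : (t - t') • rotJ e = 0 := by
    rw [sub_smul, add_left_cancel hx, sub_self]
  rcases smul_eq_zero.1 h3 with h4 | h4
  · linarith
  · have := h.norm_J; rw [h4, norm_zero] at this; norm_num at this

/-- On each segment `|t| ≤ r` the function differs from its value at the centre by at most `r` times
the gradient integral, in square. Integration over a segment of length `2 r` adds one more power of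
`r` to both terms. -/
lemma lintegral_strip_le (h : GraphCurve e κ c T) {ψ : Plane → ℝ} (hψ : ContDiff ℝ 1 ψ)
    {U : Set ℝ} (hU : IsCompact U) {r : ℝ} (hr : 0 ≤ r) :
    ∫⁻ x in strip c e U r, ‖ψ x‖ₑ ^ 2 ≤
      4 * ENNReal.ofReal r * (∫⁻ u in U, ‖ψ (c u)‖ₑ ^ 2) +
      4 * ENNReal.ofReal (r ^ 2) * ENNReal.ofReal κ⁻¹ * ∫⁻ x, ‖fderiv ℝ ψ x‖ₑ ^ 2 := by
  have hm := h.continuous.measurable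
  have hc := h.continuous
  have hS : IsCompact (strip c e U r) :=
    (hU.prod isCompact_Icc).image (by fun_prop)
  have hI : Measurable ((strip c e U r).indicator fun x => ‖ψ x‖ₑ ^ 2) :=
    (measurable_sq hψ).indicator hS.measurableSet
  rw [← lintegral_indicator hS.measurableSet]
  refine (h.le_sweep hI).trans ?_
  -- Injectivity of the coordinates makes the indicator of the strip vanish off `U ×ˢ Icc (-r) r`.
  have hmem : ∀ u t, c u + t • rotJ e ∈ strip c e U r → u ∈ U ∧ t ∈ Icc (-r) r := by
    rintro u t ⟨⟨u', t'⟩, ⟨h1, h2⟩, heq⟩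
    obtain ⟨rfl, rfl⟩ := h.param_injective heq
    exact ⟨h1, h2⟩
  calc ∫⁻ u, ∫⁻ t : ℝ, (strip c e U r).indicator (fun x => ‖ψ x‖ₑ ^ 2) (c u + t • rotJ e)
      ≤ ∫⁻ u, U.indicator (fun u => 4 * ENNReal.ofReal r * ‖ψ (c u)‖ₑ ^ 2 +
        4 * ENNReal.ofReal (r ^ 2) *
          ∫⁻ t : ℝ, ‖fderiv ℝ ψ (c u + t • rotJ e)‖ₑ ^ 2) u := by
        refine lintegral_mono fun u => ?_
        by_cases hu : u ∈ U
        · rw [indicator_of_mem hu]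
          set D := ∫⁻ t : ℝ, ‖fderiv ℝ ψ (c u + t • rotJ e)‖ₑ ^ 2
          calc ∫⁻ t : ℝ, (strip c e U r).indicator (fun x => ‖ψ x‖ₑ ^ 2) (c u + t • rotJ e)
              ≤ ∫⁻ t : ℝ, (Icc (-r) r).indicator
                (fun _ => 2 * ‖ψ (c u)‖ₑ ^ 2 + 2 * (ENNReal.ofReal r * D)) t := by
                refine lintegral_mono fun t => ?_
                by_cases ht : c u + t • rotJ e ∈ strip c e U r
                · have ht' := (hmem u t ht).2
                  simp only [indicator_of_mem ht, indicator_of_mem ht']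
                  refine (enorm_sq_le_two_mul _ (ψ (c u))).trans ?_
                  gcongr
                  have := line_sq_le hψ (c u) h.norm_J 0 t
                  rw [zero_smul, add_zero, sub_zero] at this
                  refine this.trans ?_
                  gcongr
                  rw [Real.enorm_eq_ofReal_abs]
                  exact ENNReal.ofReal_le_ofReal (abs_le.2 ht')
                · simp only [indicator_of_notMem ht]; exact zero_le
            _ = _ := by
                rw [lintegral_indicator measurableSet_Icc, setLIntegral_const, Real.volume_Icc,
                  show r - -r = 2 * r by ring, ENNReal.ofReal_mul (by norm_num), sq r,
                  ENNReal.ofReal_mul hr]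
                simp only [ENNReal.ofReal_ofNat]
                ring
        · rw [indicator_of_notMem hu]
          refine le_of_eq ?_
          rw [lintegral_eq_zero_iff' (by fun_prop)]
          refine Eventually.of_forall fun t => ?_
          simp only [Pi.zero_apply]
          rw [indicator_of_notMem]
          exact fun ht => hu (hmem u t ht).1
    _ ≤ _ := by
        rw [lintegral_indicator hU.measurableSet, lintegral_add_left (by
          exact (measurable_sq hψ).comp hm |>.const_mul _),
          lintegral_const_mul' _ _ (by finiteness), lintegral_const_mul' _ _ (by finiteness),
          mul_assoc (4 * ENNReal.ofReal (r ^ 2))]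
        gcongr
        exact (setLIntegral_le_lintegral _ _).trans (h.sweep_le (measurable_grad_sq hψ))

/-- The values on the curve and on a ray with the same initial point are close in the mean. -/
lemma lintegral_ray_sub_le (h : GraphCurve e κ c T) {ψ : Plane → ℝ} (hψ : ContDiff ℝ 1 ψ)
    {n : Plane} (hn : ‖n‖ = 1) {ν : ℝ} (hν : 0 < ν) (hne : inner ℝ n e = ν) :
    ∫⁻ u in Ioi (0 : ℝ), ENNReal.ofReal u⁻¹ *
        ‖ψ (c 0 + ((inner ℝ (c u - c 0) e) / ν) • n) - ψ (c u)‖ₑ ^ 2 ≤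
      ENNReal.ofReal (1 + ν⁻¹) * ENNReal.ofReal κ⁻¹ * ∫⁻ x, ‖fderiv ℝ ψ x‖ₑ ^ 2 := by
  rw [mul_assoc]
  refine le_trans ?_ (mul_le_mul_right (h.sweep_le (measurable_grad_sq hψ)) _)
  rw [← lintegral_const_mul' _ _ (by simp)]
  refine le_trans (setLIntegral_mono' measurableSet_Ioi fun u hu => ?_)
    (setLIntegral_le_lintegral (Ioi 0) _)
  set D := ∫⁻ t : ℝ, ‖fderiv ℝ ψ (c u + t • rotJ e)‖ₑ ^ 2
  have hu : 0 < u := hu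
  -- The point of the ray with the same abscissa as `c u`: the two are joined by a segment in
  -- direction `rotJ e`.
  set q := c 0 + ((inner ℝ (c u - c 0) e) / ν) • n
  have hcu : ‖c u - c 0‖ ≤ u := by simpa [abs_of_pos hu] using h.norm_sub_le 0 u
  have h0 : inner ℝ (q - c u) e = 0 := by
    simp only [q]
    rw [inner_sub_left, inner_add_left, inner_smul_left, inner_sub_left, hne]
    simp only [conj_trivial]
    field_simp
    ring
  have hq : q = c u + (inner ℝ (q - c u) (rotJ e)) • rotJ e := by
    have := frame_decomp h.unit (q - c u)
    rw [h0, zero_smul, zero_add] at this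
    rw [← this]; abel
  -- The length of the segment is at most linear in `u`, since both ends have distance `O(u)` from
  -- `c 0`; this absorbs the weight `u⁻¹`.
  have hb : |inner ℝ (q - c u) (rotJ e)| ≤ u * (1 + ν⁻¹) := by
    refine (abs_real_inner_le_norm _ _).trans ?_
    rw [h.norm_J, mul_one]
    have h1 : ‖q - c u‖ ≤ ‖c u - c 0‖ + ‖((inner ℝ (c u - c 0) e) / ν) • n‖ := by
      have : q - c u = -(c u - c 0) + ((inner ℝ (c u - c 0) e) / ν) • n := by
        simp only [q]; abel
      rw [this]
      exact (norm_add_le _ _).trans_eq (by rw [norm_neg])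
    have h2 : ‖((inner ℝ (c u - c 0) e) / ν) • n‖ ≤ u * ν⁻¹ := by
      rw [norm_smul, hn, mul_one, norm_div, Real.norm_eq_abs, Real.norm_eq_abs, abs_of_pos hν,
        div_eq_mul_inv]
      gcongr
      refine (abs_real_inner_le_norm _ _).trans ?_
      rwa [h.unit, mul_one]
    linarith
  have hl := line_sq_le hψ (c u) h.norm_J 0 (inner ℝ (q - c u) (rotJ e))
  rw [← hq, zero_smul, add_zero, sub_zero] at hl
  calc ENNReal.ofReal u⁻¹ * ‖ψ q - ψ (c u)‖ₑ ^ 2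
      ≤ ENNReal.ofReal u⁻¹ * (ENNReal.ofReal (u * (1 + ν⁻¹)) * D) := by
        gcongr
        refine hl.trans ?_
        gcongr
        rw [Real.enorm_eq_ofReal_abs]
        exact ENNReal.ofReal_le_ofReal hb
    _ = ENNReal.ofReal (1 + ν⁻¹) * D := by
        rw [← mul_assoc, ← ENNReal.ofReal_mul (by positivity)]
        congr 2
        field_simp

end GraphCurve

/-! ### Trace and strip inequalities for arcs -/

lemma lintegral_comp_affine (f : ℝ → ℝ≥0∞) (s₀ : ℝ) {σ : ℝ} (hσ : σ = 1 ∨ σ = -1) :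
    ∫⁻ u, f (s₀ + σ * u) = ∫⁻ s, f s := by
  rcases hσ with rfl | rfl
  · simpa using lintegral_add_left_eq_self f s₀
  · simpa [sub_eq_add_neg] using lintegral_sub_left_eq_self f s₀

namespace PlaneArc

variable (γ : PlaneArc)

lemma inner_smul_self (s₀ : ℝ) {σ : ℝ} (hσ : σ = 1 ∨ σ = -1) :
    inner ℝ (σ • γ.extTangent s₀) (σ • γ.extTangent s₀) = 1 := by
  rw [real_inner_self_eq_norm_sq, norm_smul, γ.norm_extTangent]
  rcases hσ with rfl | rfl <;> simp

lemma norm_smul_self (s₀ : ℝ) {σ : ℝ} (hσ : σ = 1 ∨ σ = -1) :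
    ‖σ • γ.extTangent s₀‖ = 1 := by
  rw [norm_smul, γ.norm_extTangent]
  rcases hσ with rfl | rfl <;> simp

/-- Compactness of the parameter interval reduces this to neighbourhoods on which the arc is a graph
curve over its own tangent line. -/
lemma exists_trace_le : ∃ C : ℝ≥0, ∀ ψ : Plane → ℝ, ContDiff ℝ 1 ψ →
    ∫⁻ s in Icc 0 γ.length, ‖ψ (γ.ext s)‖ₑ ^ 2 ≤
      C * ((∫⁻ x, ‖ψ x‖ₑ ^ 2) + ∫⁻ x, ‖fderiv ℝ ψ x‖ₑ ^ 2) := by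
  refine isCompact_Icc.induction_on (p := fun A => ∃ C : ℝ≥0, ∀ ψ : Plane → ℝ, ContDiff ℝ 1 ψ →
    ∫⁻ s in A, ‖ψ (γ.ext s)‖ₑ ^ 2 ≤
      C * ((∫⁻ x, ‖ψ x‖ₑ ^ 2) + ∫⁻ x, ‖fderiv ℝ ψ x‖ₑ ^ 2)) ⟨0, by simp⟩ ?_ ?_ ?_
  · rintro A B hAB ⟨C, hC⟩
    exact ⟨C, fun ψ hψ => (lintegral_mono_set hAB).trans (hC ψ hψ)⟩
  · rintro A B ⟨C, hC⟩ ⟨D, hD⟩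
    refine ⟨C + D, fun ψ hψ => (lintegral_union_le _ _ _).trans ?_⟩
    rw [ENNReal.coe_add, add_mul]
    exact add_le_add (hC ψ hψ) (hD ψ hψ)
  · intro s₀ _
    -- For `e` the tangent at `s₀` the slope there is `1`; any `κ < 1` works near `s₀`.
    obtain ⟨η, hη, c, T, hc, -, hcu⟩ := γ.exists_graphCurve s₀ 1 (Or.inl rfl)
      (γ.norm_smul_self s₀ (Or.inl rfl)) (κ := 1 / 2) (by norm_num)
      (by rw [γ.inner_smul_self s₀ (Or.inl rfl)]; norm_num)
    refine ⟨Metric.closedBall s₀ η, mem_nhdsWithin_of_mem_nhds (Metric.closedBall_mem_nhds _ hη),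
      2 * 2, fun ψ hψ => ?_⟩
    have h1 := hc.lintegral_trace_le hψ
    have h2 : ∫⁻ s in Metric.closedBall s₀ η, ‖ψ (γ.ext s)‖ₑ ^ 2 ≤ ∫⁻ u, ‖ψ (c u)‖ₑ ^ 2 := by
      rw [← lintegral_indicator Metric.isClosed_closedBall.measurableSet,
        ← lintegral_comp_affine _ s₀ (Or.inl rfl)]
      refine lintegral_mono fun u => ?_
      refine indicator_apply_le' (fun hu => ?_) (fun _ => zero_le)
      rw [hcu u (by simpa [Real.dist_eq] using hu)]
    refine h2.trans (h1.trans_eq ?_)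
    norm_num

/-- A `δ`-neighbourhood of an arc protrudes beyond the end points, hence is not contained in a strip
over parameters of the arc, where the trace is controlled. It is therefore first moved by `δ • e`
along the curve, in a direction in which the arc continues. The shifted set lies in such a strip,
and by `translation_sq_le` the shift costs only `δ ^ 2` times the gradient integral. -/
lemma exists_strip_le : ∃ C : ℝ≥0, ∃ δ₀ > 0, ∀ ψ : Plane → ℝ, ContDiff ℝ 1 ψ →
    ∀ δ, 0 < δ → δ < δ₀ → ∫⁻ x in Metric.thickening δ (γ.ext '' Icc 0 γ.length), ‖ψ x‖ₑ ^ 2 ≤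
      C * (ENNReal.ofReal δ * (∫⁻ s in Icc 0 γ.length, ‖ψ (γ.ext s)‖ₑ ^ 2) +
        ENNReal.ofReal (δ ^ 2) * ∫⁻ x, ‖fderiv ℝ ψ x‖ₑ ^ 2) := by
  refine isCompact_Icc.induction_on (p := fun A => ∃ C : ℝ≥0, ∃ δ₀ > 0, ∀ ψ : Plane → ℝ,
    ContDiff ℝ 1 ψ → ∀ δ, 0 < δ → δ < δ₀ →
    ∫⁻ x in Metric.thickening δ (γ.ext '' A), ‖ψ x‖ₑ ^ 2 ≤
      C * (ENNReal.ofReal δ * (∫⁻ s in Icc 0 γ.length, ‖ψ (γ.ext s)‖ₑ ^ 2) +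
        ENNReal.ofReal (δ ^ 2) * ∫⁻ x, ‖fderiv ℝ ψ x‖ₑ ^ 2)) ⟨0, 1, by simp⟩ ?_ ?_ ?_
  · rintro A B hAB ⟨C, δ₀, hδ₀, hC⟩
    exact ⟨C, δ₀, hδ₀, fun ψ hψ δ h1 h2 => (lintegral_mono_set
      (Metric.thickening_subset_of_subset _ (image_mono hAB))).trans (hC ψ hψ δ h1 h2)⟩
  · rintro A B ⟨C, δ₁, hδ₁, hC⟩ ⟨D, δ₂, hδ₂, hD⟩
    refine ⟨C + D, min δ₁ δ₂, lt_min hδ₁ hδ₂, fun ψ hψ δ h1 h2 => ?_⟩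
    rw [image_union, Metric.thickening_union]
    refine (lintegral_union_le _ _ _).trans ?_
    rw [ENNReal.coe_add, add_mul]
    exact add_le_add (hC ψ hψ δ h1 (h2.trans_le (min_le_left _ _)))
      (hD ψ hψ δ h1 (h2.trans_le (min_le_right _ _)))
  · intro s₀ hs₀
    -- At the final end point the curve is traversed backwards.
    obtain ⟨σ, ρ, hσ, hρ, hroom⟩ : ∃ σ ρ : ℝ, (σ = 1 ∨ σ = -1) ∧ 0 < ρ ∧
        s₀ + σ * ρ ∈ Icc 0 γ.length := by
      rcases hs₀.2.lt_or_eq with h | h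
      · exact ⟨1, γ.length - s₀, Or.inl rfl, by linarith, by
          constructor <;> linarith [γ.length_pos]⟩
      · exact ⟨-1, γ.length, Or.inr rfl, γ.length_pos, by
          constructor <;> linarith [γ.length_pos]⟩
    set e := σ • γ.extTangent s₀ with he
    obtain ⟨η, hη, c, T, hc, -, hcu⟩ := γ.exists_graphCurve s₀ σ hσ
      (γ.norm_smul_self s₀ hσ) (κ := 1 / 2) (by norm_num)
      (by rw [γ.inner_smul_self s₀ hσ]; norm_num)
    set b := min η ρ with hb
    have hb0 : 0 < b := lt_min hη hρ
    have hbη : b ≤ η := min_le_left _ _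
    have hbρ : b ≤ ρ := min_le_right _ _
    have hconv : ∀ u, s₀ + σ * u ∈ Icc 0 γ.length → ∀ v, u ≤ v → v ≤ b →
        s₀ + σ * v ∈ Icc 0 γ.length := by
      rintro u ⟨hu1, hu2⟩ v huv hvb
      obtain ⟨h1, h2⟩ := hroom
      rcases hσ with rfl | rfl <;> constructor <;> linarith
    set U : Set ℝ := {u | |u| ≤ b ∧ s₀ + σ * u ∈ Icc 0 γ.length} with hU
    have hUc : IsCompact U := by
      have : U = Icc (-b) b ∩ (fun u => s₀ + σ * u) ⁻¹' Icc 0 γ.length := by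
        ext u; simp only [hU, mem_ofPred_eq, abs_le, mem_inter_iff, mem_Icc, mem_preimage]
      rw [this]
      exact isCompact_Icc.inter_right (isClosed_Icc.preimage (by fun_prop))
    -- The shift changes the abscissa by at most `2 * δ`, hence the parameter by at most `4 * δ` (`κ
    -- = 1 / 2`); with `δ < b / 8` it stays below `b`. The height is at most `δ + δ + 4 * δ`, whence
    -- the half width `6 * δ`. The constants that result are `48` and `578`, both below `600`.
    refine ⟨Metric.closedBall s₀ (b / 2) ∩ Icc 0 γ.length,
      inter_mem (mem_nhdsWithin_of_mem_nhds (Metric.closedBall_mem_nhds _ (half_pos hb0)))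
        self_mem_nhdsWithin, 600, b / 8, by positivity, fun ψ hψ δ hδ hδb => ?_⟩
    have hunit : ‖e‖ = 1 := hc.unit
    have hsub : ∀ x ∈ Metric.thickening δ
        (γ.ext '' (Metric.closedBall s₀ (b / 2) ∩ Icc 0 γ.length)),
        x + δ • e ∈ GraphCurve.strip c e U (6 * δ) := by
      intro x hx
      obtain ⟨_, ⟨s, ⟨hs1, hs2⟩, rfl⟩, hdist⟩ := Metric.mem_thickening_iff.1 hx
      obtain ⟨u', hu'⟩ : ∃ u', s = s₀ + σ * u' := by
        refine ⟨σ * (s - s₀), ?_⟩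
        rcases hσ with rfl | rfl <;> ring
      have hu'b : |u'| ≤ b / 2 := by
        rw [Metric.mem_closedBall, Real.dist_eq, hu'] at hs1
        rcases hσ with rfl | rfl <;> simpa using hs1
      rw [hu', ← hcu u' (by linarith)] at hdist
      rw [hu'] at hs2
      obtain ⟨u, t, hxut, hue⟩ := hc.exists_param (x + δ • e)
      have hxe : |inner ℝ (x - c u') e| ≤ δ := by
        refine (abs_real_inner_le_norm _ _).trans ?_
        rw [hunit, mul_one, ← dist_eq_norm]
        exact hdist.le
      rw [inner_sub_left] at hxe
      rw [inner_add_left, real_inner_smul_left, real_inner_self_eq_norm_sq, hunit] at hue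
      have hxe' := abs_le.1 hxe
      -- The reason for the shift: `x` may lie behind `c u'` by at most `δ`, so after the shift it
      -- no longer does, and `hconv` keeps the parameter on the arc.
      have huu' : u' ≤ u := hc.coord_strictMono.le_iff_le.1 (by linarith)
      have huu2 : u - u' ≤ 4 * δ := by
        have := hc.coord_sub_ge huu'
        linarith
      have hu'b' := abs_le.1 hu'b
      have hub : |u| ≤ b := abs_le.2 ⟨by linarith, by linarith⟩
      refine ⟨(u, t), ⟨⟨hub, hconv u' hs2 u huu' (abs_le.1 hub).2⟩, ?_⟩, hxut.symm⟩
      rw [mem_Icc, ← abs_le]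
      have h1 : |t| = ‖x + δ • e - c u‖ := by
        rw [hxut, add_sub_cancel_left, norm_smul, hc.norm_J, mul_one, Real.norm_eq_abs]
      rw [h1]
      have h2 : x + δ • e - c u = (x - c u') + δ • e - (c u - c u') := by abel
      have h3 := hc.norm_sub_le u' u
      rw [abs_of_nonneg (by linarith)] at h3
      rw [dist_eq_norm] at hdist
      have h4 : ‖δ • e‖ = δ := by rw [norm_smul, hunit, mul_one, Real.norm_eq_abs, abs_of_pos hδ]
      rw [h2]
      have h5 := norm_sub_le (x - c u' + δ • e) (c u - c u')
      have h6 := norm_add_le (x - c u') (δ • e)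
      linarith
    have htr := translation_sq_le hψ hunit hδ.le
    have hstrip := hc.lintegral_strip_le hψ hUc (r := 6 * δ) (by positivity)
    have hmS : MeasurableSet (GraphCurve.strip c e U (6 * δ)) := by
      have := hc.continuous
      exact ((hUc.prod isCompact_Icc).image (by fun_prop)).measurableSet
    have hUint : ∫⁻ u in U, ‖ψ (c u)‖ₑ ^ 2 ≤ ∫⁻ s in Icc 0 γ.length, ‖ψ (γ.ext s)‖ₑ ^ 2 := by
      rw [← lintegral_indicator measurableSet_Icc, ← lintegral_comp_affine _ s₀ hσ,
        ← lintegral_indicator hUc.measurableSet]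
      refine lintegral_mono fun u => indicator_apply_le' (fun hu => ?_) (fun _ => zero_le)
      rw [indicator_of_mem hu.2, hcu u (hu.1.trans hbη)]
    have hshift : ∫⁻ x in Metric.thickening δ
        (γ.ext '' (Metric.closedBall s₀ (b / 2) ∩ Icc 0 γ.length)), ‖ψ (x + δ • e)‖ₑ ^ 2 ≤
        ∫⁻ x in GraphCurve.strip c e U (6 * δ), ‖ψ x‖ₑ ^ 2 := by
      rw [← lintegral_indicator hmS, ← lintegral_add_right_eq_self
        ((GraphCurve.strip c e U (6 * δ)).indicator fun x => ‖ψ x‖ₑ ^ 2) (δ • e),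
        ← lintegral_indicator Metric.isOpen_thickening.measurableSet]
      refine lintegral_mono fun x => indicator_apply_le' (fun hx => ?_) (fun _ => zero_le)
      rw [indicator_of_mem (hsub x hx)]
    have hm : Measurable fun x => 2 * ‖ψ (x + δ • e)‖ₑ ^ 2 :=
      ((measurable_sq hψ).comp (measurable_add_const (δ • e))).const_mul _
    set S := ∫⁻ s in Icc 0 γ.length, ‖ψ (γ.ext s)‖ₑ ^ 2
    set D := ∫⁻ x, ‖fderiv ℝ ψ x‖ₑ ^ 2
    calc ∫⁻ x in Metric.thickening δ (γ.ext '' (Metric.closedBall s₀ (b / 2) ∩ Icc 0 γ.length)),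
          ‖ψ x‖ₑ ^ 2
        ≤ ∫⁻ x in Metric.thickening δ (γ.ext '' (Metric.closedBall s₀ (b / 2) ∩ Icc 0 γ.length)),
          (2 * ‖ψ (x + δ • e)‖ₑ ^ 2 + 2 * ‖ψ (x + δ • e) - ψ x‖ₑ ^ 2) := by
          refine lintegral_mono fun x => ?_
          have := enorm_sq_le_two_mul (ψ x) (ψ (x + δ • e))
          rwa [← enorm_neg (ψ x - _), neg_sub] at this
      _ ≤ 2 * (∫⁻ x in GraphCurve.strip c e U (6 * δ), ‖ψ x‖ₑ ^ 2) +
          2 * (ENNReal.ofReal (δ ^ 2) * D) := by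
          rw [lintegral_add_left hm,
            lintegral_const_mul' _ _ (by simp), lintegral_const_mul' _ _ (by simp)]
          gcongr
          exact (setLIntegral_le_lintegral _ _).trans htr
      _ ≤ 2 * (4 * ENNReal.ofReal (6 * δ) * S +
          4 * ENNReal.ofReal ((6 * δ) ^ 2) * ENNReal.ofReal (1 / 2)⁻¹ * D) +
          2 * (ENNReal.ofReal (δ ^ 2) * D) := by
          gcongr
          refine hstrip.trans ?_
          gcongr
      _ = 48 * (ENNReal.ofReal δ * S) + 578 * (ENNReal.ofReal (δ ^ 2) * D) := by
          rw [mul_pow, ENNReal.ofReal_mul (by norm_num), ENNReal.ofReal_mul (by norm_num)]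
          norm_num
          ring
      _ ≤ _ := by
          rw [mul_add]
          gcongr <;> norm_num

end PlaneArc

/-! ### Test functions, mollification and cutoff -/

namespace IsTestFunction

variable {E : Type*} [NormedAddCommGroup E] [NormedSpace ℝ E] {U : Set E} {φ ψ : E → ℝ}

lemma zero : IsTestFunction U (fun _ : E => (0 : ℝ)) :=
  ⟨contDiff_const, HasCompactSupport.zero, by
    rw [show (fun _ : E => (0 : ℝ)) = 0 from rfl, tsupport_zero]; exact empty_subset _⟩

lemma mul_left (hφ : IsTestFunction U φ) {η : E → ℝ} (hη : ContDiff ℝ ∞ η) :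
    IsTestFunction U (fun x => η x * φ x) :=
  ⟨hη.mul hφ.contDiff, hφ.hasCompactSupport.mul_left,
    (tsupport_mul_subset_right).trans hφ.tsupport_subset⟩

lemma const_mul (hφ : IsTestFunction U φ) (a : ℝ) : IsTestFunction U (fun x => a * φ x) :=
  hφ.mul_left contDiff_const

lemma add (hφ : IsTestFunction U φ) (hψ : IsTestFunction U ψ) :
    IsTestFunction U (fun x => φ x + ψ x) :=
  ⟨hφ.contDiff.add hψ.contDiff, hφ.hasCompactSupport.add hψ.hasCompactSupport,
    (tsupport_add φ ψ).trans (union_subset hφ.tsupport_subset hψ.tsupport_subset)⟩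

lemma sub (hφ : IsTestFunction U φ) (hψ : IsTestFunction U ψ) :
    IsTestFunction U (fun x => φ x - ψ x) := by
  have := hφ.add (hψ.const_mul (-1))
  simpa [sub_eq_add_neg] using this

lemma contDiff_one (hφ : IsTestFunction U φ) : ContDiff ℝ 1 φ := hφ.contDiff.of_le (by norm_cast)

lemma eq_zero (hφ : IsTestFunction U φ) {x : E} (hx : x ∉ U) : φ x = 0 :=
  image_eq_zero_of_notMem_tsupport fun h => hx (hφ.tsupport_subset h)

lemma fderiv_eq_zero (hφ : IsTestFunction U φ) {x : E} (hx : x ∉ U) : fderiv ℝ φ x = 0 := by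
  by_contra h
  exact hx (hφ.tsupport_subset (support_fderiv_subset ℝ h))

lemma continuous_fderiv (hφ : IsTestFunction U φ) : Continuous (fderiv ℝ φ) :=
  hφ.contDiff_one.continuous_fderiv (by norm_num)

end IsTestFunction

/-- Mollification with the normalized bump function `ρ`. -/
noncomputable def mollify (ρ : ContDiffBump (0 : Plane)) (f : Plane → ℝ) : Plane → ℝ :=
  ρ.normed volume ⋆[ContinuousLinearMap.lsmul ℝ ℝ, volume] f

lemma mollify_contDiff (ρ : ContDiffBump (0 : Plane)) {f : Plane → ℝ} (hf : Continuous f) :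
    ContDiff ℝ ∞ (mollify ρ f) :=
  ρ.hasCompactSupport_normed.contDiff_convolution_left _ ρ.contDiff_normed hf.locallyIntegrable

lemma mollify_dist_le (ρ : ContDiffBump (0 : Plane)) {f : Plane → ℝ} (hf : Continuous f)
    {ε : ℝ} {x : Plane} (h : ∀ y ∈ Metric.ball x ρ.rOut, dist (f y) (f x) ≤ ε) :
    |mollify ρ f x - f x| ≤ ε :=
  ρ.dist_normed_convolution_le hf.aestronglyMeasurable h

lemma mollify_apply (ρ : ContDiffBump (0 : Plane)) (f : Plane → ℝ) (x : Plane) :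
    mollify ρ f x = ∫ t, ρ.normed volume t * f (x - t) := rfl

/-- An average of `K`-Lipschitz functions is `K`-Lipschitz. With `g = f` this yields closeness of
the derivatives without differentiation under the integral; with `g = 0` it preserves the Lipschitz
constant of a distance function. -/
lemma mollify_sub_lipschitz (ρ : ContDiffBump (0 : Plane)) {f g : Plane → ℝ} (hf : Continuous f)
    {K : ℝ≥0} (h : ∀ t ∈ Metric.ball (0 : Plane) ρ.rOut, LipschitzWith K fun x => f (x - t) - g x) :
    LipschitzWith K fun x => mollify ρ f x - g x := by
  refine LipschitzWith.of_dist_le_mul fun x y => ?_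
  have hint : ∀ z, Integrable fun t => ρ.normed volume t * f (z - t) := fun z =>
    (ρ.continuous_normed.mul (by fun_prop)).integrable_of_hasCompactSupport
      ρ.hasCompactSupport_normed.mul_right
  have hint1 : Integrable (ρ.normed volume) := ρ.integrable_normed
  have h1 : (mollify ρ f x - g x) - (mollify ρ f y - g y) =
      ∫ t, ρ.normed volume t * ((f (x - t) - g x) - (f (y - t) - g y)) := by
    have : (fun t => ρ.normed volume t * ((f (x - t) - g x) - (f (y - t) - g y))) =
        fun t => (ρ.normed volume t * f (x - t) - ρ.normed volume t * f (y - t)) -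
          ρ.normed volume t * (g x - g y) := by ext t; ring
    rw [this, integral_sub (by exact (hint x).sub (hint y)) (hint1.mul_const _),
      integral_sub (hint x) (hint y), integral_mul_const, ρ.integral_normed, mollify_apply,
      mollify_apply]
    ring
  rw [Real.dist_eq, h1, ← Real.norm_eq_abs]
  have h2 : ∫ t, ρ.normed volume t * (K * dist x y) = K * dist x y := by
    rw [integral_mul_const, ρ.integral_normed, one_mul]
  rw [← h2]
  refine norm_integral_le_of_norm_le (hint1.mul_const _) (Eventually.of_forall fun t => ?_)
  rw [norm_mul, Real.norm_of_nonneg (ρ.nonneg_normed t)]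
  by_cases ht : t ∈ Metric.ball (0 : Plane) ρ.rOut
  · gcongr
    · exact ρ.nonneg_normed t
    · exact (h t ht).dist_le_mul x y
  · have : ρ.normed volume t = 0 := by
      rw [← Function.notMem_support, ρ.support_normed_eq]; exact ht
    rw [this, zero_mul, zero_mul]

/-- The bump function of radius `r` that is used for mollification. -/
noncomputable def stdBump {r : ℝ} (hr : 0 < r) : ContDiffBump (0 : Plane) :=
  ⟨r / 2, r, by positivity, by linarith⟩

/-- Mollification at a scale given by the uniform continuity of `f` and of its derivative. The
compact set does not depend on `ε`, which turns uniform closeness of the derivatives into closeness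
of their square integrals. -/
lemma exists_test_near {Ω : Set Plane} (hΩ : IsOpen Ω) {f : Plane → ℝ} (hf : ContDiff ℝ 1 f)
    (hfc : HasCompactSupport f) (hfΩ : tsupport f ⊆ Ω) :
    ∃ K : Set Plane, IsCompact K ∧ ∀ ε > 0, ∃ φ : Plane → ℝ, IsTestFunction Ω φ ∧
      (∀ x, ‖φ x - f x‖ ≤ ε) ∧ (∀ x, ‖fderiv ℝ φ x - fderiv ℝ f x‖ ≤ ε) ∧
      ∀ x ∉ K, fderiv ℝ φ x = 0 ∧ fderiv ℝ f x = 0 := by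
  obtain ⟨r₀, hr₀, hK⟩ := hfc.isCompact.exists_cthickening_subset_open hΩ hfΩ
  refine ⟨Metric.cthickening r₀ (tsupport f), hfc.isCompact.cthickening, fun ε hε => ?_⟩
  have hfu : UniformContinuous f := hfc.uniformContinuous_of_continuous hf.continuous
  have hdu : UniformContinuous (fderiv ℝ f) :=
    (hfc.fderiv ℝ).uniformContinuous_of_continuous (hf.continuous_fderiv (by norm_num))
  obtain ⟨r₁, hr₁, h1⟩ := Metric.uniformContinuous_iff.1 hfu ε hε
  obtain ⟨r₂, hr₂, h2⟩ := Metric.uniformContinuous_iff.1 hdu ε hε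
  have hr : 0 < min r₀ (min r₁ r₂) := lt_min hr₀ (lt_min hr₁ hr₂)
  let ρ := stdBump hr
  have hρ0 : ρ.rOut ≤ r₀ := min_le_left _ _
  have hρ1 : ρ.rOut ≤ r₁ := (min_le_right _ _).trans (min_le_left _ _)
  have hρ2 : ρ.rOut ≤ r₂ := (min_le_right _ _).trans (min_le_right _ _)
  have hsupp : tsupport (mollify ρ f) ⊆ Metric.cthickening r₀ (tsupport f) := by
    refine closure_minimal (fun x hx => ?_) Metric.isClosed_cthickening
    by_contra hx'
    apply hx
    rw [mollify_apply]
    refine integral_eq_zero_of_ae (Eventually.of_forall fun t => ?_)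
    by_cases ht : t ∈ Metric.ball (0 : Plane) ρ.rOut
    · have : f (x - t) = 0 := by
        refine image_eq_zero_of_notMem_tsupport fun hxt => hx' ?_
        refine Metric.mem_cthickening_of_dist_le x (x - t) _ _ hxt ?_
        rw [dist_eq_norm, sub_sub_cancel]
        exact (mem_ball_zero_iff.1 ht).le.trans hρ0
      simp [this]
    · have : ρ.normed volume t = 0 := by
        rw [← Function.notMem_support, ρ.support_normed_eq]; exact ht
      simp [this]
  have hφ : ContDiff ℝ ∞ (mollify ρ f) := mollify_contDiff ρ hf.continuous
  refine ⟨mollify ρ f, ⟨hφ, ?_, hsupp.trans hK⟩, fun x => ?_, fun x => ?_, fun x hx => ⟨?_, ?_⟩⟩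
  · exact hfc.isCompact.cthickening.of_isClosed_subset (isClosed_tsupport _) hsupp
  · refine mollify_dist_le ρ hf.continuous fun y hy => (h1 ?_).le
    exact (Metric.mem_ball.1 hy).trans_le hρ1
  · have hlip : LipschitzWith ε.toNNReal fun x => mollify ρ f x - f x := by
      refine mollify_sub_lipschitz ρ hf.continuous fun t ht => ?_
      have hfd := hf.differentiable (by norm_num)
      refine lipschitzWith_of_nnnorm_fderiv_le (𝕜 := ℝ) (by fun_prop) fun z => ?_
      rw [fderiv_fun_sub (by fun_prop) (by fun_prop), fderiv_comp_sub]
      rw [← NNReal.coe_le_coe, coe_nnnorm, Real.coe_toNNReal _ hε.le, ← dist_eq_norm]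
      refine (h2 ?_).le
      rw [dist_eq_norm]
      simpa using (mem_ball_zero_iff.1 ht).trans_le hρ2
    have := norm_fderiv_le_of_lipschitz ℝ (x₀ := x) hlip
    rwa [Real.coe_toNNReal _ hε.le, fderiv_fun_sub ((hφ.differentiable (by norm_num)) x)
      ((hf.differentiable (by norm_num)) x)] at this
  · by_contra h
    exact hx (hsupp (support_fderiv_subset ℝ h))
  · by_contra h
    exact hx (Metric.self_subset_cthickening _ (support_fderiv_subset ℝ h))

/-- A fixed bump function of one variable is composed with the distance to `S`, mollified at scale
`δ / 8` and divided by `δ`. The constant is the Lipschitz constant of the bump, hence independent of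
`S` and `δ`. -/
lemma exists_cutoff : ∃ C : ℝ≥0, ∀ (S : Set Plane) (δ : ℝ), 0 < δ → ∃ η : Plane → ℝ,
    ContDiff ℝ ∞ η ∧ (∀ x, 0 ≤ η x ∧ η x ≤ 1) ∧ (∀ x ∈ S, η x = 0) ∧
    (∀ x ∉ Metric.thickening δ S, η x = 1) ∧ (∀ x ∉ Metric.thickening δ S, fderiv ℝ η x = 0) ∧
    ∀ x, ‖fderiv ℝ η x‖ ≤ C / δ := by
  -- The mollified distance is off by at most `δ / 8`: on `S` it is below `δ / 4`, off the
  -- thickening it is above `3 * δ / 4`.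
  let b : ContDiffBump (0 : ℝ) := ⟨1 / 4, 3 / 4, by norm_num, by norm_num⟩
  obtain ⟨C, hC⟩ := (b.contDiff (n := 1)).lipschitzWith_of_hasCompactSupport b.hasCompactSupport
    (by norm_num)
  refine ⟨C, fun S δ hδ => ?_⟩
  -- `Metric.infDist x ∅` is `0` by default, so the general construction would give the wrong cutoff
  -- here.
  rcases S.eq_empty_or_nonempty with rfl | hS
  · refine ⟨fun _ => 1, contDiff_const, fun _ => ⟨zero_le_one, le_rfl⟩, by simp, by simp,
      by simp, fun x => ?_⟩
    rw [fderiv_fun_const]; simp; positivity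
  have hr : 0 < δ / 8 := by positivity
  let ρ := stdBump hr
  let d : Plane → ℝ := fun x => Metric.infDist x S
  have hd : LipschitzWith 1 d := Metric.lipschitz_infDist_pt S
  have hdc : Continuous d := hd.continuous
  let m := mollify ρ d
  have hmd : ∀ x, |m x - d x| ≤ δ / 8 := fun x => mollify_dist_le ρ hdc fun y hy =>
    (hd.dist_le_mul y x).trans (by simpa using (show dist y x ≤ δ / 8 from (Metric.mem_ball.1 hy).le))
  have hml : LipschitzWith 1 m := by
    have := mollify_sub_lipschitz ρ (g := fun _ => 0) hdc (K := 1) fun t _ => by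
      simp only [sub_zero]
      exact LipschitzWith.of_dist_le_mul fun x y => by
        simpa using hd.dist_le_mul (x - t) (y - t)
    simpa using this
  have hη : ContDiff ℝ ∞ fun x => 1 - b (δ⁻¹ * m x) :=
    contDiff_const.sub (b.contDiff.comp (contDiff_const.mul (mollify_contDiff ρ hdc)))
  have hone : ∀ x ∉ Metric.thickening δ S, 1 - b (δ⁻¹ * m x) = 1 := by
    intro x hx
    have h1 : δ ≤ d x := by
      by_contra h
      refine hx (Metric.mem_thickening_iff.2 ?_)
      exact (Metric.infDist_lt_iff hS).1 (not_le.1 h)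
    have h2 := (abs_le.1 (hmd x)).1
    rw [b.zero_of_le_dist, sub_zero]
    rw [dist_zero_right, norm_mul, norm_inv, Real.norm_of_nonneg hδ.le, Real.norm_eq_abs,
      inv_mul_eq_div, le_div_iff₀ hδ]
    refine le_trans ?_ (le_abs_self _)
    change 3 / 4 * δ ≤ m x
    linarith
  refine ⟨fun x => 1 - b (δ⁻¹ * m x), hη, fun x => ⟨?_, ?_⟩, fun x hx => ?_, hone, fun x hx => ?_,
    fun x => ?_⟩
  · linarith [b.le_one (x := δ⁻¹ * m x)]
  · linarith [b.nonneg (x := δ⁻¹ * m x)]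
  · have h1 : d x = 0 := Metric.infDist_zero_of_mem hx
    have h2 := hmd x
    rw [h1, sub_zero] at h2
    simp only
    rw [b.one_of_mem_closedBall, sub_self]
    rw [mem_closedBall_zero_iff, norm_mul, norm_inv, Real.norm_of_nonneg hδ.le, Real.norm_eq_abs,
      inv_mul_eq_div, div_le_iff₀ hδ]
    change |m x| ≤ 1 / 4 * δ
    linarith
  -- At points at distance exactly `δ` the cutoff need not be constant nearby, but it attains its
  -- maximal value `1`.
  · have hmax : IsLocalMax (fun x => 1 - b (δ⁻¹ * m x)) x := by
      refine Eventually.of_forall fun y => ?_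
      simp only [hone x hx]
      linarith [b.nonneg (x := δ⁻¹ * m y)]
    exact hmax.fderiv_eq_zero
  · have hlip : LipschitzWith (C * (‖δ⁻¹‖₊ * 1)) fun x => 1 - b (δ⁻¹ * m x) := by
      have h1 : LipschitzWith (‖δ⁻¹‖₊ * 1) fun x => δ⁻¹ * m x := by
        refine LipschitzWith.of_dist_le_mul fun x y => ?_
        rw [Real.dist_eq, ← mul_sub, abs_mul]
        have := hml.dist_le_mul x y
        rw [Real.dist_eq] at this
        simp only [coe_nnnorm, Real.norm_eq_abs, NNReal.coe_one, mul_one, one_mul]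
          at this ⊢
        gcongr
      refine LipschitzWith.of_dist_le_mul fun x y => ?_
      rw [dist_sub_left]
      exact (hC.comp h1).dist_le_mul x y
    have := norm_fderiv_le_of_lipschitz ℝ (x₀ := x) hlip
    refine this.trans_eq ?_
    simp [abs_of_pos hδ, div_eq_mul_inv]

/-! ### Energy, and approximation of functions on the pattern -/

section Energy

variable {ι : Type*} [Fintype ι]

/-- The squared norm of `H_Γ^{1,0}`, as an extended nonnegative number. -/
noncomputable def energy (G : Pattern ι) (φ : Plane → ℝ) : ℝ≥0∞ :=
  (∫⁻ x, ‖fderiv ℝ φ x‖ₑ ^ 2) + ∑ i, ∫⁻ s in Icc 0 (G.arc i).length,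
    ‖fderiv ℝ φ ((G.arc i).ext s) ((G.arc i).extTangent s)‖ₑ ^ 2

/-- The family `W` of functions on the curves is approximated in `L²` by the traces of test
functions with bounded energy. -/
def TraceApprox (Ω : Set Plane) (G : Pattern ι) (W : ι → ℝ → ℝ) : Prop :=
  ∃ M : ℝ≥0, ∀ ε : ℝ≥0∞, 0 < ε → ∃ φ : Plane → ℝ, IsTestFunction Ω φ ∧ energy G φ ≤ M ∧
    ∀ i, ∫⁻ s in Icc 0 (G.arc i).length, ‖φ ((G.arc i).ext s) - W i s‖ₑ ^ 2 ≤ ε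

lemma enorm_add_sq_le {E : Type*} [NormedAddCommGroup E] (a b : E) :
    ‖a + b‖ₑ ^ 2 ≤ 2 * ‖a‖ₑ ^ 2 + 2 * ‖b‖ₑ ^ 2 :=
  (pow_le_pow_left₀ zero_le (enorm_add_le a b) 2).trans (ennreal_add_sq_le _ _)

lemma setLIntegral_sq_lt_top {X E : Type*} [TopologicalSpace X] [MeasurableSpace X]
    [OpensMeasurableSpace X] [NormedAddCommGroup E] {μ : Measure X} [IsFiniteMeasureOnCompacts μ]
    {F : X → E} {K : Set X} (hK : IsCompact K) (hF : ContinuousOn F K) :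
    ∫⁻ x in K, ‖F x‖ₑ ^ 2 ∂μ < ⊤ := by
  obtain ⟨C, hC⟩ := hK.exists_bound_of_continuousOn hF
  refine (setLIntegral_mono measurable_const (g := fun _ => ENNReal.ofReal C ^ 2)
    fun x hx => ?_).trans_lt ?_
  · gcongr
    rw [← ofReal_norm]
    exact ENNReal.ofReal_le_ofReal (hC x hx)
  · rw [setLIntegral_const]
    exact ENNReal.mul_lt_top (by finiteness) hK.measure_lt_top

lemma lintegral_sq_lt_top {E : Type*} [NormedAddCommGroup E] {F : Plane → E}
    (hF : Continuous F) {K : Set Plane} (hK : IsCompact K) (h0 : ∀ x ∉ K, F x = 0) :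
    ∫⁻ x, ‖F x‖ₑ ^ 2 < ⊤ := by
  rw [← setLIntegral_eq_of_support_subset (s := K)]
  · exact setLIntegral_sq_lt_top hK hF.continuousOn
  · intro x hx
    by_contra h
    simp [h0 x h] at hx

lemma continuous_arc_fderiv {φ : Plane → ℝ} (hφ : ContDiff ℝ 1 φ) (γ : PlaneArc) :
    Continuous fun s => fderiv ℝ φ (γ.ext s) (γ.extTangent s) :=
  ((hφ.continuous_fderiv (by norm_num)).comp γ.continuous_ext).clm_apply γ.continuous_extTangent

lemma IsTestFunction.energy_lt_top {Ω : Set Plane} {φ : Plane → ℝ} (hφ : IsTestFunction Ω φ)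
    (G : Pattern ι) : energy G φ < ⊤ := by
  refine ENNReal.add_lt_top.2 ⟨?_, ENNReal.sum_lt_top.2 fun i _ => ?_⟩
  · refine lintegral_sq_lt_top hφ.continuous_fderiv hφ.hasCompactSupport.isCompact fun x hx => ?_
    by_contra h
    exact hx (support_fderiv_subset ℝ h)
  · exact setLIntegral_sq_lt_top isCompact_Icc
      (continuous_arc_fderiv hφ.contDiff_one _).continuousOn

lemma energy_add_le (G : Pattern ι) {φ ψ : Plane → ℝ} (hφ : ContDiff ℝ 1 φ)
    (hψ : ContDiff ℝ 1 ψ) :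
    energy G (fun x => φ x + ψ x) ≤ 2 * energy G φ + 2 * energy G ψ := by
  have hd : ∀ x, fderiv ℝ (fun x => φ x + ψ x) x = fderiv ℝ φ x + fderiv ℝ ψ x := fun x =>
    fderiv_fun_add ((hφ.differentiable (by norm_num)) x) ((hψ.differentiable (by norm_num)) x)
  have h1 : ∫⁻ x, ‖fderiv ℝ (fun x => φ x + ψ x) x‖ₑ ^ 2 ≤
      2 * (∫⁻ x, ‖fderiv ℝ φ x‖ₑ ^ 2) + 2 * ∫⁻ x, ‖fderiv ℝ ψ x‖ₑ ^ 2 := by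
    rw [← lintegral_const_mul' _ _ (by simp), ← lintegral_const_mul' _ _ (by simp),
      ← lintegral_add_left ((measurable_grad_sq hφ).const_mul _)]
    refine lintegral_mono fun x => ?_
    rw [hd]
    exact enorm_add_sq_le _ _
  have h2 : ∀ i, ∫⁻ s in Icc 0 (G.arc i).length,
      ‖fderiv ℝ (fun x => φ x + ψ x) ((G.arc i).ext s) ((G.arc i).extTangent s)‖ₑ ^ 2 ≤
      2 * (∫⁻ s in Icc 0 (G.arc i).length,
        ‖fderiv ℝ φ ((G.arc i).ext s) ((G.arc i).extTangent s)‖ₑ ^ 2) +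
      2 * ∫⁻ s in Icc 0 (G.arc i).length,
        ‖fderiv ℝ ψ ((G.arc i).ext s) ((G.arc i).extTangent s)‖ₑ ^ 2 := by
    intro i
    rw [← lintegral_const_mul' _ _ (by simp), ← lintegral_const_mul' _ _ (by simp),
      ← lintegral_add_left]
    · refine lintegral_mono fun x => ?_
      rw [hd]
      exact enorm_add_sq_le _ _
    · exact ((continuous_arc_fderiv hφ _).enorm.measurable.pow_const 2).const_mul _
  calc energy G (fun x => φ x + ψ x) ≤ _ := add_le_add h1 (Finset.sum_le_sum fun i _ => h2 i)
    _ = _ := by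
      rw [Finset.sum_add_distrib, ← Finset.mul_sum, ← Finset.mul_sum, energy, energy]
      ring

namespace TraceApprox

variable {Ω : Set Plane} {G : Pattern ι} {W V : ι → ℝ → ℝ}

lemma congr (hW : TraceApprox Ω G W)
    (h : ∀ i, ∀ s ∈ Icc 0 (G.arc i).length, W i s = V i s) : TraceApprox Ω G V := by
  obtain ⟨M, hM⟩ := hW
  refine ⟨M, fun ε hε => ?_⟩
  obtain ⟨φ, h1, h2, h3⟩ := hM ε hε
  refine ⟨φ, h1, h2, fun i => (h3 i).trans_eq' ?_⟩
  exact setLIntegral_congr_fun measurableSet_Icc fun s hs => by simp only [h i s hs]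

lemma add (hW : TraceApprox Ω G W) (hV : TraceApprox Ω G V)
    (hWm : ∀ i, Measurable (W i)) : TraceApprox Ω G (fun i s => W i s + V i s) := by
  obtain ⟨M, hM⟩ := hW
  obtain ⟨N, hN⟩ := hV
  refine ⟨2 * M + 2 * N, fun ε hε => ?_⟩
  have hε' : 0 < ε / 4 := ENNReal.div_pos hε.ne' (by simp)
  obtain ⟨φ, h1, h2, h3⟩ := hM _ hε'
  obtain ⟨ψ, k1, k2, k3⟩ := hN _ hε'
  refine ⟨fun x => φ x + ψ x, h1.add k1, ?_, fun i => ?_⟩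
  · refine (energy_add_le G h1.contDiff_one k1.contDiff_one).trans ?_
    push_cast
    gcongr
  · calc ∫⁻ s in Icc 0 (G.arc i).length,
          ‖φ ((G.arc i).ext s) + ψ ((G.arc i).ext s) - (W i s + V i s)‖ₑ ^ 2
        ≤ ∫⁻ s in Icc 0 (G.arc i).length, (2 * ‖φ ((G.arc i).ext s) - W i s‖ₑ ^ 2 +
          2 * ‖ψ ((G.arc i).ext s) - V i s‖ₑ ^ 2) := by
          refine lintegral_mono fun s => ?_
          rw [add_sub_add_comm]
          exact enorm_add_sq_le _ _
      _ = 2 * (∫⁻ s in Icc 0 (G.arc i).length, ‖φ ((G.arc i).ext s) - W i s‖ₑ ^ 2) +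
          2 * ∫⁻ s in Icc 0 (G.arc i).length, ‖ψ ((G.arc i).ext s) - V i s‖ₑ ^ 2 := by
          have hm : Measurable fun s => φ ((G.arc i).ext s) :=
            (h1.contDiff.continuous.comp (G.arc i).continuous_ext).measurable
          rw [lintegral_add_left, lintegral_const_mul' _ _ (by simp),
            lintegral_const_mul' _ _ (by simp)]
          exact ((hm.sub (hWm i)).enorm.pow_const 2).const_mul _
      _ ≤ 2 * (ε / 4) + 2 * (ε / 4) := by gcongr; exacts [h3 i, k3 i]
      _ = ε := by
          rw [← add_mul, ← mul_div_assoc]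
          norm_num
          rw [mul_comm]
          exact ENNReal.mul_div_cancel_right (by norm_num) (by norm_num)

lemma of_test {φ : Plane → ℝ} (hφ : IsTestFunction Ω φ) :
    TraceApprox Ω G fun i s => φ ((G.arc i).ext s) :=
  ⟨(energy G φ).toNNReal, fun ε _ => ⟨φ, hφ, by
    rw [ENNReal.coe_toNNReal (hφ.energy_lt_top G).ne], by simp⟩⟩

lemma sum {α : Type*} (S : Finset α) {W : α → ι → ℝ → ℝ} (hW : ∀ a ∈ S, TraceApprox Ω G (W a))
    (hm : ∀ a ∈ S, ∀ i, Measurable (W a i)) :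
    TraceApprox Ω G fun i s => ∑ a ∈ S, W a i s := by
  classical
  induction S using Finset.induction_on with
  | empty => simpa using of_test (Ω := Ω) (G := G) (φ := fun _ => 0) IsTestFunction.zero
  | insert a S ha ih =>
    simp only [Finset.sum_insert ha]
    exact (hW a (Finset.mem_insert_self _ _)).add
      (ih (fun b hb => hW b (Finset.mem_insert_of_mem hb))
        fun b hb => hm b (Finset.mem_insert_of_mem hb)) (hm a (Finset.mem_insert_self _ _))

/-- The extension into a cone uses coordinates along a curve and is only `C¹`. Mollification makes
it smooth, at the cost of an arbitrarily small energy. -/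
lemma of_contDiff (hΩ : IsOpen Ω) (M : ℝ≥0) (h : ∀ ε : ℝ≥0∞, 0 < ε → ∃ f : Plane → ℝ,
    ContDiff ℝ 1 f ∧ HasCompactSupport f ∧ tsupport f ⊆ Ω ∧ energy G f ≤ M ∧
    ∀ i, ∫⁻ s in Icc 0 (G.arc i).length, ‖f ((G.arc i).ext s) - W i s‖ₑ ^ 2 ≤ ε) :
    TraceApprox Ω G W := by
  refine ⟨2 * M + 2, fun ε hε => ?_⟩
  obtain ⟨f, hf, hfc, hfΩ, hfM, hfW⟩ := h (ε / 4) (ENNReal.div_pos hε.ne' (by simp))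
  obtain ⟨K, hK, hnear⟩ := exists_test_near hΩ hf hfc hfΩ
  -- The total measure over which the uniform error is integrated: the gradient error lives on `K`,
  -- the errors of the traces on the curves.
  set A : ℝ≥0∞ := volume K + ∑ i, ENNReal.ofReal (G.arc i).length with hA
  have hAtop : A ≠ ⊤ :=
    (ENNReal.add_lt_top.2 ⟨hK.measure_lt_top, ENNReal.sum_lt_top.2 fun _ _ => by simp⟩).ne
  obtain ⟨r, hr, hr1, hr2⟩ : ∃ r : ℝ, 0 < r ∧ ENNReal.ofReal r ^ 2 * A ≤ 1 ∧
      ENNReal.ofReal r ^ 2 * A ≤ ε / 4 := by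
    have ht : Tendsto (fun r : ℝ => ENNReal.ofReal r ^ 2 * A) (𝓝[>] 0) (𝓝 0) := by
      have h1 : Tendsto (fun r : ℝ => ENNReal.ofReal r ^ 2 * A) (𝓝 0)
          (𝓝 (ENNReal.ofReal 0 ^ 2 * A)) :=
        ENNReal.Tendsto.mul_const ((ENNReal.continuous_pow 2).tendsto _ |>.comp
          (ENNReal.continuous_ofReal.tendsto 0)) (Or.inr hAtop)
      simp only [ENNReal.ofReal_zero, ne_eq, OfNat.ofNat_ne_zero, not_false_eq_true, zero_pow,
        zero_mul] at h1
      exact h1.mono_left nhdsWithin_le_nhds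
    have e1 := ht.eventually_le_const (u := 1) (by norm_num)
    have e2 := ht.eventually_le_const (u := ε / 4) (ENNReal.div_pos hε.ne' (by simp))
    obtain ⟨r, ⟨h1, h2⟩, h3⟩ := ((e1.and e2).and self_mem_nhdsWithin).exists
    exact ⟨r, h3, h1, h2⟩
  obtain ⟨φ, hφ, h0, h1, h2⟩ := hnear r hr
  have hlen : ∀ i (F : ℝ → ℝ), (∀ s, ‖F s‖ₑ ≤ ENNReal.ofReal r) →
      ∫⁻ s in Icc 0 (G.arc i).length, ‖F s‖ₑ ^ 2 ≤
        ENNReal.ofReal r ^ 2 * ENNReal.ofReal (G.arc i).length := by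
    intro i F hF
    refine (lintegral_mono fun s => pow_le_pow_left₀ zero_le (hF s) 2).trans_eq ?_
    rw [setLIntegral_const, Real.volume_Icc, sub_zero]
  have hd0 : ∀ x, ‖φ x - f x‖ₑ ≤ ENNReal.ofReal r := fun x => by
    rw [← ofReal_norm]; exact ENNReal.ofReal_le_ofReal (h0 x)
  have hd1 : ∀ x, ‖fderiv ℝ φ x - fderiv ℝ f x‖ₑ ≤ ENNReal.ofReal r := fun x => by
    rw [← ofReal_norm]; exact ENNReal.ofReal_le_ofReal (h1 x)
  have hdiff : ContDiff ℝ 1 fun x => φ x - f x := hφ.contDiff_one.sub hf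
  have hfd : ∀ x, fderiv ℝ (fun x => φ x - f x) x = fderiv ℝ φ x - fderiv ℝ f x := fun x =>
    fderiv_fun_sub ((hφ.contDiff_one.differentiable (by norm_num)) x)
      ((hf.differentiable (by norm_num)) x)
  have hE : energy G (fun x => φ x - f x) ≤ 1 := by
    refine le_trans ?_ hr1
    rw [hA, mul_add, energy, Finset.mul_sum]
    refine add_le_add ?_ (Finset.sum_le_sum fun i _ => ?_)
    · rw [← setLIntegral_eq_of_support_subset (s := K)]
      · refine (lintegral_mono fun x => pow_le_pow_left₀ zero_le ((hfd x).symm ▸ hd1 x) 2).trans_eq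
          (by rw [setLIntegral_const])
      · intro x hx
        by_contra hxK
        refine hx ?_
        beta_reduce
        rw [hfd, (h2 x hxK).1, (h2 x hxK).2, sub_zero, ← ofReal_norm, norm_zero]; simp
    · refine hlen i _ fun s => ?_
      exact (enorm_fderiv_apply_le _ _ ((G.arc i).norm_extTangent s)).trans
        ((hfd _).symm ▸ hd1 _)
  refine ⟨φ, hφ, ?_, fun i => ?_⟩
  · have h3 := energy_add_le G hf hdiff
    simp only [add_sub_cancel] at h3
    refine h3.trans ?_
    push_cast
    gcongr
    simpa using mul_le_mul_right hE 2
  · calc ∫⁻ s in Icc 0 (G.arc i).length, ‖φ ((G.arc i).ext s) - W i s‖ₑ ^ 2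
        ≤ ∫⁻ s in Icc 0 (G.arc i).length, (2 * ‖φ ((G.arc i).ext s) - f ((G.arc i).ext s)‖ₑ ^ 2 +
          2 * ‖f ((G.arc i).ext s) - W i s‖ₑ ^ 2) := by
          refine lintegral_mono fun s => ?_
          rw [← sub_add_sub_cancel (φ ((G.arc i).ext s)) (f ((G.arc i).ext s))]
          exact enorm_add_sq_le _ _
      _ ≤ 2 * (ε / 4) + 2 * (ε / 4) := by
          have hm : Measurable fun s => φ ((G.arc i).ext s) - f ((G.arc i).ext s) :=
            (hdiff.continuous.comp (G.arc i).continuous_ext).measurable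
          rw [lintegral_add_left ((hm.enorm.pow_const 2).const_mul _),
            lintegral_const_mul' _ _ (by simp), lintegral_const_mul' _ _ (by simp)]
          gcongr
          · refine (hlen i _ fun s => hd0 _).trans (le_trans ?_ hr2)
            gcongr
            rw [hA]
            exact (Finset.single_le_sum (f := fun i => ENNReal.ofReal (G.arc i).length)
              (fun _ _ => zero_le) (Finset.mem_univ i)).trans le_add_self
          · exact hfW i
      _ = ε := by
          rw [← add_mul, ← mul_div_assoc]
          norm_num
          rw [mul_comm]
          exact ENNReal.mul_div_cancel_right (by norm_num) (by norm_num)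

end TraceApprox

end Energy

/-! ### One-dimensional Sobolev functions -/

/-- `W` is absolutely continuous on `[a, b]`, with derivative `D ∈ L²(a, b)`. -/
structure SobolevOn (a b : ℝ) (W D : ℝ → ℝ) : Prop where
  memLp : MemLp D 2 (volume.restrict (Icc a b))
  sub_eq : ∀ s ∈ Icc a b, ∀ t ∈ Icc a b, W t - W s = ∫ r in s..t, D r

/-- The primitive that starts at the left end of the support also vanishes to the right of the
support, because the total integral is zero. -/
lemma IsTestFunction.exists_primitive {a b : ℝ} {θ : ℝ → ℝ}
    (hθ : IsTestFunction (Ioo a b) θ) (h0 : ∫ x, θ x = 0) :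
    ∃ ψ, IsTestFunction (Ioo a b) ψ ∧ deriv ψ = θ := by
  -- For an empty support `sInf` and `sSup` have default values that need not lie in the interval.
  rcases (tsupport θ).eq_empty_or_nonempty with h | hne
  · refine ⟨fun _ => 0, IsTestFunction.zero, ?_⟩
    rw [tsupport_eq_empty_iff] at h
    rw [h]; ext; simp
  have hK := hθ.hasCompactSupport.isCompact
  set a' := sInf (tsupport θ)
  set b' := sSup (tsupport θ)
  have ha' := hθ.tsupport_subset (hK.sInf_mem hne)
  have hb' := hθ.tsupport_subset (hK.sSup_mem hne)
  have hsub : tsupport θ ⊆ Icc a' b' := fun x hx =>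
    ⟨(hK.isLeast_sInf hne).2 hx, (hK.isGreatest_sSup hne).2 hx⟩
  have hzero : ∀ x, x ∉ Icc a' b' → θ x = 0 := fun x hx =>
    image_eq_zero_of_notMem_tsupport fun h => hx (hsub h)
  have hc : Continuous θ := hθ.contDiff.continuous
  have hd : ∀ x, HasDerivAt (fun x => ∫ t in a'..x, θ t) (θ x) x := fun x =>
    intervalIntegral.integral_hasDerivAt_right (hc.intervalIntegrable _ _)
      (hc.stronglyMeasurableAtFilter _ _) hc.continuousAt
  have hderiv : deriv (fun x => ∫ t in a'..x, θ t) = θ := funext fun x => (hd x).deriv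
  have hts : tsupport (fun x => ∫ t in a'..x, θ t) ⊆ Icc a' b' := by
    refine closure_minimal (fun x hx => ?_) isClosed_Icc
    by_contra hx'
    refine hx ?_
    simp only
    rcases lt_or_ge x a' with h | h
    · rw [intervalIntegral.integral_symm, intervalIntegral.integral_of_le h.le,
        integral_Ioc_eq_integral_Ioo, setIntegral_eq_zero_of_forall_eq_zero, neg_zero]
      exact fun t ht => hzero t fun h' => by linarith [h'.1, ht.2]
    · have hxb : b' < x := by
        by_contra h2; exact hx' ⟨h, not_lt.1 h2⟩
      rw [intervalIntegral.integral_of_le h, ← integral_Icc_eq_integral_Ioc,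
        setIntegral_eq_integral_of_forall_compl_eq_zero, h0]
      exact fun t ht => hzero t fun h' => ht ⟨h'.1, h'.2.trans hxb.le⟩
  refine ⟨fun x => ∫ t in a'..x, θ t, ⟨?_, ?_, ?_⟩, hderiv⟩
  · rw [contDiff_infty_iff_deriv, hderiv]
    exact ⟨fun x => (hd x).differentiableAt, hθ.contDiff⟩
  · exact isCompact_Icc.of_isClosed_subset (isClosed_tsupport _) hts
  · exact hts.trans fun x hx => ⟨ha'.1.trans_le hx.1, hx.2.trans_lt hb'.2⟩

lemma exists_test_integral_one {a b : ℝ} (hab : a < b) :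
    ∃ β, IsTestFunction (Ioo a b) β ∧ ∫ x, β x = 1 := by
  let f : ContDiffBump ((a + b) / 2) := ⟨(b - a) / 8, (b - a) / 4, by linarith, by linarith⟩
  refine ⟨f.normed volume, ⟨f.contDiff_normed, f.hasCompactSupport_normed, ?_⟩,
    f.integral_normed⟩
  rw [f.tsupport_normed_eq, Real.closedBall_eq_Icc]
  intro x hx
  have h1 : (a + b) / 2 - (b - a) / 4 ≤ x := hx.1
  have h2 : x ≤ (a + b) / 2 + (b - a) / 4 := hx.2
  constructor <;> linarith

/-- The du Bois-Reymond lemma. -/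
lemma ae_const_of_weak_deriv_zero {a b : ℝ} (hab : a < b) {f : ℝ → ℝ}
    (hf : IntegrableOn f (Ioo a b))
    (h : ∀ ψ, IsTestFunction (Ioo a b) ψ → ∫ x in Ioo a b, f x * deriv ψ x = 0) :
    ∃ c, f =ᵐ[volume.restrict (Ioo a b)] fun _ => c := by
  obtain ⟨β, hβ, hβ1⟩ := exists_test_integral_one hab
  have hint : ∀ η : ℝ → ℝ, IsTestFunction (Ioo a b) η → Integrable η := fun η hη =>
    hη.contDiff.continuous.integrable_of_hasCompactSupport hη.hasCompactSupport
  have hfint : ∀ η : ℝ → ℝ, IsTestFunction (Ioo a b) η →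
      IntegrableOn (fun x => f x * η x) (Ioo a b) := fun η hη => by
    obtain ⟨C, hC⟩ := hη.contDiff.continuous.bounded_above_of_compact_support hη.hasCompactSupport
    exact hf.mul_bdd hη.contDiff.continuous.aestronglyMeasurable (Eventually.of_forall hC)
  set c := ∫ x in Ioo a b, f x * β x
  refine ⟨c, ?_⟩
  have key : ∀ᵐ x, x ∈ Ioo a b → f x - c = 0 := by
    refine isOpen_Ioo.ae_eq_zero_of_integral_contDiff_smul_eq_zero
      (hf.sub (integrableOn_const (by simp) (by simp))).locallyIntegrableOn ?_
    intro η h1 h2 h3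
    have hη : IsTestFunction (Ioo a b) η := ⟨h1, h2, h3⟩
    -- Subtracting a multiple of `β` removes the mean, so that the difference is the derivative of a
    -- test function; the hypothesis on it says that `f - c` is orthogonal to `η`.
    have hθ : IsTestFunction (Ioo a b) fun x => η x - (∫ y, η y) * β x := hη.sub (hβ.const_mul _)
    obtain ⟨ψ, hψ, hψ'⟩ := hθ.exists_primitive (by
      rw [integral_sub (hint _ hη) ((hint _ hβ).const_mul _), integral_const_mul, hβ1, mul_one,
        sub_self])
    have h4 := h ψ hψ
    rw [hψ'] at h4
    have h5 : ∫ x, η x • (f x - c) = ∫ x in Ioo a b, η x • (f x - c) := by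
      rw [setIntegral_eq_integral_of_forall_compl_eq_zero]
      intro x hx
      rw [hη.eq_zero hx, zero_smul]
    have h6 : ∫ y, η y = ∫ y in Ioo a b, η y := by
      rw [setIntegral_eq_integral_of_forall_compl_eq_zero]
      exact fun x hx => hη.eq_zero hx
    have h7 : (fun x => f x * (η x - (∫ y, η y) * β x)) =
        fun x => f x * η x - (∫ y, η y) * (f x * β x) := by ext x; ring
    have h8 : (fun x => η x • (f x - c)) = fun x => f x * η x - c * η x := by
      ext x; rw [smul_eq_mul]; ring
    rw [h7, integral_sub (hfint _ hη) ((hfint _ hβ).const_mul _), integral_const_mul] at h4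
    rw [h5, h8, integral_sub (hfint _ hη) ((hint _ hη).integrableOn.const_mul _),
      integral_const_mul, ← h6]
    linarith
  rw [EventuallyEq, ae_restrict_iff' measurableSet_Ioo]
  filter_upwards [key] with x hx hx'
  linarith [hx hx']

namespace SobolevOn

variable {a b : ℝ} {W D V F : ℝ → ℝ}

lemma integrableOn (h : SobolevOn a b W D) : IntegrableOn D (Icc a b) :=
  h.memLp.integrable (by norm_num)

lemma intervalIntegrable (h : SobolevOn a b W D) {s t : ℝ} (hs : s ∈ Icc a b)
    (ht : t ∈ Icc a b) : IntervalIntegrable D volume s t := by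
  rw [intervalIntegrable_iff]
  exact h.integrableOn.mono_set (uIoc_subset_uIcc.trans (uIcc_subset_Icc hs ht))

lemma continuousOn (h : SobolevOn a b W D) : ContinuousOn W (Icc a b) := by
  rcases lt_or_ge b a with hab | hab
  · rw [Icc_eq_empty (not_le.2 hab)]; exact continuousOn_empty _
  have h1 : ContinuousOn (fun t => W a + ∫ r in a..t, D r) (Icc a b) := by
    have := intervalIntegral.continuousOn_primitive_interval (a := a) (b := b) (f := D)
      (by rw [uIcc_of_le hab]; exact h.integrableOn)
    rw [uIcc_of_le hab] at this
    exact continuousOn_const.add this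
  refine h1.congr fun t ht => ?_
  have := h.sub_eq a (left_mem_Icc.2 hab) t ht
  simp only; linarith

lemma sub (h : SobolevOn a b W D) (k : SobolevOn a b V F) :
    SobolevOn a b (fun s => W s - V s) (fun s => D s - F s) := by
  refine ⟨h.memLp.sub k.memLp, fun s hs t ht => ?_⟩
  rw [intervalIntegral.integral_sub (h.intervalIntegrable hs ht) (k.intervalIntegrable hs ht),
    ← h.sub_eq s hs t ht, ← k.sub_eq s hs t ht]
  ring

lemma mono (h : SobolevOn a b W D) {a' b' : ℝ} (ha : a ≤ a') (hb : b' ≤ b) :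
    SobolevOn a' b' W D :=
  ⟨h.memLp.mono_measure (Measure.restrict_mono (Icc_subset_Icc ha hb) le_rfl),
    fun s hs t ht => h.sub_eq s ⟨ha.trans hs.1, hs.2.trans hb⟩ t ⟨ha.trans ht.1, ht.2.trans hb⟩⟩

lemma of_hasDerivAt (hd : ∀ s, HasDerivAt W (D s) s) (hD : Continuous D) : SobolevOn a b W D := by
  refine ⟨?_, fun s _ t _ => ?_⟩
  · obtain ⟨C, hC⟩ := isCompact_Icc.exists_bound_of_continuousOn (s := Icc a b) hD.continuousOn
    refine MemLp.of_bound hD.aestronglyMeasurable C ?_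
    exact (ae_restrict_iff' measurableSet_Icc).2 (Eventually.of_forall hC)
  · exact (intervalIntegral.integral_eq_sub_of_hasDerivAt (fun x _ => hd x)
      (hD.intervalIntegrable _ _)).symm

/-- Hölder continuity with exponent one half. -/
lemma enorm_sub_sq_le (h : SobolevOn a b W D) {s t : ℝ} (hs : s ∈ Icc a b) (ht : t ∈ Icc a b) :
    ‖W t - W s‖ₑ ^ 2 ≤ ENNReal.ofReal |t - s| * ∫⁻ r in Icc a b, ‖D r‖ₑ ^ 2 := by
  have hm : AEMeasurable (fun r => ‖D r‖ₑ) (volume.restrict (uIoc s t)) := by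
    have := h.memLp.aestronglyMeasurable.enorm
    exact this.mono_measure (Measure.restrict_mono
      (uIoc_subset_uIcc.trans (uIcc_subset_Icc hs ht)) le_rfl)
  have h1 : ‖W t - W s‖ₑ ≤ ∫⁻ r in uIoc s t, ‖D r‖ₑ := by
    rw [h.sub_eq s hs t ht, ← enorm_norm,
      intervalIntegral.norm_integral_eq_norm_integral_uIoc, enorm_norm]
    exact enorm_integral_le_lintegral_enorm _
  have h2 := sq_lintegral_le (volume.restrict (uIoc s t)) hm
  refine (pow_le_pow_left₀ zero_le h1 2).trans (h2.trans ?_)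
  gcongr
  · rw [Measure.restrict_apply_univ, uIoc, Real.volume_Ioc, max_sub_min_eq_abs]
  · exact uIoc_subset_uIcc.trans (uIcc_subset_Icc hs ht)

/-- On `[a, b]`, `W` is a constant plus a primitive of `D`, thus absolutely continuous with
derivative `D` almost everywhere. Integration by parts for absolutely continuous functions applies.
-/
lemma integral_mul_deriv (h : SobolevOn a b W D) (hab : a ≤ b) {ψ : ℝ → ℝ}
    (hψ : IsTestFunction (Ioo a b) ψ) :
    ∫ x in Ioo a b, W x * deriv ψ x = -∫ x in Ioo a b, D x * ψ x := by
  have hI : IntervalIntegrable D volume a b :=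
    h.intervalIntegrable (left_mem_Icc.2 hab) (right_mem_Icc.2 hab)
  have hac := hI.absolutelyContinuousOnInterval_intervalIntegral (c := a) (by simp)
  obtain ⟨K, hK⟩ := hψ.contDiff_one.lipschitzWith_of_hasCompactSupport hψ.hasCompactSupport
    (by norm_num)
  have hψac : AbsolutelyContinuousOnInterval ψ a b :=
    hK.lipschitzOnWith.absolutelyContinuousOnInterval
  have hcon : AbsolutelyContinuousOnInterval (fun _ : ℝ => W a) a b :=
    (LipschitzWith.const (W a)).lipschitzOnWith.absolutelyContinuousOnInterval
  have hsum := hcon.add hac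
  have key := hsum.integral_mul_deriv_eq_deriv_mul hψac
  have ha0 : ψ a = 0 := hψ.eq_zero (by simp)
  have hb0 : ψ b = 0 := hψ.eq_zero (by simp)
  rw [ha0, hb0, mul_zero, mul_zero, sub_zero, zero_sub, intervalIntegral.integral_of_le hab,
    intervalIntegral.integral_of_le hab, integral_Ioc_eq_integral_Ioo,
    integral_Ioc_eq_integral_Ioo] at key
  rw [← setIntegral_congr_fun measurableSet_Ioo (f := fun x => (((fun _ : ℝ => W a) + fun x =>
    ∫ t in a..x, D t) x) * deriv ψ x), key]
  · congr 1
    refine integral_congr_ae ((ae_restrict_iff' measurableSet_Ioo).2 ?_)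
    filter_upwards [hI.ae_hasDerivAt_integral] with x hx hx'
    have := (hx (by rw [uIcc_of_le hab]; exact Ioo_subset_Icc_self hx') a (by simp)).const_add (W a)
    rw [show ((fun _ : ℝ => W a) + fun x => ∫ t in a..x, D t) =
      fun x => W a + ∫ t in a..x, D t from rfl, this.deriv]
  · intro x hx
    have := h.sub_eq a (left_mem_Icc.2 hab) x (Ioo_subset_Icc_self hx)
    simp only [Pi.add_apply]
    rw [← this]; ring

end SobolevOn

/-- A function in `H¹(0, l)` has an absolutely continuous representative. -/
lemma IsH1Interval.exists_sobolevOn {l : ℝ} (hl : 0 < l) {w dw : ℝ → ℝ}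
    (h : IsH1Interval l w dw) :
    ∃ W : ℝ → ℝ, SobolevOn 0 l W dw ∧ W =ᵐ[volume.restrict (Ioo 0 l)] w := by
  have hrest : volume.restrict (Icc 0 l) = volume.restrict (Ioo 0 l) :=
    Measure.restrict_congr_set Ioo_ae_eq_Icc.symm
  have hV : SobolevOn 0 l (fun t => ∫ r in (0 : ℝ)..t, dw r) dw := by
    have hm : MemLp dw 2 (volume.restrict (Icc 0 l)) := hrest ▸ h.memLp_deriv
    have hint : IntegrableOn dw (Icc 0 l) := hm.integrable (by norm_num)
    have hii : ∀ t ∈ Icc 0 l, IntervalIntegrable dw volume 0 t := fun t ht => by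
      rw [intervalIntegrable_iff, uIoc_of_le ht.1]
      exact hint.mono_set fun x hx => ⟨hx.1.le, hx.2.trans ht.2⟩
    exact ⟨hm, fun s hs t ht => intervalIntegral.integral_interval_sub_left (hii t ht) (hii s hs)⟩
  have hwint : IntegrableOn w (Ioo 0 l) := h.memLp.integrable (by norm_num)
  have hVint : IntegrableOn (fun t => ∫ r in (0 : ℝ)..t, dw r) (Ioo 0 l) :=
    (hV.continuousOn.integrableOn_Icc).mono_set Ioo_subset_Icc_self
  -- `w` minus the primitive of `dw` has weak derivative zero.
  obtain ⟨c, hc⟩ := ae_const_of_weak_deriv_zero hl (hwint.sub hVint) fun ψ hψ => by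
    obtain ⟨θ, hθ⟩ : ∃ θ, θ = deriv ψ := ⟨_, rfl⟩
    have hθc : Continuous (deriv ψ) := hψ.contDiff_one.continuous_deriv (by norm_num)
    obtain ⟨C, hC⟩ := hθc.bounded_above_of_compact_support hψ.hasCompactSupport.deriv
    have h1 := hwint.mul_bdd hθc.aestronglyMeasurable (Eventually.of_forall hC)
    have h2 := hVint.mul_bdd hθc.aestronglyMeasurable (Eventually.of_forall hC)
    simp only [Pi.sub_apply, sub_mul]
    rw [integral_sub h1 h2, h.weak_deriv ψ hψ, hV.integral_mul_deriv hl.le hψ, sub_self]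
  refine ⟨fun t => c + ∫ r in (0 : ℝ)..t, dw r, ⟨hV.memLp, fun s hs t ht => ?_⟩, ?_⟩
  · rw [add_sub_add_left_eq_sub]; exact hV.sub_eq s hs t ht
  · filter_upwards [hc] with t ht
    simp only [Pi.sub_apply] at ht
    linarith

/-! ### Square integrals, and density of test functions in `H¹₀(a, b)`. -/

lemma eLpNorm_two_sq {α E : Type*} [MeasurableSpace α] [NormedAddCommGroup E] (f : α → E)
    (μ : Measure α) : eLpNorm f 2 μ ^ 2 = ∫⁻ x, ‖f x‖ₑ ^ 2 ∂μ := by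
  rw [eLpNorm_eq_lintegral_rpow_enorm_toReal (by norm_num) (by norm_num), ← ENNReal.rpow_natCast,
    ← ENNReal.rpow_mul]
  norm_num

lemma lintegral_sq_lt_top_iff {α E : Type*} [MeasurableSpace α] [NormedAddCommGroup E] {f : α → E}
    {μ : Measure α} (hf : AEStronglyMeasurable f μ) :
    MemLp f 2 μ ↔ ∫⁻ x, ‖f x‖ₑ ^ 2 ∂μ < ⊤ := by
  rw [← eLpNorm_two_sq, ENNReal.pow_lt_top_iff]
  simp [MemLp, hf]

/-- The double orthogonal complement is the closure. Both density arguments, on an interval and in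
the final Hilbert space, take this form. -/
lemma mem_topologicalClosure_of_forall_orthogonal {H : Type*} [NormedAddCommGroup H]
    [InnerProductSpace ℝ H] [CompleteSpace H] (V : Submodule ℝ H) {x : H}
    (h : ∀ f : H, (∀ v ∈ V, inner ℝ v f = 0) → inner ℝ f x = 0) : x ∈ V.topologicalClosure := by
  rw [← Submodule.orthogonal_orthogonal_eq_closure, Submodule.mem_orthogonal]
  exact fun f hf => h f ((Submodule.mem_orthogonal _ _).1 hf)

namespace SobolevOn

variable {a b : ℝ} {W D : ℝ → ℝ}

/-- Test functions are dense in `H¹₀(a, b)`. -/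
lemma exists_test_deriv_near (h : SobolevOn a b W D) (hab : a < b) (ha : W a = 0) (hb : W b = 0)
    {ε : ℝ≥0∞} (hε : 0 < ε) : ∃ ψ, IsTestFunction (Ioo a b) ψ ∧
      ∫⁻ s in Icc a b, ‖deriv ψ s - D s‖ₑ ^ 2 ≤ ε := by
  set μ := volume.restrict (Icc a b)
  have hμ : volume.restrict (Icc a b) = volume.restrict (Ioo a b) :=
    Measure.restrict_congr_set Ioo_ae_eq_Icc.symm
  have hcd : ∀ {ψ : ℝ → ℝ}, IsTestFunction (Ioo a b) ψ → Continuous (deriv ψ) := fun hψ =>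
    hψ.contDiff_one.continuous_deriv (by norm_num)
  have hdd : ∀ {ψ : ℝ → ℝ}, IsTestFunction (Ioo a b) ψ → Differentiable ℝ ψ := fun hψ =>
    hψ.contDiff_one.differentiable (by norm_num)
  have hLp : ∀ {ψ : ℝ → ℝ}, IsTestFunction (Ioo a b) ψ → MemLp (deriv ψ) 2 μ := fun hψ =>
    (hcd hψ).memLp_of_hasCompactSupport hψ.hasCompactSupport.deriv
  let V : Submodule ℝ (Lp ℝ 2 μ) :=
    { carrier := {f | ∃ ψ, IsTestFunction (Ioo a b) ψ ∧ f =ᵐ[μ] deriv ψ}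
      add_mem' := by
        rintro f g ⟨ψ, hψ, hf⟩ ⟨θ, hθ, hg⟩
        refine ⟨fun x => ψ x + θ x, hψ.add hθ, ?_⟩
        filter_upwards [hf, hg, Lp.coeFn_add f g] with x h1 h2 h3
        rw [h3, Pi.add_apply, h1, h2, deriv_fun_add (hdd hψ x) (hdd hθ x)]
      zero_mem' := ⟨fun _ => 0, IsTestFunction.zero, by
        filter_upwards [Lp.coeFn_zero ℝ 2 μ] with x h1
        rw [h1]; simp⟩
      smul_mem' := by
        rintro c f ⟨ψ, hψ, hf⟩
        refine ⟨fun x => c * ψ x, hψ.const_mul c, ?_⟩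
        filter_upwards [hf, Lp.coeFn_smul c f] with x h1 h3
        rw [h3, Pi.smul_apply, h1, smul_eq_mul, deriv_const_mul _ (hdd hψ x)] }
  have hmem : h.memLp.toLp D ∈ V.topologicalClosure := by
    -- A function orthogonal to all derivatives of test functions is a constant `c`, and `∫ c * D =
    -- c * (W b - W a) = 0`.
    refine mem_topologicalClosure_of_forall_orthogonal V fun f hf => ?_
    have hfint : IntegrableOn f (Ioo a b) := by
      have : Integrable f μ := (Lp.memLp f).integrable (by norm_num)
      rwa [IntegrableOn, ← hμ]
    obtain ⟨c, hc⟩ := ae_const_of_weak_deriv_zero hab hfint fun ψ hψ => by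
      have h1 := hf ((hLp hψ).toLp _) ⟨ψ, hψ, (hLp hψ).coeFn_toLp⟩
      rw [L2.inner_def] at h1
      rw [← hμ, ← h1]
      refine integral_congr_ae ?_
      filter_upwards [(hLp hψ).coeFn_toLp] with x hx
      rw [hx]; simp
    rw [← hμ] at hc
    rw [L2.inner_def]
    have h2 : ∫ x, inner ℝ (f x) (h.memLp.toLp D x) ∂μ = ∫ x, c * D x ∂μ := by
      refine integral_congr_ae ?_
      filter_upwards [hc, h.memLp.coeFn_toLp] with x h3 h4
      rw [h3, h4]; simp [mul_comm]
    rw [h2, integral_const_mul, integral_Icc_eq_integral_Ioc,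
      ← intervalIntegral.integral_of_le hab.le,
      ← h.sub_eq a (left_mem_Icc.2 hab.le) b (right_mem_Icc.2 hab.le), ha, hb]
    simp
  obtain ⟨r, hr0, hr⟩ : ∃ r : ℝ≥0∞, 0 < r ∧ r ^ 2 ≤ ε := by
    refine ⟨min 1 ε, lt_min one_pos hε, ?_⟩
    rw [sq]
    exact (mul_le_of_le_one_left zero_le (min_le_left _ _)).trans (min_le_right _ _)
  obtain ⟨f, ⟨ψ, hψ, hf⟩, hfD⟩ := EMetric.mem_closure_iff.1 hmem r hr0
  refine ⟨ψ, hψ, ?_⟩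
  rw [← eLpNorm_two_sq]
  refine le_trans (pow_le_pow_left₀ zero_le ?_ 2) hr
  rw [Lp.edist_def] at hfD
  refine le_trans (le_of_eq ?_) hfD.le
  rw [← eLpNorm_neg]
  refine eLpNorm_congr_ae ?_
  filter_upwards [hf, h.memLp.coeFn_toLp] with x h1 h2
  simp [h1, h2]

/-- Both functions vanish at `a`, so closeness of the derivatives gives closeness of the functions
by the Hölder estimate. It matters that `M` does not depend on `ε`. -/
lemma exists_test_near (h : SobolevOn a b W D) (hab : a < b) (ha : W a = 0) (hb : W b = 0) :
    ∃ M : ℝ≥0, ∀ ε : ℝ≥0∞, 0 < ε → ∃ ψ, IsTestFunction (Ioo a b) ψ ∧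
      ∫⁻ s, ‖deriv ψ s‖ₑ ^ 2 ≤ M ∧ ∫⁻ s in Icc a b, ‖ψ s - W s‖ₑ ^ 2 ≤ ε := by
  have hD : ∫⁻ s in Icc a b, ‖D s‖ₑ ^ 2 < ⊤ :=
    (lintegral_sq_lt_top_iff h.memLp.aestronglyMeasurable).1 h.memLp
  refine ⟨2 + 2 * (∫⁻ s in Icc a b, ‖D s‖ₑ ^ 2).toNNReal, fun ε hε => ?_⟩
  set L : ℝ≥0∞ := ENNReal.ofReal (b - a) with hL
  have hL0 : L ≠ 0 := by simpa [hL] using hab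
  have hLt : L ≠ ⊤ := by simp [hL]
  -- The bound `1` keeps the energy bounded; the other bound is needed since the squared error is at
  -- most `L * r` pointwise, hence `L ^ 2 * r` when integrated.
  set r := min 1 (ε / L ^ 2) with hr
  have hr0 : 0 < r := lt_min one_pos (ENNReal.div_pos hε.ne' (by finiteness))
  obtain ⟨ψ, hψ, hψD⟩ := h.exists_test_deriv_near hab ha hb hr0
  have hdc : Continuous (deriv ψ) := hψ.contDiff_one.continuous_deriv (by norm_num)
  have hψs : SobolevOn a b ψ (deriv ψ) := of_hasDerivAt
    (fun s => (hψ.contDiff_one.differentiable (by norm_num) s).hasDerivAt) hdc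
  refine ⟨ψ, hψ, ?_, ?_⟩
  · have hsupp : ∫⁻ s, ‖deriv ψ s‖ₑ ^ 2 = ∫⁻ s in Icc a b, ‖deriv ψ s‖ₑ ^ 2 := by
      rw [setLIntegral_eq_of_support_subset]
      intro x hx
      by_contra hx'
      refine hx ?_
      have : deriv ψ x = 0 := by
        by_contra hne
        exact hx' (Ioo_subset_Icc_self (hψ.tsupport_subset (support_deriv_subset hne)))
      simp [this]
    rw [hsupp]
    calc ∫⁻ s in Icc a b, ‖deriv ψ s‖ₑ ^ 2
        ≤ ∫⁻ s in Icc a b, (2 * ‖deriv ψ s - D s‖ₑ ^ 2 + 2 * ‖D s‖ₑ ^ 2) := by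
          refine lintegral_mono fun s => ?_
          simpa using enorm_add_sq_le (deriv ψ s - D s) (D s)
      _ = 2 * (∫⁻ s in Icc a b, ‖deriv ψ s - D s‖ₑ ^ 2) + 2 * ∫⁻ s in Icc a b, ‖D s‖ₑ ^ 2 := by
          rw [lintegral_add_left', lintegral_const_mul' _ _ (by simp),
            lintegral_const_mul' _ _ (by simp)]
          exact (((hdc.aestronglyMeasurable.sub
            h.memLp.aestronglyMeasurable).enorm.pow_const 2).const_mul _)
      _ ≤ 2 * 1 + 2 * ∫⁻ s in Icc a b, ‖D s‖ₑ ^ 2 := by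
          gcongr
          exact hψD.trans (min_le_left _ _)
      _ = _ := by push_cast; rw [ENNReal.coe_toNNReal hD.ne, mul_one]
  · have hs := hψs.sub h
    have ha' : a ∈ Icc a b := left_mem_Icc.2 hab.le
    have hψa : ψ a = 0 := hψ.eq_zero (by simp)
    calc ∫⁻ s in Icc a b, ‖ψ s - W s‖ₑ ^ 2 ≤ ∫⁻ _s in Icc a b, L * r := by
          refine setLIntegral_mono' measurableSet_Icc fun s hs' => ?_
          have := hs.enorm_sub_sq_le ha' hs'
          simp only [hψa, ha, sub_self, sub_zero] at this
          refine this.trans ?_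
          gcongr
          rw [abs_of_nonneg (by linarith [hs'.1])]
          exact ENNReal.ofReal_le_ofReal (by linarith [hs'.2])
      _ = L ^ 2 * r := by
          rw [setLIntegral_const, Real.volume_Icc, ← hL]; ring
      _ ≤ L ^ 2 * (ε / L ^ 2) := by gcongr; exact min_le_right _ _
      _ = ε := ENNReal.mul_div_cancel (by simp [hL0]) (by finiteness)

end SobolevOn

/-! ### Values at nodes -/

/-- The functions `φ k` take the value `a` at `p`, asymptotically along the ray in direction `n`, in
the sense of a logarithmic mean. -/
def RayLimit (φ : ℕ → Plane → ℝ) (p n : Plane) (a : ℝ) : Prop :=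
  ∃ C : ℝ≥0∞, C ≠ ⊤ ∧ ∃ δ > 0, ∀ δ₁, 0 < δ₁ → δ₁ < δ → ∀ᶠ k in atTop,
    ∫⁻ r in Icc δ₁ δ, ENNReal.ofReal r⁻¹ * ‖φ k (p + r • n) - a‖ₑ ^ 2 ≤ C

lemma lintegral_inv_Icc {δ₁ δ : ℝ} (h0 : 0 < δ₁) (h : δ₁ ≤ δ) :
    ∫⁻ r in Icc δ₁ δ, ENNReal.ofReal r⁻¹ = ENNReal.ofReal (Real.log (δ / δ₁)) := by
  have hc : ContinuousOn (fun r : ℝ => r⁻¹) (Icc δ₁ δ) :=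
    continuousOn_inv₀.mono fun x hx => (h0.trans_le hx.1).ne'
  rw [← ofReal_integral_eq_lintegral_ofReal hc.integrableOn_Icc, integral_Icc_eq_integral_Ioc,
    ← intervalIntegral.integral_of_le h, integral_inv_of_pos h0 (h0.trans_le h)]
  exact (ae_restrict_iff' measurableSet_Icc).2 (Eventually.of_forall fun x hx =>
    inv_nonneg.2 (h0.le.trans hx.1))

/-- The constant `|a - b|²` integrated against `dr / r` over `[δ₁, m]` grows like `log (m / δ₁)`,
whereas the two ray limits bound it independently of `δ₁`. For each `δ₁` a single index `k` good for
both suffices. -/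
lemma RayLimit.unique {φ : ℕ → Plane → ℝ} (hφ : ∀ k, Continuous (φ k)) {p n : Plane} {a b : ℝ}
    (ha : RayLimit φ p n a) (hb : RayLimit φ p n b) : a = b := by
  obtain ⟨C, hC, δ, hδ, h⟩ := ha
  obtain ⟨C', hC', δ', hδ', h'⟩ := hb
  by_contra hab
  set m := min δ δ'
  have hm : 0 < m := lt_min hδ hδ'
  have hbound : ∀ δ₁, 0 < δ₁ → δ₁ < m →
      ENNReal.ofReal (Real.log (m / δ₁)) * ‖a - b‖ₑ ^ 2 ≤ 2 * C + 2 * C' := by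
    intro δ₁ h0 hlt
    obtain ⟨k, h1, h2⟩ := ((h δ₁ h0 (hlt.trans_le (min_le_left _ _))).and
      (h' δ₁ h0 (hlt.trans_le (min_le_right _ _)))).exists
    rw [← lintegral_inv_Icc h0 hlt.le, ← lintegral_mul_const' _ _ (by finiteness)]
    calc ∫⁻ r in Icc δ₁ m, ENNReal.ofReal r⁻¹ * ‖a - b‖ₑ ^ 2
        ≤ ∫⁻ r in Icc δ₁ m, (2 * (ENNReal.ofReal r⁻¹ * ‖φ k (p + r • n) - a‖ₑ ^ 2) +
          2 * (ENNReal.ofReal r⁻¹ * ‖φ k (p + r • n) - b‖ₑ ^ 2)) := by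
          refine lintegral_mono fun r => ?_
          have := enorm_add_sq_le (a - φ k (p + r • n)) (φ k (p + r • n) - b)
          rw [sub_add_sub_cancel, ← enorm_neg (a - φ k (p + r • n)), neg_sub] at this
          refine (mul_le_mul_right this _).trans_eq ?_
          ring
      _ = 2 * (∫⁻ r in Icc δ₁ m, ENNReal.ofReal r⁻¹ * ‖φ k (p + r • n) - a‖ₑ ^ 2) +
          2 * (∫⁻ r in Icc δ₁ m, ENNReal.ofReal r⁻¹ * ‖φ k (p + r • n) - b‖ₑ ^ 2) := by
          have hc := hφ k
          rw [lintegral_add_left, lintegral_const_mul' _ _ (by simp),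
            lintegral_const_mul' _ _ (by simp)]
          have hm : Measurable fun r : ℝ => ‖φ k (p + r • n) - a‖ₑ ^ 2 :=
            (Continuous.enorm (by fun_prop)).measurable.pow_const 2
          have hi : Measurable fun r : ℝ => ENNReal.ofReal r⁻¹ := by fun_prop
          exact (hi.mul hm).const_mul _
      _ ≤ _ := by
          gcongr
          · exact (lintegral_mono_set (Icc_subset_Icc_right (min_le_left _ _))).trans h1
          · exact (lintegral_mono_set (Icc_subset_Icc_right (min_le_right _ _))).trans h2
  have hab' : ‖a - b‖ₑ ^ 2 ≠ 0 := by
    simpa [sub_eq_zero] using hab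
  set L := ((2 * C + 2 * C') / ‖a - b‖ₑ ^ 2).toReal
  have hL : (2 * C + 2 * C') / ‖a - b‖ₑ ^ 2 ≠ ⊤ := ENNReal.div_ne_top (by finiteness) hab'
  -- With this `δ₁` the logarithm is exactly `L + 1`, beyond the bound `L`.
  have h1 := hbound (m * Real.exp (-(L + 1))) (by positivity) (by
    refine mul_lt_of_lt_one_right hm (Real.exp_lt_one_iff.2 ?_)
    have : 0 ≤ L := ENNReal.toReal_nonneg
    linarith)
  have h2 : Real.log (m / (m * Real.exp (-(L + 1)))) = L + 1 := by
    rw [div_mul_cancel_left₀ hm.ne', ← Real.exp_neg, neg_neg, Real.log_exp]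
  rw [h2, ← ENNReal.le_div_iff_mul_le (Or.inl hab') (Or.inl (by finiteness)),
    ENNReal.ofReal_le_iff_le_toReal hL] at h1
  change L + 1 ≤ L at h1
  linarith

lemma enorm_sub_sq_le_three (x y z w : ℝ) : ‖x - w‖ₑ ^ 2 ≤
    2 * ‖x - y‖ₑ ^ 2 + 4 * ‖y - z‖ₑ ^ 2 + 4 * ‖z - w‖ₑ ^ 2 := by
  have h1 := enorm_add_sq_le (x - y) (y - w)
  have h2 := enorm_add_sq_le (y - z) (z - w)
  rw [sub_add_sub_cancel] at h1 h2
  refine h1.trans ?_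
  calc 2 * ‖x - y‖ₑ ^ 2 + 2 * ‖y - w‖ₑ ^ 2
      ≤ 2 * ‖x - y‖ₑ ^ 2 + 2 * (2 * ‖y - z‖ₑ ^ 2 + 2 * ‖z - w‖ₑ ^ 2) := by gcongr
    _ = _ := by ring

/-- The value at a point of the continuous trace on an arc is also the asymptotic value along
rays. -/
lemma PlaneArc.rayLimit (γ : PlaneArc) {s₀ σ ρ : ℝ} (hσ : σ = 1 ∨ σ = -1)
    (hs₀ : s₀ ∈ Icc 0 γ.length) (hρ : 0 < ρ) (hroom : s₀ + σ * ρ ∈ Icc 0 γ.length)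
    {n : Plane} (hn : ‖n‖ = 1) (hnv : σ • γ.extTangent s₀ + n ≠ 0) {φ : ℕ → Plane → ℝ}
    (hφ : ∀ k, ContDiff ℝ 1 (φ k)) {B : ℝ≥0}
    (hB : ∀ᶠ k in atTop, ∫⁻ x, ‖fderiv ℝ (φ k) x‖ₑ ^ 2 ≤ B) {W D : ℝ → ℝ}
    (hW : SobolevOn 0 γ.length W D)
    (hφW : Tendsto (fun k => ∫⁻ s in Icc 0 γ.length, ‖φ k (γ.ext s) - W s‖ₑ ^ 2) atTop (𝓝 0)) :
    RayLimit φ (γ.ext s₀) n (W s₀) := by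
  set v := σ • γ.extTangent s₀ with hv
  have hv1 : ‖v‖ = 1 := γ.norm_smul_self s₀ hσ
  -- Over the bisector of `v` and `n` both the curve and the ray are graphs, with the same positive
  -- slope `ν` at the vertex. Only `n = -v` has to be excluded.
  set e := ‖v + n‖⁻¹ • (v + n) with he
  have hpos : 0 < ‖v + n‖ := norm_pos_iff.2 hnv
  have he1 : ‖e‖ = 1 := by
    rw [he, norm_smul, norm_inv, norm_norm, inv_mul_cancel₀ hpos.ne']
  have hsq : ‖v + n‖ ^ 2 = 2 * (1 + inner ℝ v n) := by
    rw [norm_add_sq_real, hv1, hn]; ring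
  set ν := inner ℝ v e with hνdef
  have hν : 0 < ν := by
    rw [hνdef, he, real_inner_smul_right, inner_add_right, real_inner_self_eq_norm_sq, hv1]
    have : 0 < ‖v + n‖ ^ 2 := by positivity
    have h2 : (0 : ℝ) < 1 ^ 2 + inner ℝ v n := by linarith
    positivity
  have hnν : inner ℝ n e = ν := by
    rw [hνdef, he, real_inner_smul_right, real_inner_smul_right, inner_add_right, inner_add_right,
      real_inner_self_eq_norm_sq, real_inner_self_eq_norm_sq, hv1, hn, real_inner_comm]
    ring
  obtain ⟨η, hη, c, T, hc, -, hcu⟩ := γ.exists_graphCurve s₀ σ hσ he1 (κ := ν / 2)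
    (by positivity) (by rw [← hv, ← hνdef]; linarith)
  have hc0 : c 0 = γ.ext s₀ := by rw [hcu 0 (by simpa using hη.le)]; simp
  set b := min η ρ
  have hb : 0 < b := lt_min hη hρ
  have hmemb : ∀ u, 0 ≤ u → u ≤ b → s₀ + σ * u ∈ Icc 0 γ.length := by
    intro u h0 h1
    have h2 : u ≤ ρ := h1.trans (min_le_right _ _)
    rcases hσ with rfl | rfl <;> constructor <;> linarith [hs₀.1, hs₀.2, hroom.1, hroom.2]
  -- The position on the ray of the point with the abscissa of `c u`. The substitution `r = g u` is
  -- comparable to the identity: `u / 2 ≤ g u`, and its derivative is at most `ν⁻¹`.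
  set g : ℝ → ℝ := fun u => inner ℝ (c u - c 0) e / ν with hg
  have hgd : ∀ u, HasDerivAt g (inner ℝ (T u) e / ν) u := by
    intro u
    have := ((hc.coord_hasDerivAt e u).sub_const (inner ℝ (c 0) e)).div_const ν
    simpa only [hg, inner_sub_left] using this
  have hgc : Continuous g := continuous_iff_continuousAt.2 fun u => (hgd u).continuousAt
  have hg0 : g 0 = 0 := by simp [hg]
  have hgge : ∀ u, 0 ≤ u → u / 2 ≤ g u := by
    intro u hu
    have := hc.coord_sub_ge hu
    rw [hg]; simp only [inner_sub_left]
    rw [le_div_iff₀ hν]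
    linarith
  have hginj : Function.Injective g := by
    intro u u' h
    apply hc.coord_strictMono.injective
    simp only [hg, inner_sub_left] at h ⊢
    rw [div_left_inj' hν.ne'] at h
    linarith
  set K : ℝ≥0∞ := ∫⁻ r in Icc 0 γ.length, ‖D r‖ₑ ^ 2
  have hK : K ≠ ⊤ := ((lintegral_sq_lt_top_iff hW.memLp.aestronglyMeasurable).1 hW.memLp).ne
  set C₁ : ℝ≥0∞ := ENNReal.ofReal (1 + ν⁻¹) * ENNReal.ofReal (ν / 2)⁻¹ * B
  refine ⟨ENNReal.ofReal ν⁻¹ * (2 * (2 * C₁ + 4 * 1 + 4 * (ENNReal.ofReal b * K))),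
    by finiteness, g b, (by have := hgge b hb.le; linarith), fun δ₁ h1 h2 => ?_⟩
  obtain ⟨u₁, ⟨hu10, hu1b⟩, hu1⟩ : δ₁ ∈ g '' Icc 0 b :=
    intermediate_value_Icc hb.le hgc.continuousOn ⟨by rw [hg0]; exact h1.le, h2.le⟩
  have hu1pos : 0 < u₁ := by
    rcases hu10.lt_or_eq with h | h
    · exact h
    · rw [← h, hg0] at hu1; linarith
  have hsub : Icc δ₁ (g b) ⊆ g '' Icc u₁ b := by
    rw [← hu1]; exact intermediate_value_Icc hu1b hgc.continuousOn
  -- On `[u₁, b]` the weight is at most `u₁⁻¹`; an error of at most `u₁` in the traces then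
  -- contributes at most `1`, whatever `u₁` is. This is why `k` may depend on `δ₁`.
  have hev : ∀ᶠ k in atTop, ∫⁻ s in Icc 0 γ.length, ‖φ k (γ.ext s) - W s‖ₑ ^ 2 ≤
      ENNReal.ofReal u₁ := hφW.eventually_le_const (by simpa using hu1pos)
  filter_upwards [hB, hev] with k hkB hkW
  have hφc := (hφ k).continuous
  have hcc := hc.continuous
  have hterm1 : ∫⁻ u in Icc u₁ b, ENNReal.ofReal u⁻¹ *
      ‖φ k (c 0 + g u • n) - φ k (c u)‖ₑ ^ 2 ≤ C₁ := by
    refine (lintegral_mono_set fun u hu => ?_).trans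
      ((hc.lintegral_ray_sub_le (hφ k) hn hν hnν).trans ?_)
    · exact hu1pos.trans_le hu.1
    · exact mul_le_mul_right hkB _
  have hterm2 : ∫⁻ u in Icc u₁ b, ENNReal.ofReal u⁻¹ *
      ‖φ k (c u) - W (s₀ + σ * u)‖ₑ ^ 2 ≤ 1 := by
    calc ∫⁻ u in Icc u₁ b, ENNReal.ofReal u⁻¹ * ‖φ k (c u) - W (s₀ + σ * u)‖ₑ ^ 2
        ≤ ∫⁻ u in Icc u₁ b, ENNReal.ofReal u₁⁻¹ * (Icc 0 γ.length).indicator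
          (fun s => ‖φ k (γ.ext s) - W s‖ₑ ^ 2) (s₀ + σ * u) := by
          refine setLIntegral_mono' measurableSet_Icc fun u hu => ?_
          have hu0 : 0 ≤ u := hu1pos.le.trans hu.1
          rw [indicator_of_mem (hmemb u hu0 hu.2), hcu u (by
            rw [abs_of_nonneg hu0]; exact hu.2.trans (min_le_left _ _))]
          gcongr
          exact hu.1
      _ ≤ ENNReal.ofReal u₁⁻¹ * ENNReal.ofReal u₁ := by
          rw [lintegral_const_mul' _ _ (by simp)]
          gcongr
          refine (setLIntegral_le_lintegral _ _).trans ?_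
          rw [lintegral_comp_affine _ s₀ hσ, lintegral_indicator measurableSet_Icc]
          exact hkW
      _ = 1 := by
          rw [← ENNReal.ofReal_mul (by positivity), inv_mul_cancel₀ hu1pos.ne', ENNReal.ofReal_one]
  -- The Hölder estimate `|W (s₀ + σ u) - W s₀|² ≤ u * K` exactly cancels the weight.
  have hterm3 : ∫⁻ u in Icc u₁ b, ENNReal.ofReal u⁻¹ *
      ‖W (s₀ + σ * u) - W s₀‖ₑ ^ 2 ≤ ENNReal.ofReal b * K := by
    calc ∫⁻ u in Icc u₁ b, ENNReal.ofReal u⁻¹ * ‖W (s₀ + σ * u) - W s₀‖ₑ ^ 2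
        ≤ ∫⁻ _u in Icc u₁ b, K := by
          refine setLIntegral_mono' measurableSet_Icc fun u hu => ?_
          have hu0 : 0 < u := hu1pos.trans_le hu.1
          have h3 := hW.enorm_sub_sq_le hs₀ (hmemb u hu0.le hu.2)
          have h4 : |s₀ + σ * u - s₀| = u := by
            rcases hσ with rfl | rfl <;> simp [abs_of_pos hu0]
          rw [h4] at h3
          refine (mul_le_mul_right h3 _).trans ?_
          rw [← mul_assoc, ← ENNReal.ofReal_mul (by positivity), inv_mul_cancel₀ hu0.ne',
            ENNReal.ofReal_one, one_mul]
      _ ≤ _ := by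
          rw [setLIntegral_const, Real.volume_Icc, mul_comm]
          gcongr
          linarith
  calc ∫⁻ r in Icc δ₁ (g b), ENNReal.ofReal r⁻¹ * ‖φ k (γ.ext s₀ + r • n) - W s₀‖ₑ ^ 2
      ≤ ∫⁻ r in g '' Icc u₁ b, ENNReal.ofReal r⁻¹ * ‖φ k (c 0 + r • n) - W s₀‖ₑ ^ 2 := by
        rw [hc0]; exact lintegral_mono_set hsub
    _ = ∫⁻ u in Icc u₁ b, ENNReal.ofReal |inner ℝ (T u) e / ν| *
          (ENNReal.ofReal (g u)⁻¹ * ‖φ k (c 0 + g u • n) - W s₀‖ₑ ^ 2) :=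
        lintegral_image_eq_lintegral_abs_deriv_mul measurableSet_Icc
          (fun u _ => (hgd u).hasDerivWithinAt) hginj.injOn _
    _ ≤ ∫⁻ u in Icc u₁ b, ENNReal.ofReal ν⁻¹ * (2 *
          (2 * (ENNReal.ofReal u⁻¹ * ‖φ k (c 0 + g u • n) - φ k (c u)‖ₑ ^ 2) +
          4 * (ENNReal.ofReal u⁻¹ * ‖φ k (c u) - W (s₀ + σ * u)‖ₑ ^ 2) +
          4 * (ENNReal.ofReal u⁻¹ * ‖W (s₀ + σ * u) - W s₀‖ₑ ^ 2))) := by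
        refine setLIntegral_mono' measurableSet_Icc fun u hu => ?_
        have hu0 : 0 < u := hu1pos.trans_le hu.1
        have h3 := enorm_sub_sq_le_three (φ k (c 0 + g u • n)) (φ k (c u)) (W (s₀ + σ * u)) (W s₀)
        have h4 : ENNReal.ofReal |inner ℝ (T u) e / ν| ≤ ENNReal.ofReal ν⁻¹ := by
          refine ENNReal.ofReal_le_ofReal ?_
          rw [abs_div, abs_of_pos hν, abs_of_pos (hc.pos.trans_le (hc.inner_ge u)),
            div_eq_mul_inv]
          exact mul_le_of_le_one_left (by positivity) (hc.inner_le u)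
        have h5 : ENNReal.ofReal (g u)⁻¹ ≤ 2 * ENNReal.ofReal u⁻¹ := by
          rw [← ENNReal.ofReal_ofNat, ← ENNReal.ofReal_mul (by norm_num)]
          refine ENNReal.ofReal_le_ofReal ?_
          rw [← div_eq_mul_inv, ← one_div_div, ← one_div]
          exact one_div_le_one_div_of_le (by positivity) (hgge u hu0.le)
        refine mul_le_mul' h4 ((mul_le_mul' h5 h3).trans_eq ?_)
        ring
    _ = ENNReal.ofReal ν⁻¹ * (2 *
          (2 * (∫⁻ u in Icc u₁ b, ENNReal.ofReal u⁻¹ * ‖φ k (c 0 + g u • n) - φ k (c u)‖ₑ ^ 2) +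
          4 * (∫⁻ u in Icc u₁ b, ENNReal.ofReal u⁻¹ * ‖φ k (c u) - W (s₀ + σ * u)‖ₑ ^ 2) +
          4 * (∫⁻ u in Icc u₁ b, ENNReal.ofReal u⁻¹ * ‖W (s₀ + σ * u) - W s₀‖ₑ ^ 2))) := by
        have hWm : AEStronglyMeasurable (fun u => W (s₀ + σ * u)) (volume.restrict (Icc u₁ b)) := by
          refine ContinuousOn.aestronglyMeasurable ?_ measurableSet_Icc
          exact hW.continuousOn.comp (by fun_prop) fun u hu =>
            hmemb u (hu1pos.le.trans hu.1) hu.2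
        have hinv : AEMeasurable (fun u : ℝ => ENNReal.ofReal u⁻¹)
          (volume.restrict (Icc u₁ b)) := by fun_prop
        have hm1 : AEMeasurable (fun u => ENNReal.ofReal u⁻¹ *
            ‖φ k (c 0 + g u • n) - φ k (c u)‖ₑ ^ 2) (volume.restrict (Icc u₁ b)) :=
          hinv.mul ((Continuous.enorm (by fun_prop)).measurable.pow_const 2).aemeasurable
        have hm2 : AEMeasurable (fun u => ENNReal.ofReal u⁻¹ *
            ‖φ k (c u) - W (s₀ + σ * u)‖ₑ ^ 2) (volume.restrict (Icc u₁ b)) :=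
          hinv.mul (((hφc.comp hcc).aestronglyMeasurable.sub hWm).enorm.pow_const 2)
        rw [lintegral_const_mul' _ _ (by simp), lintegral_const_mul' _ _ (by simp),
          lintegral_add_left' (by exact (hm1.const_mul _).add (hm2.const_mul _)),
          lintegral_add_left' (hm1.const_mul _), lintegral_const_mul' _ _ (by simp),
          lintegral_const_mul' _ _ (by simp), lintegral_const_mul' _ _ (by simp)]
    _ ≤ _ := by gcongr

/-! ### Traces of functions in `H_Γ^{1,0}` -/

lemma enorm_gradient (φ : Plane → ℝ) (x : Plane) : ‖gradient φ x‖ₑ = ‖fderiv ℝ φ x‖ₑ := by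
  rw [← ofReal_norm, ← ofReal_norm, gradient, LinearIsometryEquiv.norm_map]

lemma tendsto_lintegral_sq_of_eLpNorm {α E : Type*} [MeasurableSpace α] [NormedAddCommGroup E]
    {μ : Measure α} {f : ℕ → α → E}
    (h : Tendsto (fun n => eLpNorm (f n) 2 μ) atTop (𝓝 0)) :
    Tendsto (fun n => ∫⁻ x, ‖f n x‖ₑ ^ 2 ∂μ) atTop (𝓝 0) := by
  have h1 := ((ENNReal.continuous_pow 2).tendsto 0).comp h
  rw [zero_pow (by norm_num)] at h1
  exact h1.congr fun n => eLpNorm_two_sq _ _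

lemma tendsto_zero_of_le_add {a b c : ℕ → ℝ≥0∞} (hb : Tendsto b atTop (𝓝 0))
    (hc : Tendsto c atTop (𝓝 0)) {A B : ℝ≥0∞} (hA : A ≠ ⊤) (hB : B ≠ ⊤)
    (h : ∀ n, a n ≤ A * b n + B * c n) :
    Tendsto a atTop (𝓝 0) := by
  refine tendsto_of_tendsto_of_tendsto_of_le_of_le tendsto_const_nhds ?_ (fun _ => zero_le) h
  simpa using (ENNReal.Tendsto.const_mul hb (Or.inr hA)).add
    (ENNReal.Tendsto.const_mul hc (Or.inr hB))

lemma lintegral_sq_sub_le {α E : Type*} [MeasurableSpace α] [NormedAddCommGroup E]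
    {μ : Measure α} {f g h : α → E} (hfh : AEStronglyMeasurable (fun x => f x - h x) μ) :
    ∫⁻ x, ‖f x - g x‖ₑ ^ 2 ∂μ ≤ 2 * (∫⁻ x, ‖f x - h x‖ₑ ^ 2 ∂μ) +
      2 * ∫⁻ x, ‖g x - h x‖ₑ ^ 2 ∂μ := by
  rw [← lintegral_const_mul' _ _ (by simp), ← lintegral_const_mul' _ _ (by simp),
    ← lintegral_add_left' ((hfh.enorm.pow_const 2).const_mul _)]
  refine lintegral_mono fun x => ?_
  have := enorm_add_sq_le (f x - h x) (h x - g x)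
  rwa [sub_add_sub_cancel, ← enorm_neg (h x - g x), neg_sub] at this

lemma IsTestFunction.setLIntegral_sq {Ω : Set Plane} {φ : Plane → ℝ} (hφ : IsTestFunction Ω φ) :
    ∫⁻ x in Ω, ‖φ x‖ₑ ^ 2 = ∫⁻ x, ‖φ x‖ₑ ^ 2 := by
  refine setLIntegral_eq_of_support_subset fun x hx => ?_
  by_contra h
  exact hx (by simp [hφ.eq_zero h])

lemma IsTestFunction.setLIntegral_fderiv_sq {Ω : Set Plane} {φ : Plane → ℝ}
    (hφ : IsTestFunction Ω φ) :
    ∫⁻ x in Ω, ‖fderiv ℝ φ x‖ₑ ^ 2 = ∫⁻ x, ‖fderiv ℝ φ x‖ₑ ^ 2 := by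
  refine setLIntegral_eq_of_support_subset fun x hx => ?_
  by_contra h
  refine hx ?_
  beta_reduce
  rw [hφ.fderiv_eq_zero h, ← ofReal_norm, norm_zero]
  simp

lemma gradient_sub {φ ψ : Plane → ℝ} (hφ : ContDiff ℝ 1 φ) (hψ : ContDiff ℝ 1 ψ) (x : Plane) :
    gradient (fun x => φ x - ψ x) x = gradient φ x - gradient ψ x := by
  rw [gradient, gradient, gradient, ← map_sub, fderiv_fun_sub
    ((hφ.differentiable (by norm_num)) x) ((hψ.differentiable (by norm_num)) x)]

lemma continuous_gradient {φ : Plane → ℝ} (hφ : ContDiff ℝ 1 φ) : Continuous (gradient φ) :=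
  (LinearIsometryEquiv.continuous _).comp (hφ.continuous_fderiv (by norm_num))

lemma restrict_Icc_eq_Ioo (l : ℝ) : volume.restrict (Icc 0 l) = volume.restrict (Ioo 0 l) :=
  Measure.restrict_congr_set Ioo_ae_eq_Icc.symm

/-- The trace is independent of the approximating sequence. -/
lemma IsTraceOn.tendsto {Ω : Set Plane} {γ : PlaneArc} {u : Plane → ℝ} {g : Plane → Plane}
    {w : ℝ → ℝ} (h : IsTraceOn Ω γ u g w) (hu : AEStronglyMeasurable u (volume.restrict Ω))
    (hg : AEStronglyMeasurable g (volume.restrict Ω)) {φ : ℕ → Plane → ℝ}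
    (hφ : ∀ n, IsTestFunction Ω (φ n)) (hφu : TendstoH1 Ω φ u g) :
    Tendsto (fun n => ∫⁻ s in Icc 0 γ.length, ‖φ n (γ.ext s) - w s‖ₑ ^ 2) atTop (𝓝 0) := by
  obtain ⟨ψ, hψ, hψu, hψw⟩ := h.limit
  obtain ⟨C, hC⟩ := γ.exists_trace_le
  have e1 := tendsto_lintegral_sq_of_eLpNorm hφu.1
  have e2 := tendsto_lintegral_sq_of_eLpNorm hφu.2
  have e3 := tendsto_lintegral_sq_of_eLpNorm hψu.1
  have e4 := tendsto_lintegral_sq_of_eLpNorm hψu.2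
  have e5 := tendsto_lintegral_sq_of_eLpNorm hψw
  -- The difference of two approximating sequences tends to zero in `H¹` of the whole plane, so the
  -- trace inequality applies to it.
  have hd : ∀ n, IsTestFunction Ω fun x => φ n x - ψ n x := fun n => (hφ n).sub (hψ n)
  have f1 : Tendsto (fun n => ∫⁻ x, ‖φ n x - ψ n x‖ₑ ^ 2) atTop (𝓝 0) := by
    refine tendsto_zero_of_le_add e1 e3 (A := 2) (B := 2) (by simp) (by simp) fun n => ?_
    rw [← (hd n).setLIntegral_sq]
    exact lintegral_sq_sub_le ((hφ n).contDiff.continuous.aestronglyMeasurable.sub hu)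
  have f2 : Tendsto (fun n => ∫⁻ x, ‖fderiv ℝ (fun x => φ n x - ψ n x) x‖ₑ ^ 2) atTop (𝓝 0) := by
    refine tendsto_zero_of_le_add e2 e4 (A := 2) (B := 2) (by simp) (by simp) fun n => ?_
    rw [← (hd n).setLIntegral_fderiv_sq]
    simp_rw [← enorm_gradient, gradient_sub (hφ n).contDiff_one (hψ n).contDiff_one]
    exact lintegral_sq_sub_le
      ((continuous_gradient (hφ n).contDiff_one).aestronglyMeasurable.sub hg)
  have f3 : Tendsto (fun n => ∫⁻ s in Icc 0 γ.length, ‖φ n (γ.ext s) - ψ n (γ.ext s)‖ₑ ^ 2)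
      atTop (𝓝 0) := by
    refine tendsto_zero_of_le_add f1 f2 (A := C) (B := C) (by simp) (by simp) fun n => ?_
    rw [← mul_add]
    exact hC _ (hd n).contDiff_one
  have f4 : Tendsto (fun n => ∫⁻ s in Icc 0 γ.length, ‖w s - ψ n (γ.ext s)‖ₑ ^ 2)
      atTop (𝓝 0) := by
    refine e5.congr fun n => ?_
    rw [← restrict_Icc_eq_Ioo]
    refine setLIntegral_congr_fun measurableSet_Icc fun s hs => ?_
    rw [← γ.ext_eq hs, ← enorm_neg, neg_sub]
  refine tendsto_zero_of_le_add f3 f4 (A := 2) (B := 2) (by simp) (by simp) fun n => ?_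
  have hc1 := (hφ n).contDiff.continuous
  have hc2 := (hψ n).contDiff.continuous
  have hc3 := γ.continuous_ext
  exact lintegral_sq_sub_le (Continuous.aestronglyMeasurable (by fun_prop))

section

variable {ι : Type*}

/-- Test functions `φ n` that are bounded in `H¹`, converge to `u` in `L²(Ω)`, and whose traces
converge to `W`. -/
structure ApproxSeq (Ω : Set Plane) (G : Pattern ι) (u : Plane → ℝ) (W : ι → ℝ → ℝ)
    (φ : ℕ → Plane → ℝ) (B : ℝ≥0) : Prop where
  test : ∀ n, IsTestFunction Ω (φ n)
  bound : ∀ᶠ n in atTop, ∫⁻ x, ‖fderiv ℝ (φ n) x‖ₑ ^ 2 ≤ B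
  tendsto : Tendsto (fun n => ∫⁻ x in Ω, ‖φ n x - u x‖ₑ ^ 2) atTop (𝓝 0)
  tendsto_trace : ∀ i, Tendsto (fun n => ∫⁻ s in Icc 0 (G.arc i).length,
    ‖φ n ((G.arc i).ext s) - W i s‖ₑ ^ 2) atTop (𝓝 0)

/-- The traces on different curves come with their own approximating sequences. Since the trace does
not depend on the sequence, the one that approximates `u` in `H¹` serves all curves at once, as the
comparison at nodes requires. -/
lemma IsHGamma.exists_approxSeq {Ω : Set Plane} {G : Pattern ι} {u : Plane → ℝ}
    {g : Plane → Plane} {w dw : ι → ℝ → ℝ} (h : IsHGamma Ω G u g w dw) :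
    ∃ W : ι → ℝ → ℝ, (∀ i, SobolevOn 0 (G.arc i).length (W i) (dw i)) ∧
      (∀ i, W i =ᵐ[volume.restrict (Ioo 0 (G.arc i).length)] w i) ∧
      ∃ φ B, ApproxSeq Ω G u W φ B := by
  choose W hW hWw using fun i => (h.isH1 i).exists_sobolevOn (G.arc i).length_pos
  obtain ⟨φ, hφ, hφu⟩ := h.isH10.mem_closure
  have hum := h.isH10.memLp.aestronglyMeasurable
  have hgm := h.isH10.memLp_grad.aestronglyMeasurable
  have hg : ∫⁻ x in Ω, ‖g x‖ₑ ^ 2 < ⊤ := (lintegral_sq_lt_top_iff hgm).1 h.isH10.memLp_grad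
  refine ⟨W, hW, hWw, φ, 2 + 2 * (∫⁻ x in Ω, ‖g x‖ₑ ^ 2).toNNReal, hφ, ?_,
    tendsto_lintegral_sq_of_eLpNorm hφu.1, fun i => ?_⟩
  · have e2 := tendsto_lintegral_sq_of_eLpNorm hφu.2
    filter_upwards [e2.eventually_le_const (u := 1) (by norm_num)] with n hn
    rw [← (hφ n).setLIntegral_fderiv_sq]
    simp_rw [← enorm_gradient]
    have := lintegral_sq_sub_le (f := gradient (φ n)) (g := fun _ => 0)
      ((continuous_gradient (hφ n).contDiff_one).aestronglyMeasurable.sub hgm)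
    simp only [sub_zero, zero_sub, enorm_neg] at this
    refine this.trans ?_
    push_cast
    rw [ENNReal.coe_toNNReal hg.ne]
    gcongr
    simpa using mul_le_mul_right hn 2
  · refine ((h.isTraceOn i).tendsto hum hgm hφ hφu).congr fun n => ?_
    rw [restrict_Icc_eq_Ioo]
    refine lintegral_congr_ae ?_
    filter_upwards [hWw i] with s hs
    rw [hs]

lemma PlaneArc.exists_direction (γ : PlaneArc) {s : ℝ} (hs : s ∈ Icc 0 γ.length) :
    ∃ σ ρ : ℝ, (σ = 1 ∨ σ = -1) ∧ 0 < ρ ∧ s + σ * ρ ∈ Icc 0 γ.length := by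
  rcases hs.2.lt_or_eq with h | h
  · exact ⟨1, γ.length - s, Or.inl rfl, by linarith, by constructor <;> linarith [γ.length_pos]⟩
  · exact ⟨-1, γ.length, Or.inr rfl, γ.length_pos, by constructor <;> linarith [γ.length_pos]⟩

/-- Provides a ray along which two curve ends can be compared: `v` itself works unless `v' = -v`,
and then a perpendicular direction does. -/
lemma exists_not_antiparallel {v v' : Plane} (hv : ‖v‖ = 1) :
    ∃ n : Plane, ‖n‖ = 1 ∧ v + n ≠ 0 ∧ v' + n ≠ 0 := by
  have hv0 : v ≠ 0 := fun h => by rw [h, norm_zero] at hv; norm_num at hv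
  by_cases h : v' + v = 0
  · have hJ : ‖rotJ v‖ = 1 := by rw [norm_rotJ, hv]
    have key : ∀ a : ℝ, a • v + rotJ v ≠ 0 := by
      intro a ha
      have := congrArg (fun x => inner ℝ x (rotJ v)) ha
      simp only [inner_add_left, real_inner_smul_left, inner_self_rotJ, inner_zero_left,
        real_inner_self_eq_norm_sq, hJ] at this
      norm_num at this
    refine ⟨rotJ v, hJ, by simpa using key 1, ?_⟩
    rw [eq_neg_of_add_eq_zero_left h]
    simpa using key (-1)
  · refine ⟨v, hv, ?_, h⟩
    rw [← two_smul ℝ]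
    simpa using hv0

namespace ApproxSeq

variable {Ω : Set Plane} {G : Pattern ι} {u : Plane → ℝ} {W dw : ι → ℝ → ℝ}
  {φ : ℕ → Plane → ℝ} {B : ℝ≥0}

/-- Both values are ray limits of the same sequence along one common ray. The ray may leave `Ω`, as
the test functions are defined on the whole plane. -/
lemma trace_eq (h : ApproxSeq Ω G u W φ B)
    (hW : ∀ i, SobolevOn 0 (G.arc i).length (W i) (dw i)) {i j : ι} {s t : ℝ}
    (hs : s ∈ Icc 0 (G.arc i).length) (ht : t ∈ Icc 0 (G.arc j).length)
    (hst : (G.arc i).toFun s = (G.arc j).toFun t) : W i s = W j t := by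
  obtain ⟨σ, ρ, hσ, hρ, hr⟩ := (G.arc i).exists_direction hs
  obtain ⟨σ', ρ', hσ', hρ', hr'⟩ := (G.arc j).exists_direction ht
  obtain ⟨n, hn, h1, h2⟩ := exists_not_antiparallel (v' := σ' • (G.arc j).extTangent t)
    ((G.arc i).norm_smul_self s hσ)
  have k1 := (G.arc i).rayLimit hσ hs hρ hr hn h1 (fun k => (h.test k).contDiff_one) h.bound
    (hW i) (h.tendsto_trace i)
  have k2 := (G.arc j).rayLimit hσ' ht hρ' hr' hn h2 (fun k => (h.test k).contDiff_one) h.bound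
    (hW j) (h.tendsto_trace j)
  rw [(G.arc i).ext_eq hs, hst, ← (G.arc j).ext_eq ht] at k1
  exact k1.unique (fun k => (h.test k).contDiff.continuous) k2

/-- Below a Lipschitz graph there is room for a ray from the boundary point that stays outside `Ω`.
All test functions vanish on it, so its ray limit is `0`. -/
lemma trace_eq_zero (h : ApproxSeq Ω G u W φ B) (hΩ : IsOpen Ω)
    (hW : ∀ i, SobolevOn 0 (G.arc i).length (W i) (dw i)) {i : ι} {s : ℝ}
    (hs : s ∈ Icc 0 (G.arc i).length) (hsΩ : (G.arc i).toFun s ∈ frontier Ω)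
    (hLip : IsLipschitzBoundaryAt Ω ((G.arc i).toFun s)) : W i s = 0 := by
  obtain ⟨R, K, f, r, hf, hr, hgraph⟩ := hLip
  obtain ⟨σ, ρ, hσ, hρ, hroom⟩ := (G.arc i).exists_direction hs
  set p := (G.arc i).toFun s with hp
  set v := σ • (G.arc i).extTangent s
  have hpΩ : p ∉ Ω := fun hmem => by
    rw [hΩ.frontier_eq] at hsΩ; exact hsΩ.2 hmem
  -- A downward direction `(a, -1)` with `K * |a| ≤ 1` descends at least as fast as the graph can,
  -- so its ray stays below the graph.
  set κ : ℝ := 1 / (K + 1) with hκ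
  have hκ0 : 0 < κ := by positivity
  have hKκ : K * κ ≤ 1 := by
    rw [hκ, mul_one_div, div_le_one (by positivity)]; linarith
  let d : ℝ → Plane := fun a => R.symm !₂[a, -1]
  have hd0 : ∀ a, 0 < ‖d a‖ := fun a => by
    rw [norm_pos_iff]
    intro h0
    simp only [d, LinearIsometryEquiv.map_eq_zero_iff] at h0
    have := congrArg (fun x : Plane => x 1) h0
    simp at this
  let n : ℝ → Plane := fun a => ‖d a‖⁻¹ • d a
  have hn : ∀ a, ‖n a‖ = 1 := fun a => by
    simp only [n, norm_smul, norm_inv, norm_norm]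
    exact inv_mul_cancel₀ (hd0 a).ne'
  -- The curve direction can be opposite to at most one of the two distinct directions `n 0` and `n
  -- κ`.
  obtain ⟨a, ha, hva⟩ : ∃ a : ℝ, |a| ≤ κ ∧ v + n a ≠ 0 := by
    by_cases h0 : v + n 0 = 0
    · refine ⟨κ, by rw [abs_of_pos hκ0], fun h1 => ?_⟩
      have h2 : n 0 = n κ := by
        rw [← neg_eq_of_add_eq_zero_right h0, ← neg_eq_of_add_eq_zero_right h1]
      have h3 := congrArg (fun x => R x 0) h2
      simp only [n, d, map_smul, LinearIsometryEquiv.apply_symm_apply, PiLp.smul_apply] at h3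
      simp at h3
      exact hκ0.ne' h3
    · exact ⟨0, by simpa using hκ0.le, h0⟩
  have hray : ∀ q, 0 ≤ q → q < r → p + q • n a ∉ Ω := by
    intro q hq hqr
    have hball : p + q • n a ∈ Metric.ball p r := by
      rw [Metric.mem_ball, dist_eq_norm, add_sub_cancel_left, norm_smul, hn, mul_one,
        Real.norm_of_nonneg hq]
      exact hqr
    rw [hgraph _ hball, not_lt]
    have hp1 : R p 1 ≤ f (R p 0) := not_lt.1 fun hlt =>
      hpΩ ((hgraph p (Metric.mem_ball_self hr)).2 hlt)
    set τ := q * ‖d a‖⁻¹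
    have hτ : 0 ≤ τ := mul_nonneg hq (inv_nonneg.2 (norm_nonneg _))
    have hR : R (p + q • n a) = R p + τ • !₂[a, -1] := by
      rw [map_add, map_smul, map_smul, smul_smul]
      simp [d, τ]
    have h0 : R (p + q • n a) 0 = R p 0 + τ * a := by rw [hR]; simp
    have h1 : R (p + q • n a) 1 = R p 1 - τ := by rw [hR]; simp; ring
    rw [h0, h1]
    have hfl := hf.dist_le_mul (R p 0) (R p 0 + τ * a)
    rw [Real.dist_eq, Real.dist_eq, sub_add_cancel_left, abs_neg, abs_mul, abs_of_nonneg hτ] at hfl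
    have h2 : K * (τ * |a|) ≤ τ := by
      have : (K : ℝ) * |a| ≤ 1 := (mul_le_mul_of_nonneg_left ha K.2).trans hKκ
      nlinarith
    have := (abs_le.1 (hfl.trans h2)).2
    linarith
  have k1 := (G.arc i).rayLimit hσ hs hρ hroom (hn a) hva (fun k => (h.test k).contDiff_one)
    h.bound (hW i) (h.tendsto_trace i)
  have k2 : RayLimit φ ((G.arc i).ext s) (n a) 0 := by
    refine ⟨0, by simp, r / 2, by positivity, fun δ₁ h1 _ => Eventually.of_forall fun k => ?_⟩
    rw [(G.arc i).ext_eq hs, ← hp, nonpos_iff_eq_zero]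
    rw [setLIntegral_congr_fun measurableSet_Icc (g := fun _ => 0), lintegral_zero]
    intro q hq
    have := (h.test k).eq_zero (hray q (h1.le.trans hq.1) (by linarith [hq.2]))
    simp [this]
  exact k1.unique (fun k => (h.test k).contDiff.continuous) k2

end ApproxSeq

end

/-! ### Extension from a graph curve into a cone -/

namespace GraphCurve

variable {e : Plane} {κ : ℝ} {c T : ℝ → Plane}

lemma contDiff_curve (h : GraphCurve e κ c T) : ContDiff ℝ 1 c := by
  rw [contDiff_one_iff_deriv]
  refine ⟨fun u => (h.hasDerivAt u).differentiableAt, ?_⟩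
  rw [show deriv c = T from funext fun u => (h.hasDerivAt u).deriv]
  exact h.continuous_deriv

/-- The coordinates `(u, t)` of `x = c u + t J e` are Lipschitz `C¹` functions of `x`. -/
lemma exists_coord (h : GraphCurve e κ c T) : ∃ U R : Plane → ℝ, ContDiff ℝ 1 U ∧ ContDiff ℝ 1 R ∧
    (∀ x, x = c (U x) + R x • rotJ e) ∧ (∀ u t : ℝ, U (c u + t • rotJ e) = u) ∧
    (∀ u t : ℝ, R (c u + t • rotJ e) = t) ∧ (∀ x, ‖fderiv ℝ U x‖ ≤ 1 + κ⁻¹) ∧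
    (∀ x, ‖fderiv ℝ R x‖ ≤ 1 + κ⁻¹) := by
  let g := fun u => inner ℝ (c u) e
  -- The first coordinate is the inverse of the abscissa function, whose derivative is at least `κ`;
  -- hence it is `C¹` and `κ⁻¹`-Lipschitz.
  let Ψ : ℝ ≃ₜ ℝ := (h.coord_strictMono.orderIsoOfSurjective g h.coord_surjective).toHomeomorph
  have hΨ : ∀ u, Ψ u = g u := fun u => rfl
  have hgC : ContDiff ℝ 1 g := h.contDiff_curve.inner ℝ contDiff_const
  have hΨs : ContDiff ℝ 1 Ψ.symm :=
    Ψ.contDiff_symm_deriv (f' := fun u => inner ℝ (T u) e)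
      (fun u => (h.pos.trans_le (h.inner_ge u)).ne') (fun u => h.coord_hasDerivAt e u) hgC
  have hgU : ∀ x, inner ℝ (c (Ψ.symm (inner ℝ x e))) e = inner ℝ x e := fun x =>
    Ψ.apply_symm_apply (inner ℝ x e)
  let U : Plane → ℝ := fun x => Ψ.symm (inner ℝ x e)
  let R : Plane → ℝ := fun x => inner ℝ (x - c (U x)) (rotJ e)
  have hU : ContDiff ℝ 1 U := hΨs.comp (contDiff_id.inner ℝ contDiff_const)
  have hR : ContDiff ℝ 1 R :=
    (contDiff_id.sub (h.contDiff_curve.comp hU)).inner ℝ contDiff_const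
  have hdec : ∀ x, x = c (U x) + R x • rotJ e := by
    intro x
    have h1 := frame_decomp h.unit (x - c (U x))
    have h2 : inner ℝ (x - c (U x)) e = 0 := by
      rw [inner_sub_left]; simp only [U]; rw [hgU, sub_self]
    rw [h2, zero_smul, zero_add] at h1
    simp only [R]
    rw [← h1]; abel
  have hκ := h.pos
  have hUlip : ∀ x y, |U x - U y| ≤ κ⁻¹ * ‖x - y‖ := by
    have key : ∀ x y, U y ≤ U x → U x - U y ≤ κ⁻¹ * ‖x - y‖ := by
      intro x y hxy
      have h1 := h.coord_sub_ge hxy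
      have h2 : inner ℝ (c (U x)) e - inner ℝ (c (U y)) e = inner ℝ (x - y) e := by
        rw [inner_sub_left]; simp only [U]; rw [hgU, hgU]
      have h3 := real_inner_le_norm (x - y) e
      rw [h.unit, mul_one] at h3
      rw [inv_mul_eq_div, le_div_iff₀ hκ]
      linarith
    intro x y
    rcases le_total (U y) (U x) with hxy | hxy
    · rw [abs_of_nonneg (sub_nonneg.2 hxy)]; exact key x y hxy
    · rw [abs_sub_comm, abs_of_nonneg (sub_nonneg.2 hxy), norm_sub_rev]; exact key y x hxy
  have hRlip : ∀ x y, |R x - R y| ≤ (1 + κ⁻¹) * ‖x - y‖ := by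
    intro x y
    have h1 : R x - R y = inner ℝ ((x - y) - (c (U x) - c (U y))) (rotJ e) := by
      simp only [R]; rw [← inner_sub_left]; congr 1; abel
    rw [h1]
    refine (abs_real_inner_le_norm _ _).trans ?_
    rw [h.norm_J, mul_one]
    have h2 := _root_.norm_sub_le (x - y) (c (U x) - c (U y))
    have h3 := h.norm_sub_le (U y) (U x)
    have h4 := hUlip x y
    linarith
  refine ⟨U, R, hU, hR, hdec, fun u t => ?_, fun u t => ?_, fun x => ?_, fun x => ?_⟩
  · exact (h.param_injective (hdec (c u + t • rotJ e))).1.symm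
  · exact (h.param_injective (hdec (c u + t • rotJ e))).2.symm
  · have : LipschitzWith ⟨1 + κ⁻¹, by positivity⟩ U := LipschitzWith.of_dist_le_mul fun x y => by
      rw [Real.dist_eq, dist_eq_norm]
      refine (hUlip x y).trans ?_
      change κ⁻¹ * _ ≤ (1 + κ⁻¹) * _
      gcongr
      linarith
    exact norm_fderiv_le_of_lipschitz ℝ this
  · have : LipschitzWith ⟨1 + κ⁻¹, by positivity⟩ R := LipschitzWith.of_dist_le_mul fun x y => by
      rw [Real.dist_eq, dist_eq_norm]
      exact hRlip x y
    exact norm_fderiv_le_of_lipschitz ℝ this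

/-- The extension is `w u * ζ (t / (θ u))`. Its gradient is bounded by a multiple of `|w'| + |w| /
(θ u)` and lives on segments of length `θ u`. As `w 0 = 0`, the Hölder estimate gives `|w u|² ≤ u ∫
|w'|²`, so the integral of the second term's square over each segment is bounded, and integration
over `u ∈ (0, b)` costs a factor `b`. Since `w` vanishes near `0`, the singularity of the quotient
at the vertex plays no role for smoothness. -/
lemma exists_cone_extension (h : GraphCurve e κ c T) {θ b : ℝ} (hθ : 0 < θ) (hθ1 : θ ≤ 1)
    (hb : 0 < b) : ∃ C : ℝ≥0, ∀ w : ℝ → ℝ, IsTestFunction (Ioo 0 b) w →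
    ∃ f : Plane → ℝ, ContDiff ℝ 1 f ∧ HasCompactSupport f ∧ (∀ u, f (c u) = w u) ∧
      (∀ x ∈ tsupport f, ∃ u t, u ∈ Ioo 0 b ∧ |t| ≤ θ * u ∧ x = c u + t • rotJ e) ∧
      ∫⁻ x, ‖fderiv ℝ f x‖ₑ ^ 2 ≤ C * ∫⁻ u, ‖deriv w u‖ₑ ^ 2 := by
  obtain ⟨U, R, hU, hR, hdec, hUp, hRp, hdU, hdR⟩ := h.exists_coord
  let ζ : ContDiffBump (0 : ℝ) := ⟨1 / 4, 1 / 2, by norm_num, by norm_num⟩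
  have hζC : ContDiff ℝ ∞ ζ := ζ.contDiff
  obtain ⟨Z, hZ⟩ := (hζC.continuous_deriv (by norm_cast)).bounded_above_of_compact_support
    ζ.hasCompactSupport.deriv
  have hZ0 : 0 ≤ Z := (norm_nonneg _).trans (hZ 0)
  set L := 1 + κ⁻¹ with hL
  have hL0 : 0 < L := by have := h.pos; positivity
  refine ⟨(2 * L ^ 2 * b + 8 * L ^ 2 * Z ^ 2 * b / θ).toNNReal, fun w hw => ?_⟩
  let f : Plane → ℝ := fun x => w (U x) * ζ (R x / (θ * U x))
  have hpos : ∀ {u}, u ∈ tsupport w → 0 < u := fun hu => (hw.tsupport_subset hu).1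
  -- Covers all points where the quotient `R / (θ U)` might be singular.
  have hwz : ∀ x, U x ∉ tsupport w → f =ᶠ[𝓝 x] fun _ => 0 := by
    intro x hx
    have h1 : ∀ᶠ y in 𝓝 x, U y ∈ (tsupport w)ᶜ :=
      hU.continuous.continuousAt.eventually_mem ((isClosed_tsupport w).isOpen_compl.mem_nhds hx)
    filter_upwards [h1] with y hy
    simp only [f, image_eq_zero_of_notMem_tsupport hy, zero_mul]
  have hq : ∀ x, U x ∈ tsupport w → ContDiffAt ℝ 1 (fun x => R x / (θ * U x)) x := by
    intro x hx
    exact hR.contDiffAt.div (contDiffAt_const.mul hU.contDiffAt)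
      (mul_pos hθ (hpos hx)).ne'
  have hfC : ContDiff ℝ 1 f := by
    rw [contDiff_iff_contDiffAt]
    intro x
    by_cases hx : U x ∈ tsupport w
    · exact (hw.contDiff_one.contDiffAt.comp x hU.contDiffAt).mul
        ((hζC.of_le (by norm_cast)).contDiffAt.comp x (hq x hx))
    · exact (contDiffAt_const (c := (0 : ℝ))).congr_of_eventuallyEq (hwz x hx)
  have hsmall : ∀ x, U x ∈ tsupport w → θ * U x / 2 < |R x| → f =ᶠ[𝓝 x] fun _ => 0 := by
    intro x hx hxR
    have h1 : ∀ᶠ y in 𝓝 x, θ * U y / 2 < |R y| := by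
      have c1 := hU.continuous
      have c2 := hR.continuous
      exact (isOpen_lt (by fun_prop) (by fun_prop)).mem_nhds hxR
    have h2 : ∀ᶠ y in 𝓝 x, 0 < U y := hU.continuous.continuousAt.eventually_const_lt (hpos hx)
    filter_upwards [h1, h2] with y hy1 hy2
    simp only [f]
    rw [ζ.zero_of_le_dist, mul_zero]
    rw [dist_zero_right, norm_div, Real.norm_eq_abs, Real.norm_of_nonneg (by positivity),
      le_div_iff₀ (by positivity)]
    change 1 / 2 * (θ * U y) ≤ |R y|
    linarith
  let S : Set Plane := (fun q : ℝ × ℝ => c q.1 + q.2 • rotJ e) ''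
    ((tsupport w ×ˢ Icc (-(θ * b)) (θ * b)) ∩ {q | |q.2| ≤ θ * q.1 / 2})
  have hcc := h.continuous
  have hS : IsCompact S := by
    refine IsCompact.image ?_ (by fun_prop)
    exact (hw.hasCompactSupport.isCompact.prod isCompact_Icc).inter_right
      (isClosed_le (by fun_prop) (by fun_prop))
  have hmemS : ∀ x, U x ∈ tsupport w → ¬ θ * U x / 2 < |R x| → x ∈ S := by
    intro x hx hxR
    refine ⟨(U x, R x), ⟨⟨hx, ?_⟩, not_lt.1 hxR⟩, (hdec x).symm⟩
    have h1 := hw.tsupport_subset hx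
    rw [mem_Icc, ← abs_le]
    have := mul_le_mul_of_nonneg_left h1.2.le hθ.le
    have := mul_pos hθ h1.1
    linarith [not_lt.1 hxR]
  have hts : tsupport f ⊆ S := by
    refine closure_minimal (fun x hx => ?_) hS.isClosed
    by_cases h1 : U x ∈ tsupport w
    · by_cases h2 : θ * U x / 2 < |R x|
      · exact absurd (hsmall x h1 h2).self_of_nhds hx
      · exact hmemS x h1 h2
    · exact absurd (hwz x h1).self_of_nhds hx
  refine ⟨f, hfC, hS.of_isClosed_subset (isClosed_tsupport _) hts, fun u => ?_, fun x hx => ?_, ?_⟩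
  · have h1 := hUp u 0
    have h2 := hRp u 0
    rw [zero_smul, add_zero] at h1 h2
    simp only [f, h1, h2, zero_div]
    rw [ζ.one_of_mem_closedBall (by simpa using ζ.rIn_pos.le), mul_one]
  · obtain ⟨⟨u, t⟩, ⟨⟨h1, -⟩, h2⟩, rfl⟩ := hts hx
    have := hpos h1
    have h3 := mul_pos hθ this
    refine ⟨u, t, hw.tsupport_subset h1, ?_, rfl⟩
    have h2 : |t| ≤ θ * u / 2 := h2
    linarith
  have hgrad : ∀ x, U x ∈ tsupport w → |R x| ≤ θ * U x / 2 →
      ‖fderiv ℝ f x‖ ≤ L * |deriv w (U x)| + 2 * L * Z * (|w (U x)| / (θ * U x)) := by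
    intro x hx hxR
    have hu := hpos hx
    have hθu : 0 < θ * U x := mul_pos hθ hu
    have d1 : HasFDerivAt U (fderiv ℝ U x) x := (hU.differentiable (by norm_num) x).hasFDerivAt
    have d2 : HasFDerivAt R (fderiv ℝ R x) x := (hR.differentiable (by norm_num) x).hasFDerivAt
    have d3 := (hw.contDiff_one.differentiable (by norm_num) (U x)).hasDerivAt.comp_hasFDerivAt x d1
    have d4 : HasFDerivAt (fun x => (θ * U x)⁻¹) ((-((θ * U x) ^ 2)⁻¹) • (θ • fderiv ℝ U x)) x :=
      (hasDerivAt_inv hθu.ne').comp_hasFDerivAt x (d1.const_mul θ)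
    have d5 : HasFDerivAt (fun x => R x / (θ * U x)) (R x • ((-((θ * U x) ^ 2)⁻¹) • (θ • fderiv ℝ U x)) +
        (θ * U x)⁻¹ • fderiv ℝ R x) x := by
      simp only [div_eq_mul_inv]
      exact d2.mul d4
    have d6 := ((hζC.differentiable (by norm_cast)) (R x / (θ * U x))).hasDerivAt.comp_hasFDerivAt x d5
    have d7 : HasFDerivAt f _ x := d3.mul d6
    rw [d7.fderiv]
    set q := R x / (θ * U x) with hqdef
    have hq2 : |q| ≤ 1 := by
      rw [hqdef, abs_div, abs_of_pos hθu, div_le_one hθu]; linarith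
    have n5 : ‖R x • ((-((θ * U x) ^ 2)⁻¹) • (θ • fderiv ℝ U x)) +
        (θ * U x)⁻¹ • fderiv ℝ R x‖ ≤ 2 * L / (θ * U x) := by
      have n1 : ‖R x • ((-((θ * U x) ^ 2)⁻¹) • (θ • fderiv ℝ U x))‖ ≤ L / (θ * U x) := by
        rw [smul_smul, smul_smul, norm_smul]
        have : R x * -((θ * U x) ^ 2)⁻¹ * θ = -(q * θ) / (θ * U x) := by
          rw [hqdef]; field_simp
        rw [this, norm_div, norm_neg, norm_mul, Real.norm_eq_abs, Real.norm_of_nonneg hθ.le,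
          Real.norm_of_nonneg hθu.le, div_mul_eq_mul_div]
        gcongr
        calc |q| * θ * ‖fderiv ℝ U x‖ ≤ 1 * 1 * L := by
              gcongr
              exact hdU x
          _ = L := by ring
      have n2 : ‖(θ * U x)⁻¹ • fderiv ℝ R x‖ ≤ L / (θ * U x) := by
        rw [norm_smul, norm_inv, Real.norm_of_nonneg hθu.le, inv_mul_eq_div]
        gcongr
        exact hdR x
      refine (norm_add_le _ _).trans ((add_le_add n1 n2).trans_eq ?_)
      ring
    have hz1 : |ζ q| ≤ 1 := by rw [abs_of_nonneg ζ.nonneg]; exact ζ.le_one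
    refine (norm_add_le _ _).trans ?_
    rw [norm_smul, norm_smul, norm_smul, norm_smul, add_comm, Real.norm_eq_abs, Real.norm_eq_abs,
      Real.norm_eq_abs]
    refine add_le_add ?_ ?_
    · calc |ζ q| * (|deriv w (U x)| * ‖fderiv ℝ U x‖) ≤ 1 * (|deriv w (U x)| * L) := by
            gcongr
            exact hdU x
        _ = _ := by ring
    · calc |w (U x)| * (‖deriv ζ q‖ * ‖R x • ((-((θ * U x) ^ 2)⁻¹) • (θ • fderiv ℝ U x)) +
            (θ * U x)⁻¹ • fderiv ℝ R x‖) ≤ |w (U x)| * (Z * (2 * L / (θ * U x))) := by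
            gcongr
            exact hZ q
        _ = _ := by ring
  set E := ∫⁻ u, ‖deriv w u‖ₑ ^ 2 with hE
  have hdc : Continuous (deriv w) := hw.contDiff_one.continuous_deriv (by norm_num)
  have hws : SobolevOn 0 b w (deriv w) := SobolevOn.of_hasDerivAt
    (fun s => (hw.contDiff_one.differentiable (by norm_num) s).hasDerivAt) hdc
  -- Replaces Hardy's inequality: of the factor `u⁻²` in the gradient bound one power is absorbed
  -- here, the other by the length of the segments.
  have hwE : ∀ u ∈ Ioo 0 b, ‖w u‖ₑ ^ 2 ≤ ENNReal.ofReal u * E := by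
    intro u hu
    have := hws.enorm_sub_sq_le (left_mem_Icc.2 hb.le) (Ioo_subset_Icc_self hu)
    rw [hw.eq_zero (x := 0) (by simp), sub_zero, sub_zero, abs_of_pos hu.1] at this
    exact this.trans (mul_le_mul_right (setLIntegral_le_lintegral _ _) _)
  have hpt : ∀ u t, ‖fderiv ℝ f (c u + t • rotJ e)‖ₑ ^ 2 ≤ (Ioo 0 b).indicator (fun u =>
      (Icc (-(θ * u / 2)) (θ * u / 2)).indicator (fun _ =>
        ENNReal.ofReal (2 * L ^ 2) * ‖deriv w u‖ₑ ^ 2 +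
        ENNReal.ofReal (8 * L ^ 2 * Z ^ 2 / (θ ^ 2 * u)) * E) t) u := by
    intro u t
    set x := c u + t • rotJ e
    have hUx : U x = u := hUp u t
    have hRx : R x = t := hRp u t
    have hzero : f =ᶠ[𝓝 x] (fun _ => 0) → ‖fderiv ℝ f x‖ₑ ^ 2 = 0 := fun h0 => by
      rw [h0.fderiv_eq, fderiv_fun_const, Pi.zero_apply, ← ofReal_norm, norm_zero]; simp
    by_cases hx : U x ∈ tsupport w
    swap
    · rw [hzero (hwz x hx)]; exact zero_le
    by_cases hx2 : θ * U x / 2 < |R x|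
    · rw [hzero (hsmall x hx hx2)]; exact zero_le
    rw [not_lt] at hx2
    have hg := hgrad x hx hx2
    rw [hUx] at hg hx hx2
    rw [hRx] at hx2
    have hu := hw.tsupport_subset hx
    rw [indicator_of_mem hu, indicator_of_mem (by rw [mem_Icc, ← abs_le]; exact hx2)]
    have hu0 : 0 < u := hu.1
    calc ‖fderiv ℝ f x‖ₑ ^ 2 = ENNReal.ofReal (‖fderiv ℝ f x‖ ^ 2) := by
          rw [← ofReal_norm, ENNReal.ofReal_pow (norm_nonneg _)]
      _ ≤ ENNReal.ofReal (2 * L ^ 2 * |deriv w u| ^ 2 +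
            8 * L ^ 2 * Z ^ 2 / (θ ^ 2 * u ^ 2) * |w u| ^ 2) := by
          refine ENNReal.ofReal_le_ofReal ?_
          have h1 := pow_le_pow_left₀ (norm_nonneg _) hg 2
          have h2 : 8 * L ^ 2 * Z ^ 2 / (θ ^ 2 * u ^ 2) * |w u| ^ 2 =
              2 * (2 * L * Z * (|w u| / (θ * u))) ^ 2 := by
            field_simp; ring
          rw [h2]
          refine h1.trans ?_
          have h3 := sq_nonneg (L * |deriv w u| - 2 * L * Z * (|w u| / (θ * u)))
          linarith
      _ = ENNReal.ofReal (2 * L ^ 2) * ‖deriv w u‖ₑ ^ 2 +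
            ENNReal.ofReal (8 * L ^ 2 * Z ^ 2 / (θ ^ 2 * u ^ 2)) * ‖w u‖ₑ ^ 2 := by
          rw [ENNReal.ofReal_add (by positivity) (by positivity), ENNReal.ofReal_mul (by positivity),
            ENNReal.ofReal_mul (p := 8 * L ^ 2 * Z ^ 2 / (θ ^ 2 * u ^ 2)) (by positivity),
            ENNReal.ofReal_pow (abs_nonneg _), ENNReal.ofReal_pow (abs_nonneg _),
            ← Real.enorm_eq_ofReal_abs, ← Real.enorm_eq_ofReal_abs]
      _ ≤ ENNReal.ofReal (2 * L ^ 2) * ‖deriv w u‖ₑ ^ 2 +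
            ENNReal.ofReal (8 * L ^ 2 * Z ^ 2 / (θ ^ 2 * u ^ 2)) * (ENNReal.ofReal u * E) := by
          gcongr
          exact hwE u hu
      _ = _ := by
          rw [← mul_assoc (ENNReal.ofReal (8 * L ^ 2 * Z ^ 2 / (θ ^ 2 * u ^ 2))),
            ← ENNReal.ofReal_mul (by positivity)]
          congr 3
          field_simp
  calc ∫⁻ x, ‖fderiv ℝ f x‖ₑ ^ 2
      ≤ ∫⁻ u : ℝ, ∫⁻ t : ℝ, ‖fderiv ℝ f (c u + t • rotJ e)‖ₑ ^ 2 := h.le_sweep (measurable_grad_sq hfC)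
    _ ≤ ∫⁻ u : ℝ, (Ioo 0 b).indicator (fun u => ENNReal.ofReal (2 * L ^ 2 * b) * ‖deriv w u‖ₑ ^ 2 +
        ENNReal.ofReal (8 * L ^ 2 * Z ^ 2 / θ) * E) u := by
        refine lintegral_mono fun u => ?_
        refine (lintegral_mono fun t => hpt u t).trans ?_
        by_cases hu : u ∈ Ioo 0 b
        · have hu0 := hu.1
          simp only [indicator_of_mem hu]
          rw [lintegral_indicator measurableSet_Icc, setLIntegral_const, Real.volume_Icc, add_mul,
            mul_right_comm, mul_right_comm _ E, ← ENNReal.ofReal_mul (by positivity),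
            ← ENNReal.ofReal_mul (by positivity)]
          gcongr
          · have : θ * u ≤ 1 * b := mul_le_mul hθ1 hu.2.le hu0.le zero_le_one
            linarith
          · refine le_of_eq ?_
            field_simp
            ring
        · simp [indicator_of_notMem hu]
    _ ≤ ENNReal.ofReal (2 * L ^ 2 * b) * E + ENNReal.ofReal (8 * L ^ 2 * Z ^ 2 / θ) * E *
          ENNReal.ofReal b := by
        rw [lintegral_indicator measurableSet_Ioo, lintegral_add_right _ measurable_const,
          lintegral_const_mul' _ _ (by simp), setLIntegral_const, Real.volume_Ioo, sub_zero]
        gcongr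
        exact setLIntegral_le_lintegral _ _
    _ = _ := by
        rw [mul_right_comm (ENNReal.ofReal (8 * _ * _ / θ)), ← ENNReal.ofReal_mul (by positivity), ← add_mul,
          ← ENNReal.ofReal_add (by positivity) (by positivity)]
        congr 1
        change _ = ENNReal.ofReal _
        congr 1
        ring

end GraphCurve

/-! ### Isolation of a curve end in a cone -/

/-- The open truncated cone with vertex `p` and axis `v`. -/
def truncatedCone (p v : Plane) (ε : ℝ) : Set Plane :=
  {x | ‖x - p‖ < ε ∧ (1 - ε) * ‖x - p‖ < inner ℝ (x - p) v}

lemma truncatedCone_mono (p v : Plane) {ε ε' : ℝ} (h : ε ≤ ε') :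
    truncatedCone p v ε ⊆ truncatedCone p v ε' := fun x hx =>
  ⟨hx.1.trans_le h, (mul_le_mul_of_nonneg_right (by linarith) (norm_nonneg _)).trans_lt hx.2⟩

/-- For `ε ≤ 1` the factor `1 - ε` is nonnegative, so convexity of the norm has the right sign.
Convexity serves for connectedness: a cone that misses `∂Ω` and meets `Ω` lies in `Ω`. -/
lemma convex_truncatedCone (p v : Plane) {ε : ℝ} (hε : ε ≤ 1) : Convex ℝ (truncatedCone p v ε) := by
  intro x hx y hy a b ha hb hab
  have e1 : a • x + b • y - p = a • (x - p) + b • (y - p) := by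
    rw [smul_sub, smul_sub, sub_add_sub_comm, ← add_smul, hab, one_smul]
  have n1 : ‖a • (x - p) + b • (y - p)‖ ≤ a * ‖x - p‖ + b * ‖y - p‖ := by
    refine (norm_add_le _ _).trans_eq ?_
    rw [norm_smul, norm_smul, Real.norm_of_nonneg ha, Real.norm_of_nonneg hb]
  simp only [truncatedCone, mem_ofPred_eq, e1, inner_add_left, real_inner_smul_left]
  have h1 := hx.1
  have h2 := hx.2
  have h3 := hy.1
  have h4 := hy.2
  rcases ha.eq_or_lt with rfl | ha
  · rw [zero_add] at hab
    subst hab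
    simpa [truncatedCone] using hy
  · have s1 := mul_lt_mul_of_pos_left h1 ha
    have s2 := mul_lt_mul_of_pos_left h2 ha
    have s3 := mul_le_mul_of_nonneg_left h3.le hb
    have s4 := mul_le_mul_of_nonneg_left h4.le hb
    refine ⟨n1.trans_lt ?_, (mul_le_mul_of_nonneg_left n1 (by linarith)).trans_lt ?_⟩
    · have : a * ε + b * ε = ε := by rw [← add_mul, hab, one_mul]
      linarith
    · linarith

/-- A curve that leaves `c 0` in the direction `v` stays, with a narrow neighbourhood, in any cone
around `v`. -/
lemma exists_mem_truncatedCone {c : ℝ → Plane} {v : Plane} (hv : ‖v‖ = 1) (hc : HasDerivAt c v 0)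
    {ε : ℝ} (hε : 0 < ε) : ∃ θ, 0 < θ ∧ θ ≤ 1 ∧ ∃ b > 0, ∀ u, 0 < u → u < b → ∀ y : Plane,
      ‖y‖ ≤ θ * u → c u + y ∈ truncatedCone (c 0) v ε := by
  -- The linearization error and `y` are each at most `m / 8 * u`, so the deviation from `u • v` is
  -- at most `m / 4 * u`, and `(1 - m) * (1 + m / 4) < 1 - m / 4`.
  set m := min ε 1 with hm
  have hm0 : 0 < m := lt_min hε one_pos
  have hm1 : m ≤ 1 := min_le_right _ _
  have h1 := (hasDerivAt_iff_isLittleO_nhds_zero.1 hc).bound (show 0 < m / 8 by positivity)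
  obtain ⟨b, hb, hball⟩ := Metric.eventually_nhds_iff.1 h1
  refine ⟨m / 8, by positivity, by linarith, min b (m / 2), lt_min hb (by positivity),
    fun u hu0 hu y hy => truncatedCone_mono _ _ (min_le_left ε 1) ?_⟩
  have hub := hu.trans_le (min_le_left _ _)
  have hum := hu.trans_le (min_le_right _ _)
  have h2 := hball (y := u) (by rwa [Real.dist_eq, sub_zero, abs_of_pos hu0])
  rw [zero_add, Real.norm_of_nonneg hu0.le] at h2
  set z := c u - c 0 - u • v + y with hz
  have hzn : ‖z‖ ≤ m / 4 * u := (norm_add_le _ _).trans (by linarith)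
  have e1 : c u + y - c 0 = u • v + z := by rw [hz]; abel
  have n1 : ‖u • v + z‖ ≤ u + m / 4 * u := by
    refine (norm_add_le _ _).trans ?_
    rw [norm_smul, hv, Real.norm_of_nonneg hu0.le, mul_one]
    linarith
  have n2 : -(m / 4 * u) ≤ inner ℝ z v := by
    have := abs_real_inner_le_norm z v
    rw [hv, mul_one] at this
    linarith [(abs_le.1 (this.trans hzn)).1]
  simp only [truncatedCone, mem_ofPred_eq, e1, inner_add_left, real_inner_smul_left,
    real_inner_self_eq_norm_sq, hv]
  rw [← hm]
  constructor
  · nlinarith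
  · refine (mul_le_mul_of_nonneg_left n1 (by linarith)).trans_lt ?_
    have := mul_pos hm0 hu0
    nlinarith

/-- A curve that leaves `c 0` in another direction than `v` avoids a cone around `v`. -/
lemma eventually_notMem_truncatedCone {c : ℝ → Plane} {v v' : Plane} (hv : ‖v‖ = 1)
    (hv' : ‖v'‖ = 1) (hne : v' ≠ v) (hc : HasDerivAt c v' 0) :
    ∀ᶠ q : ℝ × ℝ in 𝓝 (0, 0), 0 ≤ q.2 → c q.2 ∉ truncatedCone (c 0) v q.1 := by
  have ha : inner ℝ v' v < 1 :=
    lt_of_le_of_ne (by simpa [hv, hv'] using real_inner_le_norm v' v)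
      fun h => hne ((inner_eq_one_iff_of_norm_eq_one hv' hv).1 h)
  set a := inner ℝ v' v
  have ham : -1 ≤ a := by
    have := neg_le_of_abs_le (abs_real_inner_le_norm v' v)
    rwa [hv, hv', mul_one] at this
  -- Membership in a cone of aperture below `m` would give `(1 - m) ^ 2 < a + m`, that is `1 - a < 3
  -- * m - m ^ 2`, against `1 - a = 4 * m`.
  set m := (1 - a) / 4 with hm
  have hm0 : 0 < m := by linarith
  have h1 := (hasDerivAt_iff_isLittleO_nhds_zero.1 hc).bound hm0
  have h2 : ∀ᶠ ε : ℝ in 𝓝 0, ε < m := eventually_lt_nhds hm0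
  rw [nhds_prod_eq]
  filter_upwards [h2.prod_mk h1] with q hq hq0 hmem
  obtain ⟨hε, hu⟩ := hq
  have hmem := truncatedCone_mono _ _ hε.le hmem
  set u := q.2
  rw [zero_add, Real.norm_of_nonneg hq0] at hu
  set z := c u - c 0 - u • v' with hz
  have e1 : c u - c 0 = u • v' + z := by rw [hz]; abel
  have n1 : u - m * u ≤ ‖u • v' + z‖ := by
    have := norm_sub_le (u • v' + z) z
    rw [add_sub_cancel_right, norm_smul, hv', Real.norm_of_nonneg hq0, mul_one] at this
    linarith
  have n2 : inner ℝ z v ≤ m * u := by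
    have := real_inner_le_norm z v
    rw [hv, mul_one] at this
    exact this.trans hu
  have h3 := hmem.2
  rw [e1, inner_add_left, real_inner_smul_left] at h3
  have h4 := mul_le_mul_of_nonneg_left n1 (show 0 ≤ 1 - m by linarith)
  change (1 - m) * _ < u * a + _ at h3
  nlinarith [mul_nonneg hm0.le hq0, mul_nonneg (mul_nonneg hm0.le hm0.le) hq0]

namespace PlaneArc

lemma hasDerivAt_ext_affine (γ : PlaneArc) (s₀ σ : ℝ) :
    HasDerivAt (fun r => γ.ext (s₀ + σ * r)) (σ • γ.extTangent s₀) 0 := by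
  have hl : HasDerivAt (fun r : ℝ => s₀ + σ * r) σ 0 := by
    simpa using ((hasDerivAt_id (0 : ℝ)).const_mul σ).const_add s₀
  have := (γ.hasDerivAt_ext (s₀ + σ * 0)).scomp 0 hl
  rwa [mul_zero, add_zero] at this

/-- If the curve, run through from `s₀` in the direction `τ`, does not start in the direction `v`,
then it avoids a cone around `v`. -/
lemma eventually_ext_notMem (γ : PlaneArc) {s₀ τ : ℝ} (hτ : τ = 1 ∨ τ = -1) {v : Plane}
    (hv : ‖v‖ = 1) (hne : τ • γ.extTangent s₀ ≠ v) :
    ∀ᶠ q : ℝ × ℝ in 𝓝 (0, s₀), 0 ≤ τ * (q.2 - s₀) → γ.ext q.2 ∉ truncatedCone (γ.ext s₀) v q.1 := by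
  have h := eventually_notMem_truncatedCone hv (γ.norm_smul_self s₀ hτ) hne
    (γ.hasDerivAt_ext_affine s₀ τ)
  have ht : Tendsto (fun q : ℝ × ℝ => (q.1, τ * (q.2 - s₀))) (𝓝 (0, s₀)) (𝓝 (0, 0)) := by
    have hc : Continuous (fun q : ℝ × ℝ => (q.1, τ * (q.2 - s₀))) := by fun_prop
    have := hc.tendsto (0, s₀)
    simpa using this
  filter_upwards [ht.eventually h] with q hq h0
  have := hq h0
  have hττ : τ * τ = 1 := by rcases hτ with rfl | rfl <;> norm_num
  rw [← mul_assoc, hττ, one_mul, add_sub_cancel, mul_zero, add_zero] at this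
  exact this

end PlaneArc

namespace Pattern

variable {ι : Type*} {G : Pattern ι} {Ω : Set Plane}

/-- Two different parameters with the same image are end points, by simplicity of one curve or by
the meeting condition for two. Room to move in a direction identifies it as the one into the curve,
so the node condition applies. -/
lemma IsRegular.tangent_ne (hreg : G.IsRegular Ω) {i j : ι} {s t σ τ ρ ρ' : ℝ}
    (hs : s ∈ Icc 0 (G.arc i).length) (ht : t ∈ Icc 0 (G.arc j).length)
    (hσ : σ = 1 ∨ σ = -1) (hτ : τ = 1 ∨ τ = -1) (hρ : 0 < ρ) (hρ' : 0 < ρ')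
    (hsr : s + σ * ρ ∈ Icc 0 (G.arc i).length) (htr : t + τ * ρ' ∈ Icc 0 (G.arc j).length)
    (hst : (G.arc i).ext s = (G.arc j).ext t) (hne : ¬ (i = j ∧ s = t)) :
    τ • (G.arc j).extTangent t ≠ σ • (G.arc i).extTangent s := by
  have hst' := hst
  rw [(G.arc i).ext_eq hs, (G.arc j).ext_eq ht] at hst'
  have hends : (s = 0 ∨ s = (G.arc i).length) ∧ (t = 0 ∨ t = (G.arc j).length) := by
    by_cases hij : i = j
    · subst hij
      have hst2 : s ≠ t := fun h => hne ⟨rfl, h⟩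
      rcases hst2.lt_or_gt with h | h
      · have := (G.arc i).simple s hs t ht h hst'
        exact ⟨Or.inl this.1, Or.inr this.2⟩
      · have := (G.arc i).simple t ht s hs h hst'.symm
        exact ⟨Or.inr this.2, Or.inl this.1⟩
    · exact G.meet_at_ends i j hij s hs t ht hst'
  -- At an end point there is room on one side only, which fixes the sign `κ`.
  have key : ∀ (k : ι) (r κ d : ℝ), r ∈ Icc 0 (G.arc k).length → (κ = 1 ∨ κ = -1) → 0 < d →
      r + κ * d ∈ Icc 0 (G.arc k).length → (r = 0 ∨ r = (G.arc k).length) →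
      ∃ b, (G.arc k).endParam b = r ∧ (G.arc k).endTangent b = κ • (G.arc k).extTangent r := by
    intro k r κ d hr hκ hd hrd he
    rw [(G.arc k).extTangent_eq hr]
    have := (G.arc k).length_pos
    rcases he with rfl | rfl
    · refine ⟨false, rfl, ?_⟩
      rcases hκ with rfl | rfl
      · simp [PlaneArc.endTangent]
      · linarith [hrd.1]
    · refine ⟨true, rfl, ?_⟩
      rcases hκ with rfl | rfl
      · linarith [hrd.2]
      · simp [PlaneArc.endTangent]
  obtain ⟨b, hb1, hb2⟩ := key i s σ ρ hs hσ hρ hsr hends.1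
  obtain ⟨c, hc1, hc2⟩ := key j t τ ρ' ht hτ hρ' htr hends.2
  rw [← hb2, ← hc2]
  refine (hreg.nodes i j b c ?_ ?_).symm
  · intro h
    obtain ⟨rfl, rfl⟩ := Prod.mk.inj h
    exact hne ⟨rfl, hb1.symm.trans hc1⟩
  · rw [hb1, hc1, hst']

/-- A small cone around the direction of a curve at one of its points contains no other points of
the pattern than those of the curve right behind this point. -/
lemma IsRegular.eventually_cone_isolated [Finite ι] (hreg : G.IsRegular Ω) {i : ι} {s₀ σ ρ : ℝ}
    (hs : s₀ ∈ Icc 0 (G.arc i).length) (hσ : σ = 1 ∨ σ = -1) (hρ : 0 < ρ)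
    (hsr : s₀ + σ * ρ ∈ Icc 0 (G.arc i).length) {η : ℝ} (hη : 0 < η) :
    ∀ᶠ ε : ℝ in 𝓝 0, ∀ j, ∀ t ∈ Icc 0 (G.arc j).length,
      (G.arc j).ext t ∈ truncatedCone ((G.arc i).ext s₀) (σ • (G.arc i).extTangent s₀) ε →
        j = i ∧ 0 < σ * (t - s₀) ∧ σ * (t - s₀) < η := by
  rw [eventually_all]
  intro j
  set p := (G.arc i).ext s₀
  set v := σ • (G.arc i).extTangent s₀
  have hv : ‖v‖ = 1 := (G.arc i).norm_smul_self s₀ hσ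
  have hσ2 : σ * σ = 1 := by rcases hσ with rfl | rfl <;> norm_num
  suffices h : ∀ᶠ ε : ℝ in 𝓝 0, ∀ t ∈ Icc 0 (G.arc j).length, t ∈ Icc 0 (G.arc j).length →
      (G.arc j).ext t ∈ truncatedCone p v ε → j = i ∧ 0 < σ * (t - s₀) ∧ σ * (t - s₀) < η from
    h.mono fun ε hε t ht => hε t ht ht
  -- Compactness in `t` yields one aperture for the whole curve; this is why the avoidance lemmas
  -- are stated for aperture and parameter jointly near a point.
  refine isCompact_Icc.eventually_forall_of_forall_eventually fun t₀ ht₀ => ?_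
  by_cases hp : (G.arc j).ext t₀ = p
  swap
  · have h1 : 0 < ‖(G.arc j).ext t₀ - p‖ := norm_pos_iff.2 (sub_ne_zero.2 hp)
    have hc : Continuous fun q : ℝ × ℝ => ‖(G.arc j).ext q.2 - p‖ - q.1 := by
      have := (G.arc j).continuous_ext
      fun_prop
    have h2 := hc.continuousAt (x := (0, t₀)) |>.eventually_const_lt
      (show 0 < ‖(G.arc j).ext t₀ - p‖ - 0 by rwa [sub_zero])
    filter_upwards [h2] with q hq _ hmem
    linarith [hmem.1]
  · rw [← hp]
    by_cases hij : i = j ∧ s₀ = t₀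
    -- Near `s₀` itself the part of the curve behind `s₀` starts in direction `-v`, so it avoids the
    -- cone; only parameters ahead of `s₀` remain.
    · obtain ⟨rfl, rfl⟩ := hij
      have h1 := (G.arc i).eventually_ext_notMem (s₀ := s₀) (τ := -σ) (v := v)
        (by rcases hσ with rfl | rfl <;> simp) hv (by
          rw [neg_smul]
          exact fun h => by
            have h2 : (2 : ℝ) • v = 0 := by rw [two_smul]; nth_rewrite 1 [← h]; exact neg_add_cancel v
            have : v = 0 := (smul_eq_zero.1 h2).resolve_left two_ne_zero
            rw [this, norm_zero] at hv
            exact zero_ne_one hv)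
      have hc : Continuous fun q : ℝ × ℝ => σ * (q.2 - s₀) := by fun_prop
      have h2 := hc.continuousAt (x := (0, s₀)) |>.eventually_lt_const
        (show σ * (s₀ - s₀) < η by simpa using hη)
      filter_upwards [h1, h2] with q hq1 hq2 _ hmem
      refine ⟨rfl, ?_, hq2⟩
      by_contra hneg
      exact hq1 (by linarith) hmem
    -- Another passage through the vertex: both branches, as far as they exist, start in directions
    -- different from `v`.
    · have hdir : ∀ τ : ℝ, (τ = 1 ∨ τ = -1) → ∀ᶠ q : ℝ × ℝ in 𝓝 (0, t₀), 0 ≤ τ * (q.2 - t₀) →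
          q.2 ∈ Icc 0 (G.arc j).length → (G.arc j).ext q.2 ∉ truncatedCone ((G.arc j).ext t₀) v q.1 := by
        intro τ hτ
        by_cases hroom : ∃ ρ' > 0, t₀ + τ * ρ' ∈ Icc 0 (G.arc j).length
        · obtain ⟨ρ', hρ', htr⟩ := hroom
          filter_upwards [(G.arc j).eventually_ext_notMem hτ hv
            (hreg.tangent_ne hs ht₀ hσ hτ hρ hρ' hsr htr hp.symm hij)] with q hq h0 _
          exact hq h0
        -- Without room only the vertex is left, and it does not belong to the cone, which is
        -- defined by a strict inequality.
        · refine Eventually.of_forall fun q h0 hq hmem => ?_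
          rcases h0.eq_or_lt with h0 | h0
          · have : q.2 = t₀ := by
              rcases hτ with rfl | rfl <;> linarith
            rw [this] at hmem
            have := hmem.2
            simp at this
          · refine hroom ⟨_, h0, ?_⟩
            rwa [← mul_assoc, show τ * τ = 1 by rcases hτ with rfl | rfl <;> norm_num, one_mul,
              add_sub_cancel]
      filter_upwards [hdir 1 (Or.inl rfl), hdir (-1) (Or.inr rfl)] with q h1 h2 hq hmem
      rcases le_total t₀ q.2 with h | h
      · exact absurd hmem (h1 (by linarith) hq)
      · exact absurd hmem (h2 (by linarith) hq)

/-- A small cone around the direction of a curve at one of its points is contained in the domain. -/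
lemma IsRegular.exists_cone_subset (hreg : G.IsRegular Ω) (hΩ : IsOpen Ω)
    (hG : G.carrier ⊆ closure Ω) {i : ι} {s₀ σ ρ : ℝ}
    (hs : s₀ ∈ Icc 0 (G.arc i).length) (hσ : σ = 1 ∨ σ = -1) (hρ : 0 < ρ)
    (hsr : s₀ + σ * ρ ∈ Icc 0 (G.arc i).length) :
    ∃ ε > 0, truncatedCone ((G.arc i).ext s₀) (σ • (G.arc i).extTangent s₀) ε ⊆ Ω := by
  have hmemG : ∀ {s}, s ∈ Icc 0 (G.arc i).length → (G.arc i).ext s ∈ closure Ω := fun {s} hs =>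
    hG (mem_iUnion.2 ⟨i, s, hs, ((G.arc i).ext_eq hs).symm⟩)
  set p := (G.arc i).ext s₀ with hp
  set v := σ • (G.arc i).extTangent s₀ with hvdef
  have hv : ‖v‖ = 1 := (G.arc i).norm_smul_self s₀ hσ
  by_cases hpΩ : p ∈ Ω
  · obtain ⟨ε, hε, hball⟩ := Metric.isOpen_iff.1 hΩ p hpΩ
    exact ⟨ε, hε, fun x hx => hball (by rw [Metric.mem_ball, dist_eq_norm]; exact hx.1)⟩
  have hpf : p ∈ frontier Ω := by rw [hΩ.frontier_eq]; exact ⟨hmemG hs, hpΩ⟩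
  have hnt : NontangentialTo (frontier Ω) p v := by
    rw [hp, (G.arc i).ext_eq hs] at hpf
    obtain ⟨h1, h2⟩ := hreg.boundary i s₀ hs hpf
    rw [hp, hvdef, (G.arc i).ext_eq hs, (G.arc i).extTangent_eq hs]
    rcases hσ with rfl | rfl
    · rw [one_smul]; exact h1 (by linarith [hsr.2])
    · rw [neg_one_smul]; exact h2 (by linarith [hsr.1])
  obtain ⟨ε₀, hε₀, hnt⟩ := hnt
  refine ⟨min ε₀ 1, lt_min hε₀ one_pos, fun x hx => ?_⟩
  set K := truncatedCone p v (min ε₀ 1) with hK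
  -- This is nontangentiality. The curve enters the cone and lies in `closure Ω`, so a point of `Ω`
  -- is found in the cone, and connectedness does the rest.
  have hKf : ∀ y ∈ K, y ∉ frontier Ω := by
    intro y hy hyf
    have hy' := truncatedCone_mono _ _ (min_le_left ε₀ 1) hy
    refine absurd hy'.2 (not_lt.2 (hnt y hyf ?_ hy'.1))
    rintro rfl
    have := hy'.2
    simp at this
  obtain ⟨θ, hθ, -, b, hb, hcone⟩ := exists_mem_truncatedCone hv
    ((G.arc i).hasDerivAt_ext_affine s₀ σ) (lt_min hε₀ one_pos)
  set u := min ρ (b / 2) with hu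
  have hu0 : 0 < u := lt_min hρ (by positivity)
  have hq := hcone u hu0 ((min_le_right _ _).trans_lt (by linarith)) 0
    (by rw [norm_zero]; positivity)
  rw [add_zero, mul_zero, add_zero] at hq
  have hu1 : u ≤ ρ := min_le_left _ _
  have hsu : s₀ + σ * u ∈ Icc 0 (G.arc i).length := by
    rcases hσ with rfl | rfl <;> constructor <;> linarith [hs.1, hs.2, hsr.1, hsr.2]
  have hqΩ : (G.arc i).ext (s₀ + σ * u) ∈ Ω := by
    have h1 := hmemG hsu
    have h2 := hKf _ hq
    rw [hΩ.frontier_eq] at h2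
    by_contra h
    exact h2 ⟨h1, h⟩
  by_contra hxΩ
  have hcl : ∀ y ∈ K, y ∉ Ω → y ∉ closure Ω := fun y hy h1 h2 =>
    hKf y hy (by rw [hΩ.frontier_eq]; exact ⟨h2, h1⟩)
  obtain ⟨y, -, hy1, hy2⟩ := (convex_truncatedCone p v (min_le_right ε₀ 1)).isPreconnected Ω
    (closure Ω)ᶜ hΩ isClosed_closure.isOpen_compl
    (fun y hy => (em (y ∈ Ω)).imp_right (hcl y hy)) ⟨_, hq, hqΩ⟩ ⟨x, hx, hcl x hx hxΩ⟩
  exact hy2 (subset_closure hy1)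

end Pattern

/-! ### Functions on the pattern as traces of test functions -/

lemma IsTestFunction.comp_affine {a b s₀ σ : ℝ} {ψ : ℝ → ℝ} (hψ : IsTestFunction (Ioo a b) ψ)
    (hσ : σ = 1 ∨ σ = -1) {η : ℝ} (h : ∀ s ∈ Ioo a b, 0 < σ * (s - s₀) ∧ σ * (s - s₀) < η) :
    IsTestFunction (Ioo 0 η) (fun u => ψ (s₀ + σ * u)) := by
  have hσ2 : σ * σ = 1 := by rcases hσ with rfl | rfl <;> norm_num
  let e : ℝ ≃ₜ ℝ :=
    { toFun := fun u => s₀ + σ * u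
      invFun := fun s => σ * (s - s₀)
      left_inv := fun u => by
        change σ * (s₀ + σ * u - s₀) = u
        rw [add_sub_cancel_left, ← mul_assoc, hσ2, one_mul]
      right_inv := fun s => by
        change s₀ + σ * (σ * (s - s₀)) = s
        rw [← mul_assoc, hσ2, one_mul, add_sub_cancel]
      continuous_toFun := by fun_prop
      continuous_invFun := by fun_prop }
  refine ⟨hψ.contDiff.comp (by fun_prop), hψ.hasCompactSupport.comp_homeomorph e, fun u hu => ?_⟩
  have h1 : u ∈ e ⁻¹' tsupport ψ := by
    rw [← tsupport_comp_eq_preimage ψ e]; exact hu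
  have h2 := h _ (hψ.tsupport_subset h1)
  have h3 : σ * (e u - s₀) = u := e.left_inv u
  rwa [h3] at h2

lemma exists_test_eq_one {Ω K : Set Plane} (hΩ : IsOpen Ω) (hK : IsClosed K) {p : Plane}
    (hp : p ∈ Ω) (hpK : p ∉ K) : ∃ χ, IsTestFunction Ω χ ∧ χ p = 1 ∧ ∀ x ∈ K, χ x = 0 := by
  obtain ⟨χ, h1, h2, h3, -, h5⟩ := exists_contDiff_tsupport_subset (n := ⊤)
    ((hΩ.sdiff hK).mem_nhds ⟨hp, hpK⟩)
  refine ⟨χ, ⟨h3, h2, h1.trans sdiff_subset⟩, h5, fun x hx => ?_⟩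
  exact image_eq_zero_of_notMem_tsupport fun h => (h1 h).2 hx

/-- Points are corrected one at a time by a test function that vanishes at those already treated. At
points outside `Ω` every test function is `0`, whence the condition on `A`. -/
lemma exists_test_eq_on_finset {Ω : Set Plane} (hΩ : IsOpen Ω) (N : Finset Plane) (A : Plane → ℝ)
    (hA : ∀ p ∈ N, p ∉ Ω → A p = 0) : ∃ χ, IsTestFunction Ω χ ∧ ∀ p ∈ N, χ p = A p := by
  classical
  induction N using Finset.induction_on with
  | empty => exact ⟨fun _ => 0, IsTestFunction.zero, by simp⟩
  | insert p N hp ih =>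
    obtain ⟨χ, h1, h2⟩ := ih fun q hq => hA q (Finset.mem_insert_of_mem hq)
    by_cases hpΩ : p ∈ Ω
    · obtain ⟨ξ, k1, k2, k3⟩ := exists_test_eq_one hΩ N.finite_toSet.isClosed hpΩ hp
      refine ⟨_, h1.add (k1.const_mul (A p - χ p)), fun q hq => ?_⟩
      rcases Finset.mem_insert.1 hq with rfl | hq
      · rw [k2]; ring
      · rw [k3 q hq, h2 q hq]; ring
    · refine ⟨χ, h1, fun q hq => ?_⟩
      rcases Finset.mem_insert.1 hq with rfl | hq
      · rw [h1.eq_zero hpΩ, hA q (Finset.mem_insert_self _ _) hpΩ]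
      · exact h2 q hq

/-- The tangential derivative depends only on the restriction to the curve, so the curve part of the
energy is determined by the trace. -/
lemma setLIntegral_arc_fderiv_congr {f : Plane → ℝ} (hf : ContDiff ℝ 1 f) (γ : PlaneArc) {h : ℝ → ℝ}
    (hfh : ∀ s ∈ Icc 0 γ.length, f (γ.ext s) = h s) :
    ∫⁻ s in Icc 0 γ.length, ‖fderiv ℝ f (γ.ext s) (γ.extTangent s)‖ₑ ^ 2 =
      ∫⁻ s in Icc 0 γ.length, ‖deriv h s‖ₑ ^ 2 := by
  rw [restrict_Icc_eq_Ioo]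
  refine setLIntegral_congr_fun measurableSet_Ioo fun s hs => ?_
  have h1 : HasDerivAt (fun s => f (γ.ext s)) (fderiv ℝ f (γ.ext s) (γ.extTangent s)) s :=
    ((hf.differentiable (by norm_num)) _).hasFDerivAt.comp_hasDerivAt s (γ.hasDerivAt_ext s)
  have h2 : (fun s => f (γ.ext s)) =ᶠ[𝓝 s] h := by
    filter_upwards [Icc_mem_nhds hs.1 hs.2] with t ht using hfh t ht
  rw [← h2.deriv_eq, h1.deriv]

/-! ### From short pieces of one curve to the whole pattern. -/

section Gluing

variable {ι : Type*} [Fintype ι] {Ω : Set Plane} {G : Pattern ι}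

/-- `H¹` functions on the part `[a, b]` of the curve `i` that vanish at `a`, `b` and on the
boundary of the domain, extended by zero, are traces of test functions. -/
def TraceApproxOn (Ω : Set Plane) (G : Pattern ι) (i : ι) (a b : ℝ) : Prop :=
  ∀ W D, SobolevOn a b W D → W a = 0 → W b = 0 →
    (∀ s ∈ Icc a b, (G.arc i).ext s ∈ frontier Ω → W s = 0) →
    TraceApprox Ω G fun j => {s | j = i ∧ s ∈ Icc a b}.indicator W

lemma traceApproxOn_of_le (i : ι) {a b : ℝ} (h : b ≤ a) : TraceApproxOn Ω G i a b := by
  intro W D _ ha _ _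
  refine (TraceApprox.of_test (Ω := Ω) (G := G) (φ := fun _ => 0) IsTestFunction.zero).congr
    fun j s _ => ?_
  refine (indicator_apply_eq_zero.2 fun hs => ?_).symm
  have : s = a := le_antisymm (hs.2.2.trans h) hs.2.1
  rw [this, ha]

/-- The local form of the extension. -/
lemma Pattern.IsRegular.exists_traceApproxOn (hreg : G.IsRegular Ω) (hΩ : IsOpen Ω)
    (hG : G.carrier ⊆ closure Ω) {i : ι} {s₀ σ ρ : ℝ}
    (hs : s₀ ∈ Icc 0 (G.arc i).length) (hσ : σ = 1 ∨ σ = -1) (hρ : 0 < ρ)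
    (hsr : s₀ + σ * ρ ∈ Icc 0 (G.arc i).length) :
    ∃ η > 0, ∀ a b, 0 ≤ a → b ≤ (G.arc i).length →
      (∀ s ∈ Icc a b, 0 ≤ σ * (s - s₀) ∧ σ * (s - s₀) < η) → TraceApproxOn Ω G i a b := by
  set v := σ • (G.arc i).extTangent s₀ with hvdef
  have hσ2 : σ * σ = 1 := by rcases hσ with rfl | rfl <;> norm_num
  have hv : ‖v‖ = 1 := (G.arc i).norm_smul_self s₀ hσ
  obtain ⟨η₁, hη₁, c, T, hc, hT, hcγ⟩ := (G.arc i).exists_graphCurve s₀ σ hσ hv (κ := 1 / 2)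
    (by norm_num) (by rw [(G.arc i).inner_smul_self s₀ hσ]; norm_num)
  have hc0 : c 0 = (G.arc i).ext s₀ := by
    rw [hcγ 0 (by simpa using hη₁.le), mul_zero, add_zero]
  obtain ⟨ε₁, hε₁, hcone⟩ := hreg.exists_cone_subset hΩ hG hs hσ hρ hsr
  -- The isolation radius `η₁` is the range on which `c` coincides with the arc, so every pattern
  -- point in the cone has the form `c u` with `u` in that range.
  obtain ⟨ε, ⟨hiso, hεε⟩, hε⟩ := (((hreg.eventually_cone_isolated hs hσ hρ hsr hη₁).and
    (eventually_le_nhds hε₁)).filter_mono nhdsWithin_le_nhds |>.and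
    (eventually_mem_nhdsWithin (a := (0 : ℝ)) (s := Ioi 0))).exists
  obtain ⟨θ, hθ, hθ1, η₂, hη₂, hmem⟩ := exists_mem_truncatedCone hv
    (by have := hc.hasDerivAt 0; rwa [hT] at this) hε
  rw [hc0] at hmem
  set η := min η₁ η₂ with hη
  have hη0 : 0 < η := lt_min hη₁ hη₂
  obtain ⟨C, hC⟩ := hc.exists_cone_extension hθ hθ1 hη0
  refine ⟨η, hη0, fun a b ha hb hside => ?_⟩
  rcases le_or_gt b a with hab | hab
  · exact traceApproxOn_of_le i hab
  intro W D hW hWa hWb _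
  obtain ⟨M, hM⟩ := hW.exists_test_near hab hWa hWb
  have hside' : ∀ s ∈ Ioo a b, 0 < σ * (s - s₀) ∧ σ * (s - s₀) < η := by
    intro s hs
    refine ⟨?_, (hside s (Ioo_subset_Icc_self hs)).2⟩
    have h1 := (hside a (left_mem_Icc.2 hab.le)).1
    have h2 := (hside b (right_mem_Icc.2 hab.le)).1
    rcases hσ with rfl | rfl <;> linarith [hs.1, hs.2]
  -- The plane part of the energy is at most `C * M` by the cone extension; each curve contributes
  -- at most `M`, the energy of `ψ`.
  refine TraceApprox.of_contDiff hΩ (C * M + Fintype.card ι * M) fun δ hδ => ?_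
  obtain ⟨ψ, hψ, hψM, hψW⟩ := hM δ hδ
  obtain ⟨f, hf, hfc, hfψ, hfs, hfE⟩ := hC _ (hψ.comp_affine hσ hside')
  have hfcone : tsupport f ⊆ truncatedCone ((G.arc i).ext s₀) v ε := by
    intro x hx
    obtain ⟨u, t, hu, ht, rfl⟩ := hfs x hx
    refine hmem u hu.1 (hu.2.trans_le (min_le_right _ _)) _ ?_
    rwa [norm_smul, hc.norm_J, mul_one]
  -- The support of `f` lies in the isolating cone, so `f` vanishes on all other curves and equals
  -- `ψ` on this piece.
  have htrace : ∀ j, ∀ s ∈ Icc 0 (G.arc j).length,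
      f ((G.arc j).ext s) = {s | j = i ∧ s ∈ Icc a b}.indicator ψ s := by
    intro j s hsj
    by_cases hx : (G.arc j).ext s ∈ tsupport f
    · obtain ⟨rfl, h1, h2⟩ := hiso j s hsj (hfcone hx)
      have e1 : s = s₀ + σ * (σ * (s - s₀)) := by
        rw [← mul_assoc, hσ2, one_mul, add_sub_cancel]
      have e2 : f ((G.arc j).ext s) = ψ s := by
        rw [e1, ← hcγ _ (by rw [abs_of_pos h1]; exact h2.le), hfψ, ← e1]
      rw [e2]
      by_cases hs : s ∈ Icc a b
      · rw [indicator_of_mem (show s ∈ {s | j = j ∧ s ∈ Icc a b} from ⟨rfl, hs⟩)]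
      · rw [indicator_of_notMem (fun h => hs h.2)]
        exact hψ.eq_zero fun h => hs (Ioo_subset_Icc_self h)
    · rw [image_eq_zero_of_notMem_tsupport hx]
      symm
      refine indicator_apply_eq_zero.2 fun ⟨hji, hs⟩ => ?_
      subst hji
      by_contra hψs
      have hs' : s ∈ Ioo a b := by
        by_contra h
        exact hψs (hψ.eq_zero h)
      have h1 := hside' s hs'
      have e1 : s = s₀ + σ * (σ * (s - s₀)) := by
        rw [← mul_assoc, hσ2, one_mul, add_sub_cancel]
      have e2 : f ((G.arc j).ext s) = ψ s := by
        rw [e1, ← hcγ _ (by rw [abs_of_pos h1.1]; exact h1.2.le.trans (min_le_left _ _)), hfψ, ← e1]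
      exact hψs (by rw [← e2]; exact image_eq_zero_of_notMem_tsupport hx)
  refine ⟨f, hf, hfc, (hfcone.trans (truncatedCone_mono _ _ hεε)).trans hcone, ?_, fun j => ?_⟩
  · rw [energy]
    push_cast
    refine add_le_add (hfE.trans ?_) ?_
    · gcongr
      refine le_trans (le_of_eq ?_) hψM
      rw [← lintegral_comp_affine (fun s => ‖deriv ψ s‖ₑ ^ 2) s₀ hσ]
      refine lintegral_congr fun u => ?_
      have h1 : HasDerivAt (fun u => ψ (s₀ + σ * u)) (deriv ψ (s₀ + σ * u) * σ) u := by
        have hl : HasDerivAt (fun r : ℝ => s₀ + σ * r) σ u := by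
          simpa using ((hasDerivAt_id u).const_mul σ).const_add s₀
        exact ((hψ.contDiff_one.differentiable (by norm_num)) _).hasDerivAt.comp u hl
      rw [h1.deriv, enorm_mul]
      rcases hσ with rfl | rfl <;> simp
    · have hj : ∀ j, ∫⁻ s in Icc 0 (G.arc j).length,
          ‖fderiv ℝ f ((G.arc j).ext s) ((G.arc j).extTangent s)‖ₑ ^ 2 ≤ M := by
        intro j
        by_cases hji : j = i
        · rw [setLIntegral_arc_fderiv_congr hf (G.arc j) (h := ψ)]
          · exact (setLIntegral_le_lintegral _ _).trans hψM
          · intro s hs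
            rw [htrace j s hs]
            refine indicator_apply_eq_self.2 fun h => ?_
            exact hψ.eq_zero fun h' => h ⟨hji, Ioo_subset_Icc_self h'⟩
        · rw [setLIntegral_arc_fderiv_congr hf (G.arc j) (h := fun _ => 0)]
          · simp
          · intro s hs
            rw [htrace j s hs]
            exact indicator_of_notMem (fun h => hji h.1) _
      exact (Finset.sum_le_card_nsmul _ _ _ fun j _ => hj j).trans_eq (by simp)
  · refine le_trans ?_ hψW
    rw [setLIntegral_congr_fun (g := (Icc a b).indicator fun s =>
      ‖{s | j = i ∧ s ∈ Icc a b}.indicator (fun s => ψ s - W s) s‖ₑ ^ 2) measurableSet_Icc]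
    · refine (setLIntegral_le_lintegral _ _).trans ?_
      rw [lintegral_indicator measurableSet_Icc]
      refine lintegral_mono fun s => ?_
      refine pow_le_pow_left₀ zero_le ?_ 2
      exact enorm_indicator_le_enorm_self _ _
    · intro s _
      simp only [htrace j s ‹_›]
      by_cases h : s ∈ {s | j = i ∧ s ∈ Icc a b}
      · simp only [indicator_of_mem h, indicator_of_mem h.2]
      · rw [indicator_of_notMem h, indicator_of_notMem h]
        by_cases hs : s ∈ Icc a b
        · rw [indicator_of_mem hs, indicator_of_notMem h, sub_zero]
        · rw [indicator_of_notMem hs]; simp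

lemma measurable_indicator_arc {ι : Type*} {i j : ι} {a b : ℝ} {W : ℝ → ℝ} (hW : ContinuousOn W (Icc a b)) :
    Measurable ({s | j = i ∧ s ∈ Icc a b}.indicator W) := by
  classical
  by_cases h : j = i
  · have : {s | j = i ∧ s ∈ Icc a b} = Icc a b := by ext; simp [h]
    rw [this, ← piecewise_eq_indicator]
    exact hW.measurable_piecewise continuousOn_const measurableSet_Icc
  · have : {s | j = i ∧ s ∈ Icc a b} = ∅ := by ext; simp [h]
    rw [this, indicator_empty]
    exact measurable_const

lemma IsTestFunction.sobolevOn_ext {χ : Plane → ℝ} (hχ : IsTestFunction Ω χ) (γ : PlaneArc)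
    (a b : ℝ) : SobolevOn a b (fun s => χ (γ.ext s))
      (fun s => fderiv ℝ χ (γ.ext s) (γ.extTangent s)) :=
  SobolevOn.of_hasDerivAt (fun s =>
    ((hχ.contDiff_one.differentiable (by norm_num)) _).hasFDerivAt.comp_hasDerivAt s
      (γ.hasDerivAt_ext s)) (continuous_arc_fderiv hχ.contDiff_one γ)

/-- A test function `χ` with the value `W c` at the joint, zero on the pattern outside the open
piece `(a, b)`, is subtracted. The difference vanishes at `a`, `c` and `b`, so it splits into
functions to which the two hypotheses apply. If the joint is not in `Ω` it lies on `∂Ω`, where `W`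
vanishes already, and `χ = 0` will do. -/
lemma TraceApproxOn.glue {i : ι} {a c b : ℝ} (hΩ : IsOpen Ω) (hG : G.carrier ⊆ closure Ω)
    (h1 : TraceApproxOn Ω G i a c) (h2 : TraceApproxOn Ω G i c b) (ha : 0 ≤ a)
    (hb : b ≤ (G.arc i).length) (hac : a ≤ c) (hcb : c ≤ b) : TraceApproxOn Ω G i a b := by
  rcases hac.eq_or_lt with rfl | hac
  · exact h2
  rcases hcb.eq_or_lt with rfl | hcb
  · exact h1
  intro W D hW hWa hWb hWf
  have hcl : c ∈ Icc 0 (G.arc i).length := ⟨ha.trans hac.le, hcb.le.trans hb⟩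
  obtain ⟨χ, hχ, hχc, hχ0⟩ : ∃ χ, IsTestFunction Ω χ ∧ χ ((G.arc i).ext c) = W c ∧
      ∀ j, ∀ s ∈ Icc 0 (G.arc j).length, ¬ (j = i ∧ s ∈ Ioo a b) → χ ((G.arc j).ext s) = 0 := by
    by_cases hp : (G.arc i).ext c ∈ Ω
    swap
    · refine ⟨fun _ => 0, IsTestFunction.zero, ?_, fun _ _ _ _ => rfl⟩
      symm
      refine hWf c ⟨hac.le, hcb.le⟩ ?_
      rw [hΩ.frontier_eq]
      exact ⟨hG (mem_iUnion.2 ⟨i, c, hcl, ((G.arc i).ext_eq hcl).symm⟩), hp⟩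
    · let K : Set Plane := ⋃ j, (G.arc j).ext '' (Icc 0 (G.arc j).length ∩ {s | ¬ (j = i ∧ s ∈ Ioo a b)})
      have hK : IsClosed K := by
        refine isClosed_iUnion_of_finite fun j => ?_
        refine (IsCompact.image ?_ (G.arc j).continuous_ext).isClosed
        refine isCompact_Icc.inter_right ?_
        by_cases hji : j = i
        · simp only [hji, true_and]; exact isOpen_Ioo.isClosed_compl
        · simp [hji]
      -- The joint is interior to the parameter interval, and interior points of a curve are met by
      -- no other parameter and no other curve.
      have hpK : (G.arc i).ext c ∉ K := by
        intro hmem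
        obtain ⟨j, s, ⟨hs, hs2⟩, hsc⟩ := mem_iUnion.1 hmem
        rw [(G.arc j).ext_eq hs, (G.arc i).ext_eq hcl] at hsc
        by_cases hji : j = i
        · subst hji
          rcases lt_trichotomy s c with h | h | h
          · have := ((G.arc j).simple s hs c hcl h hsc).2
            linarith
          · exact hs2 ⟨rfl, by rw [h]; exact ⟨hac, hcb⟩⟩
          · have := ((G.arc j).simple c hcl s hs h hsc.symm).1
            linarith
        · rcases (G.meet_at_ends j i hji s hs c hcl hsc).2 with h | h <;> linarith
      obtain ⟨χ, k1, k2, k3⟩ := exists_test_eq_one hΩ hK hp hpK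
      refine ⟨_, k1.const_mul (W c), ?_, fun j s hs hn => ?_⟩
      · rw [k2, mul_one]
      · rw [k3 _ (mem_iUnion.2 ⟨j, s, ⟨hs, hn⟩, rfl⟩), mul_zero]
  set V : ℝ → ℝ := fun s => W s - χ ((G.arc i).ext s) with hV
  have hVs : SobolevOn a b V _ := hW.sub (hχ.sobolevOn_ext (G.arc i) a b)
  have hVc : V c = 0 := by rw [hV]; simp only [hχc, sub_self]
  have hVa : V a = 0 := by
    rw [hV]; simp only
    rw [hWa, hχ0 i a ⟨ha, by linarith⟩ (by simp), sub_zero]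
  have hVb : V b = 0 := by
    rw [hV]; simp only
    rw [hWb, hχ0 i b ⟨by linarith, hb⟩ (by simp), sub_zero]
  have hVf : ∀ s ∈ Icc a b, (G.arc i).ext s ∈ frontier Ω → V s = 0 := by
    intro s hs hsf
    rw [hV]; simp only
    rw [hWf s hs hsf, hχ.eq_zero (fun h => ?_), sub_zero]
    rw [hΩ.frontier_eq] at hsf
    exact hsf.2 h
  have t1 := h1 V _ (hVs.mono le_rfl hcb.le) hVa hVc fun s hs => hVf s ⟨hs.1, hs.2.trans hcb.le⟩
  have t2 := h2 V _ (hVs.mono hac.le le_rfl) hVc hVb fun s hs => hVf s ⟨hac.le.trans hs.1, hs.2⟩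
  have hVC := hVs.continuousOn
  refine ((t1.add t2 fun j => measurable_indicator_arc
    (hVC.mono (Icc_subset_Icc_right hcb.le))).add (TraceApprox.of_test hχ) fun j =>
    (measurable_indicator_arc (hVC.mono (Icc_subset_Icc_right hcb.le))).add
    (measurable_indicator_arc (hVC.mono (Icc_subset_Icc_left hac.le)))).congr fun j s hs => ?_
  by_cases hj : j = i
  · subst hj
    simp only [true_and]
    by_cases hsab : s ∈ Icc a b
    · have e1 : s ∈ {s | s ∈ Icc a b} := hsab
      rw [indicator_of_mem e1]
      rcases lt_trichotomy s c with h | h | h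
      · rw [indicator_of_mem (show s ∈ {s | s ∈ Icc a c} from ⟨hsab.1, h.le⟩),
          indicator_of_notMem (show s ∉ {s | s ∈ Icc c b} from fun h' => not_le.2 h h'.1), hV]
        ring
      · rw [h, indicator_apply_eq_zero.2 fun _ => hVc, indicator_apply_eq_zero.2 fun _ => hVc, hχc]
        ring
      · rw [indicator_of_mem (show s ∈ {s | s ∈ Icc c b} from ⟨h.le, hsab.2⟩),
          indicator_of_notMem (show s ∉ {s | s ∈ Icc a c} from fun h' => not_le.2 h h'.2), hV]
        ring
    · rw [indicator_of_notMem (show s ∉ {s | s ∈ Icc a b} from hsab),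
        indicator_of_notMem (show s ∉ {s | s ∈ Icc a c} from fun h => hsab ⟨h.1, h.2.trans hcb.le⟩),
        indicator_of_notMem (show s ∉ {s | s ∈ Icc c b} from fun h => hsab ⟨hac.le.trans h.1, h.2⟩),
        hχ0 j s hs fun h => hsab (Ioo_subset_Icc_self h.2)]
      simp
  · rw [indicator_of_notMem (fun h => hj h.1), indicator_of_notMem (fun h => hj h.1),
      indicator_of_notMem (fun h => hj h.1), hχ0 j s hs fun h => hj h.1]
    simp

/-- Around each `s₀` the forward and the backward cone handle intervals on either side, and gluing
at `s₀` handles those that contain it. A partition of the curve subordinate to these neighbourhoods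
is then glued step by step. -/
lemma Pattern.IsRegular.traceApproxOn (hreg : G.IsRegular Ω) (hΩ : IsOpen Ω)
    (hG : G.carrier ⊆ closure Ω) (i : ι) : TraceApproxOn Ω G i 0 (G.arc i).length := by
  set l := (G.arc i).length with hl
  have hlpos : 0 < l := (G.arc i).length_pos
  have hloc : ∀ s₀ ∈ Icc 0 l, ∃ δ > 0, ∀ a b, 0 ≤ a → b ≤ l → s₀ - δ < a → b < s₀ + δ →
      TraceApproxOn Ω G i a b := by
    intro s₀ hs₀
    obtain ⟨δ₁, hδ₁, hr⟩ : ∃ δ > 0, ∀ a b, s₀ ≤ a → b ≤ l → b < s₀ + δ →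
        TraceApproxOn Ω G i a b := by
      rcases hs₀.2.lt_or_eq with h | h
      · obtain ⟨η, hη, hgood⟩ := hreg.exists_traceApproxOn hΩ hG hs₀ (Or.inl rfl)
          (sub_pos.2 h) (by rw [one_mul, add_sub_cancel]; exact right_mem_Icc.2 hlpos.le)
        exact ⟨η, hη, fun a b ha hb hbη => hgood a b (hs₀.1.trans ha) hb fun s hs =>
          ⟨by linarith [hs.1], by linarith [hs.2]⟩⟩
      · exact ⟨1, one_pos, fun a b ha hb _ => traceApproxOn_of_le i (by linarith)⟩
    obtain ⟨δ₂, hδ₂, hle⟩ : ∃ δ > 0, ∀ a b, 0 ≤ a → b ≤ s₀ → s₀ - δ < a →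
        TraceApproxOn Ω G i a b := by
      rcases hs₀.1.lt_or_eq with h | h
      · obtain ⟨η, hη, hgood⟩ := hreg.exists_traceApproxOn hΩ hG hs₀ (Or.inr rfl)
          h (by rw [neg_one_mul, add_neg_cancel]; exact left_mem_Icc.2 hlpos.le)
        exact ⟨η, hη, fun a b ha hb hbη => hgood a b ha (hb.trans hs₀.2) fun s hs =>
          ⟨by linarith [hs.2], by linarith [hs.1]⟩⟩
      · exact ⟨1, one_pos, fun a b ha hb _ => traceApproxOn_of_le i (by linarith)⟩
    refine ⟨min δ₁ δ₂, lt_min hδ₁ hδ₂, fun a b ha hb h1 h2 => ?_⟩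
    have m1 := min_le_left δ₁ δ₂
    have m2 := min_le_right δ₁ δ₂
    rcases le_total s₀ a with h | h
    · exact hr a b h hb (by linarith)
    rcases le_total b s₀ with h' | h'
    · exact hle a b ha h' (by linarith)
    exact (hle a s₀ ha le_rfl (by linarith)).glue hΩ hG (hr s₀ b le_rfl hb (by linarith)) ha hb h h'
  choose! δ hδ hgood using hloc
  obtain ⟨t, ht0, htm, ⟨m, hm⟩, htc⟩ := exists_monotone_Icc_subset_open_cover_Icc hlpos.le
    (c := fun s₀ : Icc 0 l => {s : Icc 0 l | |(s : ℝ) - s₀| < δ s₀})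
    (fun s₀ => isOpen_lt (by fun_prop) continuous_const)
    (fun s _ => mem_iUnion.2 ⟨s, by simpa using hδ s s.2⟩)
  have hind : ∀ n, TraceApproxOn Ω G i 0 (t n) := by
    intro n
    induction n with
    | zero => rw [ht0]; exact traceApproxOn_of_le i le_rfl
    | succ n ih =>
      have hmono : (t n : ℝ) ≤ t (n + 1) := htm (Nat.le_succ n)
      refine ih.glue hΩ hG ?_ le_rfl (t (n + 1)).2.2 (t n).2.1 hmono
      obtain ⟨s₀, hsub⟩ := htc n
      have k1 : |(t n : ℝ) - s₀| < δ s₀ := hsub (left_mem_Icc.2 (htm (Nat.le_succ n)))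
      have k2 : |(t (n + 1) : ℝ) - s₀| < δ s₀ := hsub (right_mem_Icc.2 (htm (Nat.le_succ n)))
      rw [abs_lt] at k1 k2
      exact hgood s₀ s₀.2 _ _ (t n).2.1 (t (n + 1)).2.2 (by linarith) (by linarith)
  have := hind m
  rwa [hm m le_rfl] at this

/-- Compatible `H¹` functions on the pattern are traces of test functions, with bounded energy. -/
theorem Pattern.IsRegular.traceApprox (hreg : G.IsRegular Ω) (hΩ : IsOpen Ω)
    (hG : G.carrier ⊆ closure Ω) {W dW : ι → ℝ → ℝ}
    (hW : ∀ i, SobolevOn 0 (G.arc i).length (W i) (dW i))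
    (hmatch : ∀ i j, ∀ s ∈ Icc 0 (G.arc i).length, ∀ t ∈ Icc 0 (G.arc j).length,
      (G.arc i).toFun s = (G.arc j).toFun t → W i s = W j t)
    (hzero : ∀ i, ∀ s ∈ Icc 0 (G.arc i).length, (G.arc i).toFun s ∈ frontier Ω → W i s = 0) :
    TraceApprox Ω G W := by
  classical
  -- By the matching condition the functions on the curves come from one function on the carrier;
  -- its value elsewhere is irrelevant.
  obtain ⟨A, hA⟩ : ∃ A : Plane → ℝ, ∀ i, ∀ s ∈ Icc 0 (G.arc i).length, A ((G.arc i).ext s) = W i s := by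
    refine ⟨fun p => if h : ∃ q : ι × ℝ, q.2 ∈ Icc 0 (G.arc q.1).length ∧
      (G.arc q.1).toFun q.2 = p then W h.choose.1 h.choose.2 else 0, fun i s hs => ?_⟩
    have h : ∃ q : ι × ℝ, q.2 ∈ Icc 0 (G.arc q.1).length ∧
      (G.arc q.1).toFun q.2 = (G.arc i).ext s := ⟨(i, s), hs, ((G.arc i).ext_eq hs).symm⟩
    beta_reduce
    rw [dif_pos h]
    exact hmatch _ _ _ h.choose_spec.1 s hs (h.choose_spec.2.trans ((G.arc i).ext_eq hs))
  let N : Finset Plane := (Finset.univ.image fun i => (G.arc i).ext 0) ∪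
    Finset.univ.image fun i => (G.arc i).ext (G.arc i).length
  have h0 : ∀ i, (0 : ℝ) ∈ Icc 0 (G.arc i).length := fun i => left_mem_Icc.2 (G.arc i).length_pos.le
  have hl : ∀ i, (G.arc i).length ∈ Icc 0 (G.arc i).length :=
    fun i => right_mem_Icc.2 (G.arc i).length_pos.le
  have hf : ∀ i, ∀ s ∈ Icc 0 (G.arc i).length, (G.arc i).ext s ∉ Ω → W i s = 0 := by
    intro i s hs hn
    refine hzero i s hs ?_
    rw [hΩ.frontier_eq]
    rw [(G.arc i).ext_eq hs] at hn
    exact ⟨hG (mem_iUnion.2 ⟨i, s, hs, rfl⟩), hn⟩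
  -- After subtraction of the traces of `χ` the remainders vanish at all nodes, so each can be
  -- extended by zero to the other curves and treated separately.
  obtain ⟨χ, hχ, hχN⟩ := exists_test_eq_on_finset hΩ N A fun p hp hpΩ => by
    simp only [N, Finset.mem_union, Finset.mem_image, Finset.mem_univ, true_and] at hp
    rcases hp with ⟨i, rfl⟩ | ⟨i, rfl⟩
    · rw [hA i _ (h0 i)]; exact hf i _ (h0 i) hpΩ
    · rw [hA i _ (hl i)]; exact hf i _ (hl i) hpΩ
  set V : ι → ℝ → ℝ := fun i s => W i s - χ ((G.arc i).ext s) with hV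
  have hVs : ∀ i, SobolevOn 0 (G.arc i).length (V i) _ := fun i =>
    (hW i).sub (hχ.sobolevOn_ext (G.arc i) _ _)
  have hV0 : ∀ i, V i 0 = 0 := fun i => by
    rw [hV]; simp only
    rw [hχN _ (by simp [N]), hA i _ (h0 i), sub_self]
  have hVl : ∀ i, V i (G.arc i).length = 0 := fun i => by
    rw [hV]; simp only
    rw [hχN _ (by simp [N]), hA i _ (hl i), sub_self]
  have hi : ∀ i, TraceApprox Ω G fun j => {s | j = i ∧ s ∈ Icc 0 (G.arc i).length}.indicator (V i) := by
    intro i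
    refine hreg.traceApproxOn hΩ hG i (V i) _ (hVs i) (hV0 i) (hVl i) fun s hs hsf => ?_
    rw [hΩ.frontier_eq] at hsf
    rw [hV]; simp only
    rw [hf i s hs hsf.2, hχ.eq_zero hsf.2, sub_zero]
  refine ((TraceApprox.of_test hχ).add (TraceApprox.sum Finset.univ (fun i _ => hi i) fun i _ j =>
    measurable_indicator_arc (hVs i).continuousOn) fun i =>
    (hχ.contDiff.continuous.comp (G.arc i).continuous_ext).measurable).congr fun j s hs => ?_
  rw [Finset.sum_eq_single j]
  · rw [indicator_of_mem (show s ∈ {s | j = j ∧ s ∈ Icc 0 (G.arc j).length} from ⟨rfl, hs⟩), hV]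
    ring
  · intro i _ hij
    exact indicator_of_notMem (fun h => hij h.1.symm) _
  · simp

end Gluing

/-! ### Bounded approximation -/

section Bounded

variable {ι : Type*} [Fintype ι] {Ω : Set Plane} {G : Pattern ι}

lemma Pattern.exists_strip_le (G : Pattern ι) : ∃ C : ℝ≥0, ∃ δ₀ > 0, ∀ ψ : Plane → ℝ, ContDiff ℝ 1 ψ →
    ∀ δ, 0 < δ → δ < δ₀ → ∀ a K : ℝ≥0∞,
      (∀ i, ∫⁻ s in Icc 0 (G.arc i).length, ‖ψ ((G.arc i).ext s)‖ₑ ^ 2 ≤ a) →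
      ∫⁻ x, ‖fderiv ℝ ψ x‖ₑ ^ 2 ≤ K →
      ∫⁻ x in Metric.thickening δ (⋃ i, (G.arc i).ext '' Icc 0 (G.arc i).length), ‖ψ x‖ₑ ^ 2 ≤
        C * (ENNReal.ofReal δ * a + ENNReal.ofReal (δ ^ 2) * K) := by
  choose C δ₀ hδ₀ h using fun i => (G.arc i).exists_strip_le
  obtain ⟨δ₁, hδ₁, hlt⟩ : ∃ δ₁ > 0, ∀ i, δ₁ ≤ δ₀ i := by
    have : ∀ᶠ d : ℝ in 𝓝[>] 0, ∀ i, d ≤ δ₀ i :=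
      eventually_all.2 fun i => (eventually_le_nhds (hδ₀ i)).filter_mono nhdsWithin_le_nhds
    obtain ⟨d, hd, hd0⟩ := (this.and eventually_mem_nhdsWithin).exists
    exact ⟨d, hd0, hd⟩
  refine ⟨∑ i, C i, δ₁, hδ₁, fun ψ hψ δ hδ hδ₁ a K ha hK => ?_⟩
  rw [Metric.thickening_iUnion]
  refine (lintegral_iUnion_le _ _).trans ?_
  rw [tsum_fintype]
  push_cast
  rw [Finset.sum_mul]
  refine Finset.sum_le_sum fun i _ => (h i ψ hψ δ hδ (hδ₁.trans_le (hlt i))).trans ?_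
  gcongr
  exact ha i

/-- The function is `φ n + (1 - η) * (f - φ n)`, where `f` has good traces and bounded energy, and
`η` cuts out the pattern at scale `δ`. Its traces are those of `f`. Off the pattern it is close to
`φ n`, as `f - φ n` has small mass in the thin neighbourhood. The critical term `|∇η|² |f - φ n|²`
is of order `δ⁻² * δ²` after integration, thus bounded independently of `δ`. -/
theorem ApproxSeq.exists_bounded {u : Plane → ℝ} {W dW : ι → ℝ → ℝ} {φ : ℕ → Plane → ℝ} {B : ℝ≥0}
    (h : ApproxSeq Ω G u W φ B) (hW : ∀ i, SobolevOn 0 (G.arc i).length (W i) (dW i))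
    (hT : TraceApprox Ω G W) :
    ∃ M : ℝ≥0, ∀ ε : ℝ≥0∞, 0 < ε → ∃ Φ : Plane → ℝ, IsTestFunction Ω Φ ∧ energy G Φ ≤ M ∧
      ∫⁻ x in Ω, ‖Φ x - u x‖ₑ ^ 2 ≤ ε ∧
      ∀ i, ∫⁻ s in Icc 0 (G.arc i).length, ‖Φ ((G.arc i).ext s) - W i s‖ₑ ^ 2 ≤ ε := by
  obtain ⟨M, hM⟩ := hT
  obtain ⟨C, δ₀, hδ₀, hstrip⟩ := G.exists_strip_le
  obtain ⟨Cη, hη⟩ := exists_cutoff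
  set K : ℝ≥0 := 2 * M + 2 * B with hK
  set A : ℝ≥0 := C * (4 + K) with hA
  refine ⟨2 * B + (4 * K + 4 * (Cη ^ 2 * A)) + M, fun ε hε => ?_⟩
  have hε4 : 0 < ε / 4 := ENNReal.div_pos hε.ne' (by simp)
  obtain ⟨δ, hδA, hδδ, hδ⟩ : ∃ δ : ℝ, A * ENNReal.ofReal (δ ^ 2) < ε / 4 ∧ δ < δ₀ ∧ 0 < δ := by
    have h1 : Tendsto (fun δ : ℝ => A * ENNReal.ofReal (δ ^ 2)) (𝓝 0) (𝓝 0) := by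
      have : Continuous fun δ : ℝ => A * ENNReal.ofReal (δ ^ 2) :=
        (ENNReal.continuous_const_mul ENNReal.coe_ne_top).comp
          (ENNReal.continuous_ofReal.comp (by fun_prop))
      simpa using this.tendsto 0
    obtain ⟨δ, ⟨h1, h2⟩, h3⟩ := (((h1.eventually_lt_const hε4).and
      (eventually_lt_nhds hδ₀)).filter_mono (nhdsWithin_le_nhds (s := Ioi 0)) |>.and
        eventually_mem_nhdsWithin).exists
    exact ⟨δ, h1, h2, h3⟩
  have hδe : 0 < ENNReal.ofReal δ := ENNReal.ofReal_pos.2 hδ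
  -- The scale `δ` is fixed first; `f` and `n` are chosen afterwards, so that both traces are within
  -- `δ` of `W` in squared norm.
  obtain ⟨f, hf, hfM, hfW⟩ := hM (min ε (ENNReal.ofReal δ)) (lt_min hε hδe)
  obtain ⟨n, ⟨hnB, hnu⟩, hnW⟩ := ((h.bound.and (h.tendsto.eventually_le_const hε4)).and
    (eventually_all.2 fun i => (h.tendsto_trace i).eventually_le_const hδe)).exists
  have hφ := h.test n
  set ψ : Plane → ℝ := fun x => f x - φ n x with hψdef
  have hψ : IsTestFunction Ω ψ := hf.sub hφ
  set S : Set Plane := ⋃ i, (G.arc i).ext '' Icc 0 (G.arc i).length with hS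
  obtain ⟨η, hηC, hη01, hη0, hη1, hηd, hηb⟩ := hη S δ hδ
  have hψK : ∫⁻ x, ‖fderiv ℝ ψ x‖ₑ ^ 2 ≤ K := by
    calc ∫⁻ x, ‖fderiv ℝ ψ x‖ₑ ^ 2
        ≤ ∫⁻ x, (2 * ‖fderiv ℝ f x‖ₑ ^ 2 + 2 * ‖fderiv ℝ (φ n) x‖ₑ ^ 2) := by
          refine lintegral_mono fun x => ?_
          rw [hψdef, fderiv_fun_sub (hf.contDiff_one.differentiable (by norm_num) x)
            (hφ.contDiff_one.differentiable (by norm_num) x), sub_eq_add_neg,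
            ← enorm_neg (fderiv ℝ (φ n) x)]
          exact enorm_add_sq_le _ _
      _ = 2 * (∫⁻ x, ‖fderiv ℝ f x‖ₑ ^ 2) + 2 * ∫⁻ x, ‖fderiv ℝ (φ n) x‖ₑ ^ 2 := by
          rw [lintegral_add_left ((measurable_grad_sq hf.contDiff_one).const_mul _),
            lintegral_const_mul' _ _ (by simp), lintegral_const_mul' _ _ (by simp)]
      _ ≤ K := by
          rw [hK]
          push_cast
          gcongr
          exact le_self_add.trans hfM
  have hψW : ∀ i, ∫⁻ s in Icc 0 (G.arc i).length, ‖ψ ((G.arc i).ext s)‖ₑ ^ 2 ≤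
      4 * ENNReal.ofReal δ := by
    intro i
    have hm : AEStronglyMeasurable (fun s => f ((G.arc i).ext s) - W i s)
        (volume.restrict (Icc 0 (G.arc i).length)) :=
      (hf.contDiff.continuous.comp (G.arc i).continuous_ext).aestronglyMeasurable.sub
        ((hW i).continuousOn.aestronglyMeasurable measurableSet_Icc)
    refine (lintegral_sq_sub_le hm).trans ?_
    calc _ ≤ 2 * ENNReal.ofReal δ + 2 * ENNReal.ofReal δ := by
          gcongr
          · exact (hfW i).trans (min_le_right _ _)
          · exact hnW i
      _ = 4 * ENNReal.ofReal δ := by rw [← add_mul]; norm_num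
  -- Trace and gradient terms are both of order `δ ^ 2`: the first is `δ` times the squared trace,
  -- which is at most `4 * δ`.
  have hψS : ∫⁻ x in Metric.thickening δ S, ‖ψ x‖ₑ ^ 2 ≤ A * ENNReal.ofReal (δ ^ 2) := by
    refine (hstrip ψ hψ.contDiff_one δ hδ hδδ _ _ hψW hψK).trans_eq ?_
    rw [hA, sq, ENNReal.ofReal_mul hδ.le]
    push_cast
    ring
  have hSm : MeasurableSet (Metric.thickening δ S) := Metric.isOpen_thickening.measurableSet
  have hη' : ContDiff ℝ ∞ fun x => 1 - η x := contDiff_const.sub hηC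
  have hχ : IsTestFunction Ω (fun x => (1 - η x) * ψ x) := hψ.mul_left hη'
  have hχm : Measurable fun x => ‖(1 - η x) * ψ x‖ₑ ^ 2 := measurable_sq hχ.contDiff_one
  have htrace : ∀ i, ∀ s ∈ Icc 0 (G.arc i).length,
      φ n ((G.arc i).ext s) + (1 - η ((G.arc i).ext s)) * ψ ((G.arc i).ext s) =
        f ((G.arc i).ext s) := by
    intro i s hs
    rw [hη0 _ (mem_iUnion.2 ⟨i, mem_image_of_mem _ hs⟩), hψdef]
    ring
  refine ⟨_, hφ.add hχ, ?_, ?_, fun i => ?_⟩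
  · rw [energy]
    push_cast
    refine add_le_add ?_ ?_
    · have hpt : ∀ x, ‖fderiv ℝ (fun x => φ n x + (1 - η x) * ψ x) x‖ₑ ^ 2 ≤
          2 * ‖fderiv ℝ (φ n) x‖ₑ ^ 2 + (4 * ‖fderiv ℝ ψ x‖ₑ ^ 2 +
            4 * (ENNReal.ofReal ((Cη / δ) ^ 2) *
              (Metric.thickening δ S).indicator (fun x => ‖ψ x‖ₑ ^ 2) x)) := by
        intro x
        have d1 := (hφ.contDiff_one.differentiable (by norm_num) x)
        have d2 := (hψ.contDiff_one.differentiable (by norm_num) x)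
        have d3 : DifferentiableAt ℝ η x := hηC.differentiable (by norm_cast) x
        have hDη : ‖ψ x • fderiv ℝ (fun x => 1 - η x) x‖ₑ ^ 2 ≤ ENNReal.ofReal ((Cη / δ) ^ 2) *
            (Metric.thickening δ S).indicator (fun x => ‖ψ x‖ₑ ^ 2) x := by
          rw [fderiv_const_sub, enorm_smul, enorm_neg, mul_pow, mul_comm]
          by_cases hx : x ∈ Metric.thickening δ S
          · rw [indicator_of_mem hx, ENNReal.ofReal_pow (by positivity)]
            gcongr
            rw [← ofReal_norm]
            exact ENNReal.ofReal_le_ofReal (hηb x)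
          · rw [hηd x hx, ← ofReal_norm, norm_zero]
            simp
        have h1 : ‖fderiv ℝ (fun x => (1 - η x) * ψ x) x‖ₑ ^ 2 ≤ 2 * ‖fderiv ℝ ψ x‖ₑ ^ 2 +
            2 * (ENNReal.ofReal ((Cη / δ) ^ 2) *
              (Metric.thickening δ S).indicator (fun x => ‖ψ x‖ₑ ^ 2) x) := by
          rw [fderiv_fun_mul (d3.const_sub 1) d2]
          refine (enorm_add_sq_le _ _).trans ?_
          refine add_le_add (mul_le_mul_right ?_ _) (mul_le_mul_right hDη _)
          rw [enorm_smul]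
          refine pow_le_pow_left₀ zero_le (mul_le_of_le_one_left zero_le ?_) 2
          rw [← ofReal_norm, ENNReal.ofReal_le_one, Real.norm_eq_abs, abs_le]
          constructor <;> linarith [hη01 x]
        rw [fderiv_fun_add d1 (hχ.contDiff_one.differentiable (by norm_num) x)]
        refine (enorm_add_sq_le _ _).trans (add_le_add le_rfl ?_)
        refine (mul_le_mul_right h1 _).trans_eq ?_
        rw [mul_add, ← mul_assoc, ← mul_assoc]
        norm_num
      refine (lintegral_mono hpt).trans ?_
      rw [lintegral_add_left ((measurable_grad_sq hφ.contDiff_one).const_mul _),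
        lintegral_add_left ((measurable_grad_sq hψ.contDiff_one).const_mul _),
        lintegral_const_mul' _ _ (by simp), lintegral_const_mul' _ _ (by simp),
        lintegral_const_mul' _ _ (by simp), lintegral_const_mul' _ _ (by simp),
        lintegral_indicator hSm]
      refine add_le_add (mul_le_mul_right hnB _) (add_le_add (mul_le_mul_right hψK _)
        (mul_le_mul_right ?_ _))
      refine (mul_le_mul_right hψS _).trans_eq ?_
      rw [mul_left_comm, ← ENNReal.ofReal_mul (by positivity), mul_comm]
      congr 1
      rw [show ((Cη : ℝ) / δ) ^ 2 * δ ^ 2 = (Cη : ℝ) ^ 2 by field_simp, ENNReal.ofReal_pow (by simp)]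
      simp
    · refine le_trans (Finset.sum_le_sum fun i _ => le_of_eq ?_) (le_add_self.trans hfM)
      rw [setLIntegral_arc_fderiv_congr (hφ.add hχ).contDiff_one (G.arc i)
        (h := fun s => f ((G.arc i).ext s)) (htrace i),
        setLIntegral_arc_fderiv_congr hf.contDiff_one (G.arc i)
        (h := fun s => f ((G.arc i).ext s)) (fun _ _ => rfl)]
  · calc ∫⁻ x in Ω, ‖φ n x + (1 - η x) * ψ x - u x‖ₑ ^ 2
        ≤ ∫⁻ x in Ω, (2 * ‖(1 - η x) * ψ x‖ₑ ^ 2 + 2 * ‖φ n x - u x‖ₑ ^ 2) := by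
          refine lintegral_mono fun x => ?_
          have := enorm_add_sq_le ((1 - η x) * ψ x) (φ n x - u x)
          rwa [show (1 - η x) * ψ x + (φ n x - u x) = φ n x + (1 - η x) * ψ x - u x by ring] at this
      _ ≤ 2 * (ε / 4) + 2 * (ε / 4) := by
          rw [lintegral_add_left (hχm.const_mul _), lintegral_const_mul' _ _ (by simp),
            lintegral_const_mul' _ _ (by simp)]
          gcongr
          refine (setLIntegral_le_lintegral _ _).trans (le_trans ?_ (hψS.trans hδA.le))
          rw [← lintegral_indicator hSm]
          refine lintegral_mono fun x => ?_
          by_cases hx : x ∈ Metric.thickening δ S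
          · rw [indicator_of_mem hx, enorm_mul]
            refine pow_le_pow_left₀ zero_le (mul_le_of_le_one_left zero_le ?_) 2
            rw [← ofReal_norm, ENNReal.ofReal_le_one, Real.norm_eq_abs, abs_le]
            constructor <;> linarith [hη01 x]
          · rw [hη1 x hx]; simp
      _ = ε := by
          rw [← add_mul, show (2 : ℝ≥0∞) + 2 = 4 by norm_num]
          exact ENNReal.mul_div_cancel (by simp) (by simp)
  · refine le_trans (le_of_eq ?_) ((hfW i).trans (min_le_left _ _))
    exact setLIntegral_congr_fun measurableSet_Icc fun s hs => by simp only [htrace i s hs]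

end Bounded

/-! ### Test functions belong to the space -/

namespace IsTestFunction

variable {Ω : Set Plane} {φ ψ : Plane → ℝ}

lemma memLp (hφ : IsTestFunction Ω φ) (S : Set Plane) : MemLp φ 2 (volume.restrict S) :=
  (hφ.contDiff.continuous.memLp_of_hasCompactSupport hφ.hasCompactSupport).restrict _

lemma memLp_gradient (hφ : IsTestFunction Ω φ) (S : Set Plane) :
    MemLp (gradient φ) 2 (volume.restrict S) :=
  ((continuous_gradient hφ.contDiff_one).memLp_of_hasCompactSupport
    ((hφ.hasCompactSupport.fderiv ℝ).comp_left (map_zero _))).restrict _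

lemma memLp_fderiv (hφ : IsTestFunction Ω φ) (S : Set Plane) (e : Plane) :
    MemLp (fun x => fderiv ℝ φ x e) 2 (volume.restrict S) :=
  ((hφ.continuous_fderiv.clm_apply continuous_const).memLp_of_hasCompactSupport
    (hφ.hasCompactSupport.fderiv_apply ℝ e)).restrict _

lemma hasWeakGradient (hφ : IsTestFunction Ω φ) : HasWeakGradient Ω φ (gradient φ) := by
  intro ψ hψ e
  have c1 : Continuous fun x => fderiv ℝ φ x e := hφ.continuous_fderiv.clm_apply continuous_const
  have c2 : Continuous fun x => fderiv ℝ ψ x e := hψ.continuous_fderiv.clm_apply continuous_const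
  rw [setIntegral_eq_integral_of_forall_compl_eq_zero fun x hx => by simp [hφ.eq_zero hx],
    setIntegral_eq_integral_of_forall_compl_eq_zero fun x hx => by simp [hψ.eq_zero hx]]
  simp only [inner_gradient_left]
  refine integral_mul_fderiv_eq_neg_fderiv_mul_of_integrable ?_ ?_ ?_
    (fun x _ => hφ.contDiff_one.differentiable (by norm_num) x)
    (fun x _ => hψ.contDiff_one.differentiable (by norm_num) x)
  · exact (c1.mul hψ.contDiff.continuous).integrable_of_hasCompactSupport
      hψ.hasCompactSupport.mul_left
  · exact (hφ.contDiff.continuous.mul c2).integrable_of_hasCompactSupport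
      hφ.hasCompactSupport.mul_right
  · exact (hφ.contDiff.continuous.mul hψ.contDiff.continuous).integrable_of_hasCompactSupport
      hφ.hasCompactSupport.mul_right

lemma tendstoH1 (φ : Plane → ℝ) (Ω : Set Plane) : TendstoH1 Ω (fun _ => φ) φ (gradient φ) := by
  constructor <;> simp

lemma isH10 (hφ : IsTestFunction Ω φ) : IsH10 Ω φ (gradient φ) :=
  ⟨hφ.memLp Ω, hφ.memLp_gradient Ω, hφ.hasWeakGradient, fun _ => φ, fun _ => hφ, tendstoH1 φ Ω⟩

end IsTestFunction

namespace PlaneArc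

variable {Ω : Set Plane} {φ : Plane → ℝ} (γ : PlaneArc)

lemma arcDeriv_eq (hφ : ContDiff ℝ 1 φ) {s : ℝ} (hs : s ∈ Icc 0 γ.length) :
    γ.arcDeriv φ s = fderiv ℝ φ (γ.ext s) (γ.extTangent s) := by
  rw [γ.ext_eq hs, γ.extTangent_eq hs]
  exact (((hφ.differentiable (by norm_num)) _).hasFDerivAt.comp_hasDerivWithinAt s
    (γ.hasDerivWithinAt hs)).derivWithin (uniqueDiffOn_Icc γ.length_pos s hs)

lemma memLp_of_continuous {l : ℝ} {F : ℝ → ℝ} (hF : Continuous F) :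
    MemLp F 2 (volume.restrict (Ioo 0 l)) := by
  rw [← restrict_Icc_eq_Ioo]
  exact (lintegral_sq_lt_top_iff hF.aestronglyMeasurable).2
    (setLIntegral_sq_lt_top isCompact_Icc hF.continuousOn)

lemma ae_ext_eq : ∀ᵐ s ∂volume.restrict (Ioo 0 γ.length), γ.ext s = γ.toFun s :=
  (ae_restrict_iff' measurableSet_Ioo).2 (Eventually.of_forall fun _ hs =>
    γ.ext_eq (Ioo_subset_Icc_self hs))

lemma ae_arcDeriv_eq (hφ : ContDiff ℝ 1 φ) : ∀ᵐ s ∂volume.restrict (Ioo 0 γ.length),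
    γ.arcDeriv φ s = fderiv ℝ φ (γ.ext s) (γ.extTangent s) :=
  (ae_restrict_iff' measurableSet_Ioo).2 (Eventually.of_forall fun _ hs =>
    γ.arcDeriv_eq hφ (Ioo_subset_Icc_self hs))

lemma memLp_trace (hφ : IsTestFunction Ω φ) :
    MemLp (fun s => φ (γ.toFun s)) 2 (volume.restrict (Ioo 0 γ.length)) := by
  refine (memLp_congr_ae ?_).1
    (memLp_of_continuous (hφ.contDiff.continuous.comp γ.continuous_ext))
  filter_upwards [γ.ae_ext_eq] with s hs
  simp only [Function.comp_apply, hs]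

lemma isTraceOn (hφ : IsTestFunction Ω φ) :
    IsTraceOn Ω γ φ (gradient φ) (fun s => φ (γ.toFun s)) :=
  ⟨γ.memLp_trace hφ, fun _ => φ, fun _ => hφ, IsTestFunction.tendstoH1 φ Ω, by simp⟩

lemma isH1Interval (hφ : IsTestFunction Ω φ) :
    IsH1Interval γ.length (fun s => φ (γ.toFun s)) (γ.arcDeriv φ) := by
  refine ⟨γ.memLp_trace hφ, ?_, fun ψ hψ => ?_⟩
  · exact (memLp_congr_ae (γ.ae_arcDeriv_eq hφ.contDiff_one)).2
      (memLp_of_continuous (continuous_arc_fderiv hφ.contDiff_one γ))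
  · have := (hφ.sobolevOn_ext γ 0 γ.length).integral_mul_deriv γ.length_pos.le hψ
    refine Eq.trans (integral_congr_ae ?_) (this.trans (congrArg Neg.neg (integral_congr_ae ?_)))
    · filter_upwards [γ.ae_ext_eq] with s hs
      rw [hs]
    · filter_upwards [γ.ae_arcDeriv_eq hφ.contDiff_one] with s hs
      rw [hs]

end PlaneArc

lemma IsTestFunction.isHGamma {ι : Type*} {Ω : Set Plane} {φ : Plane → ℝ} (hφ : IsTestFunction Ω φ)
    (G : Pattern ι) : IsHGamma Ω G φ (gradient φ) (fun i s => φ ((G.arc i).toFun s))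
      (fun i => (G.arc i).arcDeriv φ) :=
  ⟨hφ.isH10, fun i => (G.arc i).isTraceOn hφ, fun i => (G.arc i).isH1Interval hφ⟩

/-! ### Weak approximation in Hilbert space -/

/-- A bounded sequence in a subspace that converges weakly on a total set has its weak limit in
the closure of the subspace. -/
lemma mem_closure_of_tendsto_inner {H : Type*} [NormedAddCommGroup H] [InnerProductSpace ℝ H]
    [CompleteSpace H] (V : Submodule ℝ H) {x : H} {v : ℕ → H} (hv : ∀ n, v n ∈ V) {R : ℝ}
    (hR : ∀ n, ‖v n‖ ≤ R) (D : Set H) (hD : ∀ f : H, (∀ d ∈ D, inner ℝ d f = 0) → f = 0)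
    (h : ∀ d ∈ D, Tendsto (fun n => inner ℝ (v n) d) atTop (𝓝 (inner ℝ x d))) :
    x ∈ V.topologicalClosure := by
  have hspan : (Submodule.span ℝ D).topologicalClosure = ⊤ := by
    rw [Submodule.topologicalClosure_eq_top_iff, eq_bot_iff]
    intro f hf
    exact (Submodule.mem_bot ℝ).2 (hD f fun d hd => hf d (Submodule.subset_span hd))
  have h1 : ∀ f ∈ Submodule.span ℝ D, Tendsto (fun n => inner ℝ (v n) f) atTop (𝓝 (inner ℝ x f)) := by
    intro f hf
    induction hf using Submodule.span_induction with
    | mem d hd => exact h d hd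
    | zero => simp
    | add a b _ _ ha hb => simpa only [inner_add_right] using ha.add hb
    | smul c a _ ha => simpa only [real_inner_smul_right] using ha.const_mul c
  -- For `f` orthogonal to `V` one has `⟪v n, f⟫ = 0`. Boundedness of `v n` allows `f` to be
  -- replaced by an element `a` of the span of `D`, for which `⟪v n, a⟫ → ⟪x, a⟫`; hence `⟪x, f⟫ =
  -- 0`.
  refine mem_topologicalClosure_of_forall_orthogonal V fun f hf => ?_
  rw [real_inner_comm]
  by_contra hne
  have hR0 : 0 ≤ R := (norm_nonneg _).trans (hR 0)
  set t := |inner ℝ x f| with ht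
  have ht0 : 0 < t := abs_pos.2 hne
  have hfc : f ∈ closure (Submodule.span ℝ D : Set H) := by
    rw [← Submodule.topologicalClosure_coe, hspan]; trivial
  set Q := R + ‖x‖ + 1 with hQ
  have hQ0 : 0 < Q := by positivity
  obtain ⟨a, ha, haf⟩ := Metric.mem_closure_iff.1 hfc (t / (2 * Q)) (by positivity)
  rw [dist_eq_norm] at haf
  have h2 := ((h1 a ha).sub_const (inner ℝ x a)).abs
  rw [sub_self, abs_zero] at h2
  obtain ⟨n, hn⟩ := (h2.eventually_lt_const (half_pos ht0)).exists
  have e1 : inner ℝ x f = inner ℝ (x - v n) (f - a) - (inner ℝ (v n) a - inner ℝ x a) := by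
    have : inner ℝ (v n) f = 0 := hf _ (hv n)
    rw [inner_sub_right, inner_sub_left, inner_sub_left, this]
    ring
  have e2 : |inner ℝ (x - v n) (f - a)| ≤ Q * (t / (2 * Q)) := by
    refine (abs_real_inner_le_norm _ _).trans (mul_le_mul ?_ haf.le (norm_nonneg _) hQ0.le)
    have := norm_sub_le x (v n)
    have := hR n
    linarith
  have e3 : Q * (t / (2 * Q)) = t / 2 := by field_simp
  have e4 : t ≤ |inner ℝ (x - v n) (f - a)| + |inner ℝ (v n) a - inner ℝ x a| := by
    rw [ht, e1]; exact abs_sub _ _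
  linarith

lemma tendsto_integral_mul {α : Type*} [MeasurableSpace α] {μ : Measure α} {f : ℕ → α → ℝ}
    {g q : α → ℝ} (hf : ∀ n, MemLp (f n) 2 μ) (hg : MemLp g 2 μ) (hq : MemLp q 2 μ)
    (h : Tendsto (fun n => ∫⁻ x, ‖f n x - g x‖ₑ ^ 2 ∂μ) atTop (𝓝 0)) :
    Tendsto (fun n => ∫ x, f n x * q x ∂μ) atTop (𝓝 (∫ x, g x * q x ∂μ)) := by
  have key : ∀ {a : α → ℝ} (ha : MemLp a 2 μ),
      inner ℝ (hq.toLp q) (ha.toLp a) = ∫ x, a x * q x ∂μ := by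
    intro a ha
    rw [L2.inner_def]
    refine integral_congr_ae ?_
    filter_upwards [hq.coeFn_toLp, ha.coeFn_toLp] with x h1 h2
    rw [h1, h2]
    simp [mul_comm]
  have h1 : Tendsto (fun n => (hf n).toLp (f n)) atTop (𝓝 (hg.toLp g)) := by
    rw [Lp.tendsto_Lp_iff_tendsto_eLpNorm'']
    have h2 := ((ENNReal.continuous_rpow_const (y := (1 / 2 : ℝ))).tendsto 0).comp h
    rw [ENNReal.zero_rpow_of_pos (by norm_num)] at h2
    refine h2.congr fun n => ?_
    simp only [Function.comp_apply]
    have h3 : eLpNorm (f n - g) 2 μ ^ 2 = ∫⁻ x, ‖f n x - g x‖ₑ ^ 2 ∂μ := eLpNorm_two_sq _ _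
    rw [← h3, ← ENNReal.rpow_natCast, ← ENNReal.rpow_mul]
    norm_num
  have h3 := (tendsto_const_nhds (x := hq.toLp q)).inner (𝕜 := ℝ) h1
  simpa only [key] using h3

/-! ### Density -/

/-- Totality of the fields `θ • e` in `L²`, by the fundamental lemma of the calculus of variations.
The generality covers both the gradients on `Ω` and the derivatives on the parameter intervals. -/
lemma eq_zero_of_integral_test_smul {E F : Type*} [NormedAddCommGroup E] [NormedSpace ℝ E]
    [FiniteDimensional ℝ E] [MeasurableSpace E] [BorelSpace E] [NormedAddCommGroup F]
    [InnerProductSpace ℝ F] [CompleteSpace F] {μ : Measure E} [IsLocallyFiniteMeasure μ] {U : Set E}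
    (hU : IsOpen U) (f : Lp F 2 (μ.restrict U))
    (h : ∀ θ : E → ℝ, IsTestFunction U θ → ∀ e : F, ∫ x in U, inner ℝ (θ x • e) (f x) ∂μ = 0) :
    f = 0 := by
  have hloc : LocallyIntegrable f (μ.restrict U) := (Lp.memLp f).locallyIntegrable (by norm_num)
  have h1 : ∀ᵐ x ∂μ.restrict U, x ∈ U → f x = 0 := by
    refine hU.ae_eq_zero_of_integral_contDiff_smul_eq_zero (hloc.locallyIntegrableOn _)
      fun θ h1 h2 h3 => ?_
    have hint : Integrable (fun x => θ x • f x) (μ.restrict U) :=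
      hloc.integrable_smul_left_of_hasCompactSupport h1.continuous h2
    refine ext_inner_left ℝ fun e => ?_
    rw [inner_zero_right, ← integral_inner hint, ← h θ ⟨h1, h2, h3⟩ e]
    simp only [real_inner_smul_left, real_inner_smul_right]
  refine (Lp.eq_zero_iff_ae_eq_zero).2 ?_
  filter_upwards [h1, ae_restrict_mem hU.measurableSet] with x h2 h3
  exact h2 h3

lemma norm_toLp_sq {α E : Type*} [MeasurableSpace α] [NormedAddCommGroup E] {μ : Measure α}
    {f : α → E} (hf : MemLp f 2 μ) : ‖hf.toLp f‖ ^ 2 = (∫⁻ x, ‖f x‖ₑ ^ 2 ∂μ).toReal := by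
  rw [Lp.norm_toLp, ← ENNReal.toReal_pow, eLpNorm_two_sq]

/-! ### The Hilbert space of gradients and arc-length derivatives. -/

section Density

variable {ι : Type*} {Ω : Set Plane} {G : Pattern ι}

/-- The Hilbert space of square integrable vector fields on `Ω` and functions on the curves. -/
abbrev PatternL2 (Ω : Set Plane) (G : Pattern ι) : Type _ :=
  WithLp 2 (Lp Plane 2 (volume.restrict Ω) ×
    PiLp 2 fun i => Lp ℝ 2 (volume.restrict (Ioo 0 (G.arc i).length)))

namespace PatternL2

variable {X X' : Plane → Plane} {y y' : ι → ℝ → ℝ}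

/-- The element of the Hilbert space given by square integrable functions. -/
noncomputable def ofFun (hX : MemLp X 2 (volume.restrict Ω))
    (hy : ∀ i, MemLp (y i) 2 (volume.restrict (Ioo 0 (G.arc i).length))) : PatternL2 Ω G :=
  WithLp.toLp 2 (hX.toLp X, WithLp.toLp 2 fun i => (hy i).toLp (y i))

lemma ofFun_congr (hX : MemLp X 2 (volume.restrict Ω)) (hX' : MemLp X' 2 (volume.restrict Ω))
    (hy : ∀ i, MemLp (y i) 2 (volume.restrict (Ioo 0 (G.arc i).length)))
    (hy' : ∀ i, MemLp (y' i) 2 (volume.restrict (Ioo 0 (G.arc i).length)))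
    (h : X =ᵐ[volume.restrict Ω] X')
    (h' : ∀ i, y i =ᵐ[volume.restrict (Ioo 0 (G.arc i).length)] y' i) :
    ofFun hX hy = ofFun hX' hy' := by
  rw [ofFun, ofFun, (MemLp.toLp_eq_toLp_iff hX hX').2 h,
    funext fun i => (MemLp.toLp_eq_toLp_iff (hy i) (hy' i)).2 (h' i)]

lemma ofFun_add (hX : MemLp X 2 (volume.restrict Ω)) (hX' : MemLp X' 2 (volume.restrict Ω))
    (hy : ∀ i, MemLp (y i) 2 (volume.restrict (Ioo 0 (G.arc i).length)))
    (hy' : ∀ i, MemLp (y' i) 2 (volume.restrict (Ioo 0 (G.arc i).length))) :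
    ofFun hX hy + ofFun hX' hy' = ofFun (hX.add hX') (fun i => (hy i).add (hy' i)) := rfl

lemma ofFun_sub (hX : MemLp X 2 (volume.restrict Ω)) (hX' : MemLp X' 2 (volume.restrict Ω))
    (hy : ∀ i, MemLp (y i) 2 (volume.restrict (Ioo 0 (G.arc i).length)))
    (hy' : ∀ i, MemLp (y' i) 2 (volume.restrict (Ioo 0 (G.arc i).length))) :
    ofFun hX hy - ofFun hX' hy' = ofFun (hX.sub hX') (fun i => (hy i).sub (hy' i)) := rfl

lemma smul_ofFun (c : ℝ) (hX : MemLp X 2 (volume.restrict Ω))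
    (hy : ∀ i, MemLp (y i) 2 (volume.restrict (Ioo 0 (G.arc i).length))) :
    c • ofFun hX hy = ofFun (hX.const_smul c) (fun i => (hy i).const_smul c) := rfl

variable [Fintype ι]

lemma inner_ofFun (hX : MemLp X 2 (volume.restrict Ω))
    (hy : ∀ i, MemLp (y i) 2 (volume.restrict (Ioo 0 (G.arc i).length))) (f : PatternL2 Ω G) :
    inner ℝ (ofFun hX hy) f = (∫ x in Ω, inner ℝ (X x) (f.fst x)) +
      ∑ i, ∫ s in Ioo 0 (G.arc i).length, inner ℝ (y i s) (f.snd i s) := by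
  rw [WithLp.prod_inner_apply, PiLp.inner_apply, L2.inner_def]
  congr 1
  · refine integral_congr_ae ?_
    filter_upwards [hX.coeFn_toLp] with x hx
    simp only [ofFun]
    rw [hx]
    rfl
  · refine Finset.sum_congr rfl fun i _ => ?_
    rw [L2.inner_def]
    refine integral_congr_ae ?_
    filter_upwards [(hy i).coeFn_toLp] with x hx
    simp only [ofFun]
    rw [hx]
    rfl

lemma inner_ofFun_ofFun (hX : MemLp X 2 (volume.restrict Ω)) (hX' : MemLp X' 2 (volume.restrict Ω))
    (hy : ∀ i, MemLp (y i) 2 (volume.restrict (Ioo 0 (G.arc i).length)))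
    (hy' : ∀ i, MemLp (y' i) 2 (volume.restrict (Ioo 0 (G.arc i).length))) :
    inner ℝ (ofFun hX hy) (ofFun hX' hy') = (∫ x in Ω, inner ℝ (X x) (X' x)) +
      ∑ i, ∫ s in Ioo 0 (G.arc i).length, inner ℝ (y i s) (y' i s) := by
  rw [inner_ofFun]
  congr 1
  · refine integral_congr_ae ?_
    filter_upwards [hX'.coeFn_toLp] with x hx
    change inner ℝ (X x) (hX'.toLp X' x) = _
    rw [hx]
  · refine Finset.sum_congr rfl fun i _ => integral_congr_ae ?_
    filter_upwards [(hy' i).coeFn_toLp] with x hx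
    change inner ℝ (y i x) ((hy' i).toLp (y' i) x) = _
    rw [hx]

lemma norm_ofFun_sq (hX : MemLp X 2 (volume.restrict Ω))
    (hy : ∀ i, MemLp (y i) 2 (volume.restrict (Ioo 0 (G.arc i).length))) :
    ‖(ofFun hX hy : PatternL2 Ω G)‖ ^ 2 = (∫ x in Ω, ‖X x‖ ^ 2) +
      ∑ i, ∫ s in Ioo 0 (G.arc i).length, y i s ^ 2 := by
  rw [← real_inner_self_eq_norm_sq, inner_ofFun_ofFun]
  simp only [real_inner_self_eq_norm_sq, Real.norm_eq_abs, sq_abs]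

lemma norm_ofFun_sq_eq_toReal (hX : MemLp X 2 (volume.restrict Ω))
    (hy : ∀ i, MemLp (y i) 2 (volume.restrict (Ioo 0 (G.arc i).length))) :
    ‖(ofFun hX hy : PatternL2 Ω G)‖ ^ 2 = (∫⁻ x in Ω, ‖X x‖ₑ ^ 2).toReal +
      ∑ i, (∫⁻ s in Ioo 0 (G.arc i).length, ‖y i s‖ₑ ^ 2).toReal := by
  rw [WithLp.prod_norm_sq_eq_of_L2, PiLp.norm_sq_eq_of_L2]
  simp only [← norm_toLp_sq hX, ← norm_toLp_sq (hy _)]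
  rfl

/-- The gradient and the arc-length derivatives of a test function. -/
noncomputable def ofTest (G : Pattern ι) {φ : Plane → ℝ} (hφ : IsTestFunction Ω φ) : PatternL2 Ω G :=
  ofFun hφ.isH10.memLp_grad fun i => ((G.arc i).isH1Interval hφ).memLp_deriv

/-- The subspace of the Hilbert space that corresponds to the test functions. -/
noncomputable def testSubmodule (Ω : Set Plane) (G : Pattern ι) : Submodule ℝ (PatternL2 Ω G) :=
  have smul_mem : ∀ (c : ℝ) {v : PatternL2 Ω G}, v ∈ {v | ∃ φ, ∃ hφ : IsTestFunction Ω φ,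
      v = ofTest G hφ} → c • v ∈ {v | ∃ φ, ∃ hφ : IsTestFunction Ω φ, v = ofTest G hφ} := by
    rintro c _ ⟨φ, hφ, rfl⟩
    refine ⟨_, hφ.const_mul c, ?_⟩
    rw [ofTest, smul_ofFun]
    have hd : ∀ x, fderiv ℝ (fun x => c * φ x) x = c • fderiv ℝ φ x := fun x =>
      fderiv_const_mul (hφ.contDiff_one.differentiable (by norm_num) x) c
    refine ofFun_congr _ _ _ _ (Eventually.of_forall fun x => ?_) fun i => ?_
    · simp [gradient, hd]
    · filter_upwards [(G.arc i).ae_arcDeriv_eq hφ.contDiff_one,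
        (G.arc i).ae_arcDeriv_eq (hφ.const_mul c).contDiff_one] with s h1 h2
      simp [h1, h2, hd]
  { carrier := {v | ∃ φ, ∃ hφ : IsTestFunction Ω φ, v = ofTest G hφ}
    smul_mem' := fun c _ h => smul_mem c h
    zero_mem' := by
      have := smul_mem 0 ⟨_, IsTestFunction.zero, rfl⟩
      rwa [zero_smul] at this
    add_mem' := by
      rintro _ _ ⟨φ, hφ, rfl⟩ ⟨ψ, hψ, rfl⟩
      refine ⟨_, hφ.add hψ, ?_⟩
      rw [ofTest, ofTest, ofFun_add]
      have hd : ∀ x, fderiv ℝ (fun x => φ x + ψ x) x = fderiv ℝ φ x + fderiv ℝ ψ x := fun x =>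
        fderiv_fun_add (hφ.contDiff_one.differentiable (by norm_num) x)
          (hψ.contDiff_one.differentiable (by norm_num) x)
      refine ofFun_congr _ _ _ _ (Eventually.of_forall fun x => ?_) fun i => ?_
      · simp [gradient, hd]
      · filter_upwards [(G.arc i).ae_arcDeriv_eq hφ.contDiff_one,
          (G.arc i).ae_arcDeriv_eq hψ.contDiff_one,
          (G.arc i).ae_arcDeriv_eq (hφ.add hψ).contDiff_one] with s h1 h2 h3
        simp [h1, h2, h3, hd] }

lemma norm_ofTest_le {φ : Plane → ℝ} (hφ : IsTestFunction Ω φ) {M : ℝ≥0} (hM : energy G φ ≤ M) :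
    ‖ofTest G hφ‖ ^ 2 ≤ M + Fintype.card ι * M := by
  have key : ∀ {a : ℝ≥0∞}, a ≤ M → a.toReal ≤ M := fun h => by
    simpa using ENNReal.toReal_mono ENNReal.coe_ne_top h
  rw [ofTest, norm_ofFun_sq_eq_toReal]
  refine add_le_add (key ?_) ?_
  · simp only [enorm_gradient]
    exact (setLIntegral_le_lintegral _ _).trans (le_self_add.trans hM)
  · refine (Finset.sum_le_card_nsmul _ _ (M : ℝ) fun i _ => key ?_).trans_eq (by simp)
    refine le_trans ?_ ((Finset.single_le_sum (fun _ _ => zero_le) (Finset.mem_univ i)).trans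
      (le_add_self.trans hM))
    rw [restrict_Icc_eq_Ioo]
    refine le_of_eq (lintegral_congr_ae ?_)
    filter_upwards [(G.arc i).ae_arcDeriv_eq hφ.contDiff_one] with s hs
    rw [hs]

end PatternL2

open PatternL2 in
-- The test functions of bounded energy need not converge in norm. Paired with smooth fields,
-- however, their derivatives can be moved onto the fields, so the `L²` convergence of the functions
-- and of the traces gives weak convergence to the derivatives of `u`. The weak limit lies in the
-- norm closure of the subspace of test functions.
theorem IsHGamma.exists_test_near [Fintype ι] {u : Plane → ℝ} {g : Plane → Plane} {w dw : ι → ℝ → ℝ}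
    (h : IsHGamma Ω G u g w dw) (hΩ : IsOpen Ω) {M : ℝ≥0}
    (hM : ∀ ε : ℝ≥0∞, 0 < ε → ∃ Φ : Plane → ℝ, IsTestFunction Ω Φ ∧ energy G Φ ≤ M ∧
      ∫⁻ x in Ω, ‖Φ x - u x‖ₑ ^ 2 ≤ ε ∧
      ∀ i, ∫⁻ s in Icc 0 (G.arc i).length, ‖Φ ((G.arc i).ext s) - w i s‖ₑ ^ 2 ≤ ε)
    {ε : ℝ} (hε : 0 < ε) : ∃ φ : Plane → ℝ, IsTestFunction Ω φ ∧
      hGammaNormSq Ω G (fun x => g x - gradient φ x)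
        (fun i s => dw i s - (G.arc i).arcDeriv φ s) < ε ^ 2 := by
  classical
  choose Φ hΦ hΦM hΦu hΦw using fun n : ℕ => hM ((n : ℝ≥0∞) + 1)⁻¹ (by simp)
  have hlim : Tendsto (fun n : ℕ => ((n : ℝ≥0∞) + 1)⁻¹) atTop (𝓝 0) := by
    have := (tendsto_add_atTop_iff_nat 1).2 ENNReal.tendsto_inv_nat_nhds_zero
    simpa using this
  have hu : Tendsto (fun n => ∫⁻ x in Ω, ‖Φ n x - u x‖ₑ ^ 2) atTop (𝓝 0) :=
    tendsto_of_tendsto_of_tendsto_of_le_of_le tendsto_const_nhds hlim (fun _ => zero_le) hΦu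
  have hw : ∀ i, Tendsto (fun n => ∫⁻ s in Ioo 0 (G.arc i).length,
      ‖Φ n ((G.arc i).toFun s) - w i s‖ₑ ^ 2) atTop (𝓝 0) := by
    intro i
    refine tendsto_of_tendsto_of_tendsto_of_le_of_le tendsto_const_nhds hlim (fun _ => zero_le)
      fun n => le_trans (le_of_eq ?_) (hΦw n i)
    rw [restrict_Icc_eq_Ioo]
    refine lintegral_congr_ae ?_
    filter_upwards [(G.arc i).ae_ext_eq] with s hs
    rw [hs]
  let x : PatternL2 Ω G := ofFun h.isH10.memLp_grad fun i => (h.isH1 i).memLp_deriv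
  have hθm : ∀ {θ : Plane → ℝ}, IsTestFunction Ω θ → ∀ e : Plane,
      MemLp (fun x => θ x • e) 2 (volume.restrict Ω) := fun hθ e =>
    ((hθ.contDiff.continuous.smul continuous_const).memLp_of_hasCompactSupport
      hθ.hasCompactSupport.smul_right).restrict _
  have hψm : ∀ {i} {ψ : ℝ → ℝ}, IsTestFunction (Ioo 0 (G.arc i).length) ψ → ∀ e : ℝ, ∀ j,
      MemLp (fun s => if j = i then ψ s • e else 0) 2 (volume.restrict (Ioo 0 (G.arc j).length)) := by
    intro i ψ hψ e j
    by_cases hj : j = i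
    · simp only [hj, if_true]
      exact PlaneArc.memLp_of_continuous (hψ.contDiff.continuous.smul continuous_const)
    · simp [hj]
  have h0X : MemLp (fun _ : Plane => (0 : Plane)) 2 (volume.restrict Ω) := MemLp.zero
  have h0y : ∀ i, MemLp (fun _ : ℝ => (0 : ℝ)) 2 (volume.restrict (Ioo 0 (G.arc i).length)) :=
    fun _ => MemLp.zero
  -- Smooth fields in a single component; these suffice for totality, and on them the pairing
  -- reduces to one weak derivative.
  let D : Set (PatternL2 Ω G) :=
    {d | ∃ θ, ∃ hθ : IsTestFunction Ω θ, ∃ e : Plane, d = ofFun (hθm hθ e) h0y} ∪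
    {d | ∃ i ψ, ∃ hψ : IsTestFunction (Ioo 0 (G.arc i).length) ψ, ∃ e : ℝ, d = ofFun h0X (hψm hψ e)}
  have hx : x ∈ (testSubmodule Ω G).topologicalClosure := by
    refine mem_closure_of_tendsto_inner _ (v := fun n => ofTest G (hΦ n)) (fun n => ⟨_, hΦ n, rfl⟩)
      (R := Real.sqrt (M + Fintype.card ι * M))
      (fun n => Real.le_sqrt_of_sq_le (norm_ofTest_le (hΦ n) (hΦM n))) D (fun f hf => ?_) ?_
    · have h1 : f.fst = 0 := by
        refine eq_zero_of_integral_test_smul hΩ f.fst fun θ hθ e => ?_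
        have := hf _ (Or.inl ⟨θ, hθ, e, rfl⟩)
        rw [inner_ofFun] at this
        simpa using this
      have h2 : ∀ i, f.snd i = 0 := by
        intro i
        refine eq_zero_of_integral_test_smul isOpen_Ioo (f.snd i) fun ψ hψ e => ?_
        have := hf _ (Or.inr ⟨i, ψ, hψ, e, rfl⟩)
        rw [inner_ofFun, Finset.sum_eq_single i (by
          intro j _ hj
          simp [hj]) (by simp)] at this
        simpa using this
      have h3 : f.snd = 0 := by ext1 i; exact h2 i
      have : f = WithLp.toLp 2 (f.fst, f.snd) := rfl
      rw [this, h1, h3]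
      rfl
    · rintro d (⟨θ, hθ, e, rfl⟩ | ⟨i, ψ, hψ, e, rfl⟩)
      -- The same formula holds for `u` and for the approximating functions, so only convergence in
      -- `L²(Ω)` is needed.
      · have key : ∀ {v : Plane → ℝ} {k : Plane → Plane} (hk : MemLp k 2 (volume.restrict Ω))
            {y : ι → ℝ → ℝ} (hy : ∀ i, MemLp (y i) 2 (volume.restrict (Ioo 0 (G.arc i).length))),
            HasWeakGradient Ω v k →
            inner ℝ (ofFun hk hy) (ofFun (hθm hθ e) h0y) = -∫ x in Ω, v x * fderiv ℝ θ x e := by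
          intro v k hk y hy hvk
          rw [inner_ofFun_ofFun, hvk θ hθ e, neg_neg]
          simp [real_inner_smul_right, mul_comm]
        simp only [x, ofTest]
        rw [key _ _ h.isH10.hasWeakGradient]
        simp only [key _ _ (hΦ _).hasWeakGradient]
        exact (tendsto_integral_mul (fun n => (hΦ n).memLp Ω) h.isH10.memLp (hθ.memLp_fderiv Ω e)
          hu).neg
      · have key : ∀ {v : ℝ → ℝ} {k : Plane → Plane} (hk : MemLp k 2 (volume.restrict Ω))
            {y : ι → ℝ → ℝ} (hy : ∀ i, MemLp (y i) 2 (volume.restrict (Ioo 0 (G.arc i).length))),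
            IsH1Interval (G.arc i).length v (y i) →
            inner ℝ (ofFun hk hy) (ofFun h0X (hψm hψ e)) =
              (-∫ s in Ioo 0 (G.arc i).length, v s * deriv ψ s) * e := by
          intro v k hk y hy hvk
          rw [inner_ofFun_ofFun, hvk.weak_deriv ψ hψ, neg_neg, Finset.sum_eq_single i (by
            intro j _ hj
            simp [hj]) (by simp), ← integral_mul_const]
          simp [mul_comm, mul_left_comm]
        simp only [x, ofTest]
        rw [key _ _ (h.isH1 i)]
        simp only [fun n => key (hΦ n).isH10.memLp_grad (y := fun i => (G.arc i).arcDeriv (Φ n))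
          (fun i => ((G.arc i).isH1Interval (hΦ n)).memLp_deriv) ((G.arc i).isH1Interval (hΦ n))]
        exact (tendsto_integral_mul (fun n => ((G.arc i).isH1Interval (hΦ n)).memLp)
          (h.isH1 i).memLp (PlaneArc.memLp_of_continuous (hψ.contDiff_one.continuous_deriv
            (by norm_num))) (hw i)).neg.mul_const e
  obtain ⟨_, ⟨φ, hφ, rfl⟩, hlt⟩ := Metric.mem_closure_iff.1 hx ε hε
  refine ⟨φ, hφ, ?_⟩
  rw [dist_eq_norm] at hlt
  have h1 := pow_lt_pow_left₀ hlt (norm_nonneg _) two_ne_zero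
  rw [ofTest, ofFun_sub, norm_ofFun_sq] at h1
  exact h1

end Density

theorem mainTheorem3 {ι : Type*} [Fintype ι] (Ω : Set Plane) (hΩ : IsOpen Ω)
    (hΩc : IsConnected Ω) (G : Pattern ι) (hG : G.carrier ⊆ closure Ω)
    (hLip : ∀ p ∈ G.carrier ∩ frontier Ω, IsLipschitzBoundaryAt Ω p)
    (hreg : G.IsRegular Ω) :
    -- `C₀^∞(Ω)` is a subset of the space
    (∀ φ : Plane → ℝ, IsTestFunction Ω φ →
      IsHGamma Ω G φ (gradient φ) (fun i s => φ ((G.arc i).toFun s))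
        (fun i => (G.arc i).arcDeriv φ)) ∧
    ∀ (u : Plane → ℝ) (g : Plane → Plane) (w dw : ι → ℝ → ℝ), IsHGamma Ω G u g w dw →
      -- density: `u` is approximated in norm by functions in `C₀^∞(Ω)`
      (∀ ε > 0, ∃ φ : Plane → ℝ, IsTestFunction Ω φ ∧
        hGammaNormSq Ω G (fun x => g x - gradient φ x)
          (fun i s => dw i s - (G.arc i).arcDeriv φ s) < ε ^ 2) ∧
      -- the continuous representatives of the traces agree at common points of the curves
      -- (different curves, or the two ends of a closed one), and vanish on the boundary of `Ω`
      ∃ W : ι → ℝ → ℝ,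
        (∀ i, ContinuousOn (W i) (Icc 0 (G.arc i).length)) ∧
        (∀ i, W i =ᵐ[volume.restrict (Ioo 0 (G.arc i).length)] w i) ∧
        (∀ i j, ∀ s ∈ Icc 0 (G.arc i).length, ∀ t ∈ Icc 0 (G.arc j).length,
          (G.arc i).toFun s = (G.arc j).toFun t → W i s = W j t) ∧
        (∀ i, ∀ s ∈ Icc 0 (G.arc i).length, (G.arc i).toFun s ∈ frontier Ω → W i s = 0) := by
  refine ⟨fun φ hφ => hφ.isHGamma G, fun u g w dw h => ?_⟩
  obtain ⟨W, hW, hWw, φ, B, hseq⟩ := h.exists_approxSeq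
  have hmatch : ∀ i j, ∀ s ∈ Icc 0 (G.arc i).length, ∀ t ∈ Icc 0 (G.arc j).length,
      (G.arc i).toFun s = (G.arc j).toFun t → W i s = W j t :=
    fun i j s hs t ht hst => hseq.trace_eq hW hs ht hst
  have hzero : ∀ i, ∀ s ∈ Icc 0 (G.arc i).length, (G.arc i).toFun s ∈ frontier Ω → W i s = 0 :=
    fun i s hs hsf => hseq.trace_eq_zero hΩ hW hs hsf
      (hLip _ ⟨mem_iUnion.2 ⟨i, s, hs, rfl⟩, hsf⟩)
  refine ⟨fun ε hε => ?_, W, fun i => (hW i).continuousOn, hWw, hmatch, hzero⟩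
  -- Matching and vanishing on the boundary, which are part of the conclusion, are also the
  -- compatibility conditions under which the traces can be reproduced with bounded energy.
  obtain ⟨M, hM⟩ := hseq.exists_bounded hW (hreg.traceApprox hΩ hG hW hmatch hzero)
  refine h.exists_test_near hΩ (M := M) (fun δ hδ => ?_) hε
  obtain ⟨Φ, h1, h2, h3, h4⟩ := hM δ hδ
  refine ⟨Φ, h1, h2, h3, fun i => le_trans (le_of_eq ?_) (h4 i)⟩
  rw [restrict_Icc_eq_Ioo]
  refine lintegral_congr_ae ?_
  filter_upwards [hWw i] with s hs
  rw [hs]
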